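/- The game is played on the square grid $\mathbb{Z}^2$, where each position has its four usual neighbors. A configuration is a finite set $C\subseteq\mathbb{Z}^2$ of occupied positions (coins). A move takes a coin $c\in C$ to a free position $p\notin C$ that has at least two neighbors in $C\setminus\{c\}$. We write $A\to B$ if $B$ can be obtained from $A$ by a finite (possibly empty) sequence of moves. The span of $C$ is $\mathrm{span}(C)=\bigcup_{i\ge 0}C_i$, where $C_0=C$ and $C_{i+1}$ is obtained from $C_i$ by adding all positions outside $C_i$ that have at least two neighbors in $C_i$. An $m\times n$ rectangle is a set $I\times J$, with $I,J$ intervals of $\mathbb{Z}$ of cardinality $m$ and $n$. We denote by $\min_C$ the smallest cardinality of a configuration with the same span as $C$. We say that $A$ has $k$ extra coins if there is $A'\subseteq A$ with $|A'|=k$ and $\mathrm{span}(A\setminus A')=\mathrm{span}(A)$. We say that $B$ has $k$ redundant coins if there are distinct $b_1,\dots,b_k\in B$ such that, for every $i$, $b_i$ has at least two neighbors in $B\setminus\{b_1,\dots,b_{i-1}\}$. \textbf{Theorem.} Let $A$ and $B$ be configurations with $|A|=|B|=N$ such that: (i) $\mathrm{span}(A)$ is a single $m\times n$ rectangle and $B\subseteq\mathrm{span}(A)$;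 (ii) $A$ has $2$ extra coins; (iii) $B$ has $2$ redundant coins; (iv) $N\ge\frac32\max(\min_A,\min_B)+2$. Then $A\to B$. -/

import Mathlib

namespace CoinPuzzle

/-- A configuration: a finite set of occupied positions of the square grid `ℤ × ℤ`. -/
abbrev Configuration := Finset (ℤ × ℤ)

/-- The four neighbors (right, left, top, bottom) of a position of the square grid. -/
def neighbors (p : ℤ × ℤ) : Finset (ℤ × ℤ) :=
  {(p.1 + 1, p.2), (p.1 - 1, p.2), (p.1, p.2 + 1), (p.1, p.2 - 1)}

/-- The number of neighbors of the position `p` that are occupied in `C`. -/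
def numNeighbors (C : Configuration) (p : ℤ × ℤ) : ℕ := (neighbors p ∩ C).card

/-- `Move A B`: one legal move leads from `A` to `B`. A coin `c` of `A` is moved to a free
position `p` which has at least two neighbors among the other coins. -/
def Move (A B : Configuration) : Prop :=
  ∃ c ∈ A, ∃ p, p ∉ A ∧ 2 ≤ numNeighbors (A.erase c) p ∧ B = insert p (A.erase c)

/-- `Reaches A B`: some finite (possibly empty) sequence of legal moves leads from `A` to `B`. -/
def Reaches (A B : Configuration) : Prop := Relation.ReflTransGen Move A B

/-- The positions outside `C` that have at least two neighbors in `C`. -/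
def adjPositions (C : Configuration) : Configuration :=
  (C.biUnion neighbors).filter fun p => p ∉ C ∧ 2 ≤ numNeighbors C p

theorem mem_neighbors_comm {p q : ℤ × ℤ} : p ∈ neighbors q ↔ q ∈ neighbors p := by
  obtain ⟨a, b⟩ := p
  obtain ⟨c, d⟩ := q
  simp only [neighbors, Finset.mem_insert, Finset.mem_singleton, Prod.mk.injEq]
  omega

theorem mem_adjPositions {C : Configuration} {p : ℤ × ℤ} :
    p ∈ adjPositions C ↔ p ∉ C ∧ 2 ≤ numNeighbors C p := by
  simp only [adjPositions, Finset.mem_filter, Finset.mem_biUnion, and_iff_right_iff_imp]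
  rintro ⟨-, h⟩
  obtain ⟨q, hq⟩ : (neighbors p ∩ C).Nonempty := by
    rw [← Finset.card_pos]
    exact lt_of_lt_of_le two_pos h
  rw [Finset.mem_inter] at hq
  exact ⟨q, hq.2, mem_neighbors_comm.1 hq.1⟩

/-- The non-decreasing sequence `C₀ = C`, `Cᵢ₊₁ = Cᵢ ∪ Adj(Cᵢ)`. -/
def spanSeq (C : Configuration) : ℕ → Configuration
  | 0 => C
  | i + 1 => spanSeq C i ∪ adjPositions (spanSeq C i)

/-- The span of `C`: the limit (union) of the sequence `spanSeq C`. -/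
def span (C : Configuration) : Set (ℤ × ℤ) := ⋃ i, (spanSeq C i : Set (ℤ × ℤ))

/-- `R` is an `m × n` rectangle: a product of two integer intervals of cardinalities `m`, `n`. -/
def IsRectangle (m n : ℕ) (R : Set (ℤ × ℤ)) : Prop :=
  ∃ a b : ℤ, R = Set.Ico a (a + m) ×ˢ Set.Ico b (b + n)

/-- The cardinality of the minimum configurations with the same span as `C`. -/
noncomputable def minCard (C : Configuration) : ℕ :=
  sInf {k | ∃ D : Configuration, span D = span C ∧ D.card = k}

/-- `A` has `k` extra coins: some `k` coins can be removed from `A` without changing the span. -/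
def HasExtraCoins (A : Configuration) (k : ℕ) : Prop :=
  ∃ A' ⊆ A, A'.card = k ∧ span (A \ A') = span A

/-- `B` has `k` redundant coins: there are distinct `b₁, …, b_k` in `B` such that each `bᵢ` has at
least two neighbors in `B \ {b₁, …, bᵢ₋₁}`. -/
def HasRedundantCoins (B : Configuration) (k : ℕ) : Prop :=
  ∃ b : Fin k → ℤ × ℤ, Function.Injective b ∧
    ∀ i, b i ∈ B ∧ 2 ≤ numNeighbors (B \ (Finset.univ.filter (· < i)).image b) (b i)

end CoinPuzzle

/-!
The span of a configuration is its *hull*, the smallest closed set containing it (`span_eq_hull`),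
and the moves are best seen as a *pebbling*: with `N` pebbles, one may put a pebble on a position
that has two pebbled neighbors, as long as fewer than `N` are on the board, and one may take pebbles
away (`Peb`). Coins that carry no pebble serve as the supply, so a pebbling with `N` pebbles can be
played with `N` coins (`Peb.reaches`). Redundant coins can be put back in the reverse order
(`HasRedundantCoins.exists_subset`). Hence it suffices to lead `A` without its extra coins to `B`
without its redundant coins; both configurations leave two of the `N` pebbles unused.

*Boxes.* Two rectangles at `ℓ¹`-distance at most two span their bounding box
(`hull_union_of_near`), while a union of rectangles at larger distances is closed
(`closed_biUnion_of_far`). So every hull is a disjoint union of far boxes (`exists_far_family`). As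
merging near boxes does not increase the sum of the half-perimeters, a box of half-perimeter `s`
needs at least `s / 2` coins (`Spans.semi_le`), and `s / 2` rounded up are enough (`exists_tight`).

*Configurations with the same hull.* If two configurations of at most `K` coins have the same hull,
then they can be transformed into each other with `K + 2` pebbles (`equi_of_hull_eq`). For a single
box (`boxConn`) this is an induction on the box, and for every box on `K`. A configuration that
spans a box can be transformed into one that consists of a configuration spanning a smaller box and
one more coin (`Spans.normalizable`). It remains to connect the different ways in which the box
grows out of a smaller one. Two of them are connected if their last coins can be added in either
order (`Conn.of_square`); this connects all of them in large and in long narrow boxes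
(`conn_ne_of_large`, `conn_top_of_narrow`). For boxes of three by three, two by four and two by
three positions, explicit sequences of steps with three coins are added, and in the remaining small
boxes there are enough pebbles to fill the whole box (`BoxConn.of_card_le`).

*Different hulls.* Playing backwards from `B`, the hull is enlarged until it is the whole rectangle
(`good_box`). The part that grows is first a single column, and then an interval of columns, which
absorbs the boxes of the hull of `B` that it touches. It can grow by one line whenever minimum
configurations of the growing box and of the remaining boxes leave enough pebbles (`Good.grow`).
Absorbing a box saves the coins spent on it except for the columns that the growing box gains.
This saving is a weight on the columns (`leftWeight`), and an interval can grow if its weight is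
large compared with its length (`ready_of_weight`). A covering argument on the line
(`interval_chain`) finds an order in which all columns can be reached, provided that the total
weight is large enough, and this is what `N ≥ 3 / 2 * max + 2` gives.
-/

namespace CoinPuzzle

/-! ### Closed sets and the hull of a set -/

theorem mem_neighbors {p q : ℤ × ℤ} : q ∈ neighbors p ↔
    (q.1 = p.1 + 1 ∧ q.2 = p.2) ∨ (q.1 = p.1 - 1 ∧ q.2 = p.2) ∨
    (q.1 = p.1 ∧ q.2 = p.2 + 1) ∨ (q.1 = p.1 ∧ q.2 = p.2 - 1) := by
  obtain ⟨a, b⟩ := p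
  obtain ⟨c, d⟩ := q
  simp only [neighbors, Finset.mem_insert, Finset.mem_singleton, Prod.mk.injEq]

theorem not_mem_neighbors_self (p : ℤ × ℤ) : p ∉ neighbors p := by
  rw [mem_neighbors]
  omega

/-- `p` has at least two neighbors in the (possibly infinite) set `S`. -/
def Supported (S : Set (ℤ × ℤ)) (p : ℤ × ℤ) : Prop :=
  ∃ q ∈ S, ∃ r ∈ S, q ≠ r ∧ q ∈ neighbors p ∧ r ∈ neighbors p

theorem Supported.mono {S T : Set (ℤ × ℤ)} {p : ℤ × ℤ} (h : Supported S p) (hST : S ⊆ T) :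
    Supported T p := by
  obtain ⟨q, hq, r, hr, h⟩ := h
  exact ⟨q, hST hq, r, hST hr, h⟩

theorem two_le_numNeighbors_iff {C : Configuration} {p : ℤ × ℤ} :
    2 ≤ numNeighbors C p ↔ Supported (C : Set (ℤ × ℤ)) p := by
  rw [numNeighbors, ← Nat.lt_iff_add_one_le, Finset.one_lt_card]
  simp only [Finset.mem_inter, Supported, Finset.mem_coe]
  constructor
  · rintro ⟨q, ⟨hq, hq'⟩, r, ⟨hr, hr'⟩, h⟩
    exact ⟨q, hq', r, hr', h, hq, hr⟩
  · rintro ⟨q, hq', r, hr', h, hq, hr⟩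
    exact ⟨q, ⟨hq, hq'⟩, r, ⟨hr, hr'⟩, h⟩

/-- A set of positions is closed if it contains every position with two neighbors in it. -/
def Closed (S : Set (ℤ × ℤ)) : Prop := ∀ p, Supported S p → p ∈ S

/-- The smallest closed set containing `S`. On finite sets this is the span, see `span_eq_hull`. -/
def hull (S : Set (ℤ × ℤ)) : Set (ℤ × ℤ) := {p | ∀ T, S ⊆ T → Closed T → p ∈ T}

theorem subset_hull (S : Set (ℤ × ℤ)) : S ⊆ hull S := fun _ hp _ hT _ => hT hp

theorem hull_subset {S T : Set (ℤ × ℤ)} (h : S ⊆ T) (hT : Closed T) : hull S ⊆ T :=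
  fun _ hp => hp T h hT

theorem closed_hull (S : Set (ℤ × ℤ)) : Closed (hull S) := by
  intro p hp T hST hT
  exact hT p (hp.mono (hull_subset hST hT))

theorem hull_mono {S T : Set (ℤ × ℤ)} (h : S ⊆ T) : hull S ⊆ hull T :=
  hull_subset (h.trans (subset_hull T)) (closed_hull T)

theorem Closed.hull_eq {S : Set (ℤ × ℤ)} (h : Closed S) : hull S = S :=
  (hull_subset subset_rfl h).antisymm (subset_hull S)

theorem hull_subset_hull {S T : Set (ℤ × ℤ)} (h : S ⊆ hull T) : hull S ⊆ hull T :=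
  hull_subset h (closed_hull T)

/-- Two sets have the same hull as soon as each lies in the hull of the other. -/
theorem hull_congr {S T : Set (ℤ × ℤ)} (h : S ⊆ hull T) (h' : T ⊆ hull S) : hull S = hull T :=
  (hull_subset_hull h).antisymm (hull_subset_hull h')

theorem hull_union_congr {S S' T T' : Set (ℤ × ℤ)} (h : hull S = hull S') (h' : hull T = hull T') :
    hull (S ∪ T) = hull (S' ∪ T') := by
  apply hull_congr <;> apply Set.union_subset
  · exact (subset_hull S).trans (h.subset.trans (hull_mono Set.subset_union_left))
  · exact (subset_hull T).trans (h'.subset.trans (hull_mono Set.subset_union_right))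
  · exact (subset_hull S').trans (h.symm.subset.trans (hull_mono Set.subset_union_left))
  · exact (subset_hull T').trans (h'.symm.subset.trans (hull_mono Set.subset_union_right))

theorem hull_hull (S : Set (ℤ × ℤ)) : hull (hull S) = hull S := (closed_hull S).hull_eq

theorem hull_nonempty_iff {S : Set (ℤ × ℤ)} : (hull S).Nonempty ↔ S.Nonempty := by
  constructor
  · rintro ⟨p, hp⟩
    by_contra h
    rw [Set.not_nonempty_iff_eq_empty] at h
    have hc : Closed (∅ : Set (ℤ × ℤ)) := fun p ⟨q, hq, _⟩ => hq.elim
    exact hp ∅ (by rw [h]) hc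
  · exact fun h => h.mono (subset_hull S)

theorem span_eq_hull (C : Configuration) : span C = hull (C : Set (ℤ × ℤ)) := by
  have mono : ∀ i, spanSeq C i ⊆ spanSeq C (i + 1) := fun i => Finset.subset_union_left
  have mono' : Monotone (spanSeq C) := monotone_nat_of_le_succ mono
  apply Set.Subset.antisymm
  · apply Set.iUnion_subset
    intro i
    induction i with
    | zero => exact subset_hull _
    | succ i ih =>
      intro p hp
      rcases Finset.mem_union.1 (Finset.mem_coe.1 hp) with hp | hp
      · exact ih hp
      · exact closed_hull _ p ((two_le_numNeighbors_iff.1 (mem_adjPositions.1 hp).2).mono ih)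
  · apply hull_subset
    · exact Set.subset_iUnion (fun i => (spanSeq C i : Set (ℤ × ℤ))) 0
    · rintro p ⟨q, hq, r, hr, hne, hqp, hrp⟩
      obtain ⟨i, hi⟩ := Set.mem_iUnion.1 hq
      obtain ⟨j, hj⟩ := Set.mem_iUnion.1 hr
      have hi' := mono' (le_max_left i j) hi
      have hj' := mono' (le_max_right i j) hj
      by_cases hp : p ∈ spanSeq C (max i j)
      · exact Set.mem_iUnion.2 ⟨_, hp⟩
      · refine Set.mem_iUnion.2 ⟨max i j + 1, ?_⟩
        exact Finset.mem_coe.2 (Finset.mem_union_right _ (mem_adjPositions.2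
          ⟨hp, two_le_numNeighbors_iff.2 ⟨q, hi', r, hj', hne, hqp, hrp⟩⟩))

/-! ### The pebbling relation -/

/-- One step of the pebbling game with `N` pebbles: put a pebble on a position with two pebbled
neighbors, if one is left, or take pebbles away. -/
def PebStep (N : ℕ) (Y Y' : Configuration) : Prop :=
  (∃ p, Supported (Y : Set (ℤ × ℤ)) p ∧ Y.card < N ∧ Y' = insert p Y) ∨ Y' ⊆ Y

/-- `Peb N Y Y'`: with `N` pebbles one gets from `Y` to `Y'`. The pebbles that are not on the board
stand for coins whose positions are irrelevant, see `Peb.reaches`. -/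
def Peb (N : ℕ) (Y Y' : Configuration) : Prop := Relation.ReflTransGen (PebStep N) Y Y'

theorem Peb.refl (N : ℕ) (Y : Configuration) : Peb N Y Y := Relation.ReflTransGen.refl

theorem Peb.trans {N : ℕ} {X Y Z : Configuration} (h : Peb N X Y) (h' : Peb N Y Z) : Peb N X Z :=
  Relation.ReflTransGen.trans h h'

theorem Peb.drop {N : ℕ} {Y Y' : Configuration} (h : Y' ⊆ Y) : Peb N Y Y' :=
  Relation.ReflTransGen.single (Or.inr h)

theorem Peb.add {N : ℕ} {Y : Configuration} {p : ℤ × ℤ} (h : Supported (Y : Set (ℤ × ℤ)) p)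
    (hY : Y.card < N) : Peb N Y (insert p Y) :=
  Relation.ReflTransGen.single (Or.inl ⟨p, h, hY, rfl⟩)

/-- Pebbles placed on an arbitrary additional set `X` do not disturb: when `X` already contains the
position a step wants to use, nothing needs to be done. -/
theorem Peb.union {N : ℕ} {Y Y' : Configuration} (h : Peb N Y Y') (X : Configuration) {M : ℕ}
    (hM : N + X.card ≤ M) : Peb M (Y ∪ X) (Y' ∪ X) := by
  induction h with
  | refl => exact Peb.refl _ _
  | tail _ h ih =>
    refine ih.trans ?_
    rcases h with ⟨p, hp, hc, rfl⟩ | h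
    · rw [Finset.insert_union]
      apply Peb.add (hp.mono (by simp))
      have := Finset.card_union_le (by assumption) X
      omega
    · exact Peb.drop (Finset.union_subset_union_left h)

theorem Peb.mono {N M : ℕ} {Y Y' : Configuration} (h : Peb N Y Y') (hM : N ≤ M) : Peb M Y Y' := by
  simpa using h.union ∅ (M := M) (by simpa using hM)

theorem Peb.insert_congr {N : ℕ} {Y Y' : Configuration} (h : Peb N Y Y') (x : ℤ × ℤ) {M : ℕ}
    (hM : N + 1 ≤ M) : Peb M (insert x Y) (insert x Y') := by
  have := h.union {x} (M := M) (by simpa using hM)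
  simpa [Finset.union_comm, ← Finset.insert_eq] using this

/-- A pebbling with `N` pebbles is realized by moves of `N` coins: whenever a pebble is put on a
free position, a coin that carries no pebble moves there. -/
theorem Peb.reaches {N : ℕ} {Y Y' : Configuration} (h : Peb N Y Y') {C : Configuration}
    (hC : C.card = N) (hY : Y ⊆ C) : ∃ C', C'.card = N ∧ Y' ⊆ C' ∧ Reaches C C' := by
  induction h with
  | refl => exact ⟨C, hC, hY, Relation.ReflTransGen.refl⟩
  | @tail Z Z' _ h ih =>
    obtain ⟨C', hC', hZ, hr⟩ := ih
    rcases h with ⟨p, hp, hc, rfl⟩ | h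
    · by_cases hpC : p ∈ C'
      · exact ⟨C', hC', Finset.insert_subset hpC hZ, hr⟩
      · obtain ⟨c, hcC, hcZ⟩ := Finset.exists_mem_notMem_of_card_lt_card (hC' ▸ hc)
        have hsub : Z ⊆ C'.erase c := Finset.subset_erase.2 ⟨hZ, hcZ⟩
        have hp' : p ∉ C'.erase c := fun hh => hpC (Finset.mem_of_mem_erase hh)
        refine ⟨insert p (C'.erase c), ?_, Finset.insert_subset_insert _ hsub, hr.tail
          ⟨c, hcC, p, hpC, two_le_numNeighbors_iff.2 (hp.mono (by exact_mod_cast hsub)), rfl⟩⟩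
        rw [Finset.card_insert_of_notMem hp', Finset.card_erase_add_one hcC, hC']
    · exact ⟨C', hC', h.trans hZ, hr⟩

/-- Pebbles can be put on all positions of a subset of the hull, if there are enough of them. -/
theorem Peb.fill {N : ℕ} {Y Z : Configuration} (hYZ : Y ⊆ Z)
    (hZ : (Z : Set (ℤ × ℤ)) = hull Y) (hN : Z.card ≤ N) : Peb N Y Z := by
  obtain ⟨n, hn⟩ : ∃ n, n = (Z \ Y).card := ⟨_, rfl⟩
  induction n generalizing Y with
  | zero =>
    have : Z ⊆ Y := Finset.sdiff_eq_empty_iff_subset.1 (Finset.card_eq_zero.1 hn.symm)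
    rw [hYZ.antisymm this]
    exact Peb.refl _ _
  | succ n ih =>
    have hne : (Z \ Y).Nonempty := Finset.card_pos.1 (by omega)
    have hnc : ¬ Closed (Y : Set (ℤ × ℤ)) := by
      intro hc
      rw [hc.hull_eq] at hZ
      rw [Finset.coe_inj.1 hZ] at hne
      simp at hne
    simp only [Closed, not_forall] at hnc
    obtain ⟨p, hp, hpY⟩ := hnc
    have hpZ : p ∈ Z := by
      rw [← Finset.mem_coe, hZ]
      exact closed_hull _ p (hp.mono (subset_hull _))
    have hsub : insert p Y ⊆ Z := Finset.insert_subset hpZ hYZ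
    have hcard := Finset.card_le_card hsub
    rw [Finset.card_insert_of_notMem (by simpa using hpY)] at hcard
    refine (Peb.add hp (by omega)).trans (ih hsub ?_ ?_)
    · rw [hZ]
      apply hull_congr
      · exact (subset_hull _).trans (hull_mono (by simp))
      · intro q hq
        rcases Finset.mem_insert.1 (Finset.mem_coe.1 hq) with rfl | hq
        · rw [← hZ]; exact hpZ
        · exact subset_hull _ hq
    · have : Z \ insert p Y = (Z \ Y).erase p := by
        ext q; simp only [Finset.mem_sdiff, Finset.mem_insert, Finset.mem_erase]; tauto
      rw [this, Finset.card_erase_of_mem (Finset.mem_sdiff.2 ⟨hpZ, by simpa using hpY⟩)]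
      omega

/-! ### Boxes -/

/-- A box: a nonempty rectangle of the grid with columns `l, …, r` and rows `b, …, t`. -/
@[ext] structure Box where
  l : ℤ
  r : ℤ
  b : ℤ
  t : ℤ
  hlr : l ≤ r
  hbt : b ≤ t

namespace Box

/-- The set of positions of a box. -/
def cells (Q : Box) : Set (ℤ × ℤ) := {p | Q.l ≤ p.1 ∧ p.1 ≤ Q.r ∧ Q.b ≤ p.2 ∧ p.2 ≤ Q.t}

theorem mem_cells {Q : Box} {p : ℤ × ℤ} :
    p ∈ Q.cells ↔ Q.l ≤ p.1 ∧ p.1 ≤ Q.r ∧ Q.b ≤ p.2 ∧ p.2 ≤ Q.t := Iff.rfl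

/-- The half-perimeter of a box. -/
def semi (Q : Box) : ℤ := (Q.r - Q.l) + (Q.t - Q.b) + 2

/-- The box consisting of one position. -/
def single (p : ℤ × ℤ) : Box := ⟨p.1, p.1, p.2, p.2, le_rfl, le_rfl⟩

/-- The bounding box of two boxes. -/
def join (P Q : Box) : Box :=
  ⟨min P.l Q.l, max P.r Q.r, min P.b Q.b, max P.t Q.t,
    by have := P.hlr; have := Q.hlr; omega, by have := P.hbt; have := Q.hbt; omega⟩

/-- Two boxes are near if their `ℓ¹`-distance is at most two. These are the pairs of boxes whose
union spans their bounding box, see `hull_union_of_near`. -/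
def Near (P Q : Box) : Prop :=
  max (max (Q.l - P.r) (P.l - Q.r)) 0 + max (max (Q.b - P.t) (P.b - Q.t)) 0 ≤ 2

theorem near_comm {P Q : Box} : Near P Q ↔ Near Q P := by
  simp only [Near]
  omega

theorem join_comm (P Q : Box) : join P Q = join Q P := by
  simp only [join, Box.mk.injEq]
  omega

theorem join_left_comm (P Q R : Box) : join (join P Q) R = join Q (join P R) := by
  simp only [join, Box.mk.injEq]
  omega

theorem near_of_mem {P Q : Box} {p q : ℤ × ℤ} (hp : p ∈ P.cells) (hq : q ∈ Q.cells)
    (h : |p.1 - q.1| + |p.2 - q.2| ≤ 2) : Near P Q := by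
  rw [mem_cells] at hp hq
  simp only [abs, Near] at *
  omega

theorem Near.exists_mem {P Q : Box} (h : Near P Q) :
    ∃ p ∈ P.cells, ∃ q ∈ Q.cells, |p.1 - q.1| + |p.2 - q.2| ≤ 2 := by
  have := P.hlr; have := Q.hlr; have := P.hbt; have := Q.hbt
  refine ⟨(min (max Q.l P.l) P.r, min (max Q.b P.b) P.t), ?_,
    (min (max P.l Q.l) Q.r, min (max P.b Q.b) Q.t), ?_, ?_⟩
  · simp only [mem_cells]; omega
  · simp only [mem_cells]; omega
  · simp only [Near, abs] at *
    omega

theorem cells_subset_iff {P Q : Box} :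
    P.cells ⊆ Q.cells ↔ Q.l ≤ P.l ∧ P.r ≤ Q.r ∧ Q.b ≤ P.b ∧ P.t ≤ Q.t := by
  have := P.hlr; have := P.hbt
  constructor
  · intro h
    have h1 := h (show (P.l, P.b) ∈ P.cells by simp only [mem_cells]; omega)
    have h2 := h (show (P.r, P.t) ∈ P.cells by simp only [mem_cells]; omega)
    simp only [mem_cells] at h1 h2
    omega
  · intro h p
    simp only [mem_cells]
    omega

theorem Near.mono {P P' Q : Box} (h : Near P Q) (hP : P.cells ⊆ P'.cells) : Near P' Q := by
  rw [cells_subset_iff] at hP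
  simp only [Near] at *
  omega

theorem cells_injective {P Q : Box} (h : P.cells = Q.cells) : P = Q := by
  have h1 := cells_subset_iff.1 h.subset
  have h2 := cells_subset_iff.1 h.symm.subset
  ext <;> omega

theorem cells_nonempty (Q : Box) : Q.cells.Nonempty :=
  ⟨(Q.l, Q.b), by have := Q.hlr; have := Q.hbt; simp only [mem_cells]; omega⟩

theorem cells_single (p : ℤ × ℤ) : (single p).cells = {p} := by
  ext q
  simp only [mem_cells, single, Set.mem_singleton_iff, Prod.ext_iff]
  omega

theorem left_subset_join (P Q : Box) : P.cells ⊆ (join P Q).cells := by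
  rw [cells_subset_iff]; simp only [join]; omega

theorem right_subset_join (P Q : Box) : Q.cells ⊆ (join P Q).cells := by
  rw [cells_subset_iff]; simp only [join]; omega

theorem semi_lt_of_subset {P Q : Box} (h : P.cells ⊆ Q.cells) (hne : P ≠ Q) : P.semi < Q.semi := by
  have h := cells_subset_iff.1 h
  by_contra hc
  apply hne
  simp only [semi] at hc
  ext <;> omega

theorem semi_join_le {P Q : Box} (h : Near P Q) : (join P Q).semi ≤ P.semi + Q.semi := by
  have := P.hlr; have := Q.hlr; have := P.hbt; have := Q.hbt
  simp only [semi, join, Near] at *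
  omega

theorem closed_cells (Q : Box) : Closed Q.cells := by
  rintro p ⟨q, hq, r, hr, hne, hqp, hrp⟩
  rw [mem_neighbors] at hqp hrp
  rw [Ne, Prod.ext_iff] at hne
  simp only [mem_cells] at *
  omega

end Box

open Box

/-- If a closed set contains a segment of a column and one position beside it, then it contains the
whole segment beside it. -/
theorem Closed.column {S : Set (ℤ × ℤ)} (hS : Closed S) {x x' b t j : ℤ}
    (hx : x' = x + 1 ∨ x' = x - 1)
    (h : ∀ k, b ≤ k → k ≤ t → (x, k) ∈ S) (hj : (x', j) ∈ S) (hbj : b ≤ j) (hjt : j ≤ t) :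
    ∀ k, b ≤ k → k ≤ t → (x', k) ∈ S := by
  have up : ∀ n : ℕ, j + n ≤ t → (x', j + n) ∈ S := by
    intro n
    induction n with
    | zero => intro _; simpa using hj
    | succ n ih =>
      intro hn
      have hn' : j + n ≤ t := by push_cast at hn; omega
      refine hS _ ⟨_, h (j + (n + 1 : ℕ)) (by push_cast; omega) hn, _, ih hn', ?_, ?_, ?_⟩
      · simp only [Ne, Prod.mk.injEq]; omega
      · rw [mem_neighbors]; dsimp only; omega
      · rw [mem_neighbors]; dsimp only; omega
  have down : ∀ n : ℕ, b ≤ j - n → (x', j - n) ∈ S := by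
    intro n
    induction n with
    | zero => intro _; simpa using hj
    | succ n ih =>
      intro hn
      have hn' : b ≤ j - n := by push_cast at hn; omega
      refine hS _ ⟨_, h (j - (n + 1 : ℕ)) hn (by push_cast; omega), _, ih hn', ?_, ?_, ?_⟩
      · simp only [Ne, Prod.mk.injEq]; omega
      · rw [mem_neighbors]; dsimp only; omega
      · rw [mem_neighbors]; dsimp only; omega
  intro k hbk hkt
  rcases le_total j k with hjk | hjk
  · have := up (k - j).toNat (by omega)
    rwa [show j + ((k - j).toNat : ℤ) = k by omega] at this
  · have := down (j - k).toNat (by omega)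
    rwa [show j - ((j - k).toNat : ℤ) = k by omega] at this

/-- The reflection of `Closed.column` at the diagonal. -/
theorem Closed.row {S : Set (ℤ × ℤ)} (hS : Closed S) {y y' l r j : ℤ} (hy : y' = y + 1 ∨ y' = y - 1)
    (h : ∀ k, l ≤ k → k ≤ r → (k, y) ∈ S) (hj : (j, y') ∈ S) (hlj : l ≤ j) (hjr : j ≤ r) :
    ∀ k, l ≤ k → k ≤ r → (k, y') ∈ S := by
  have hT : Closed (Prod.swap ⁻¹' S) := by
    rintro p ⟨q, hq, q', hq', hne, h1, h2⟩
    refine hS _ ⟨_, hq, _, hq', Prod.swap_injective.ne hne, ?_, ?_⟩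
    · rw [mem_neighbors] at *
      simp only [Prod.fst_swap, Prod.snd_swap]
      omega
    · rw [mem_neighbors] at *
      simp only [Prod.fst_swap, Prod.snd_swap]
      omega
  exact hT.column (x := y) (x' := y') (b := l) (t := r) (j := j) hy h hj hlj hjr

/-- A closed set containing two near boxes contains their bounding box: the first box can be
enlarged by one line at a time towards the second one. -/
theorem Closed.join_subset {S : Set (ℤ × ℤ)} (hS : Closed S) {P Q : Box} (hP : P.cells ⊆ S)
    (hQ : Q.cells ⊆ S) (h : Near P Q) : (join P Q).cells ⊆ S := by
  obtain ⟨n, hn⟩ : ∃ n : ℕ, (join P Q).semi - P.semi ≤ n := ⟨_, Int.self_le_toNat _⟩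
  induction n generalizing P with
  | zero =>
    have : P = join P Q := by
      by_contra hne
      have := semi_lt_of_subset (left_subset_join P Q) hne
      omega
    rwa [← this]
  | succ n ih =>
    have hP1 := P.hlr; have hP2 := P.hbt; have hQ1 := Q.hlr; have hQ2 := Q.hbt
    have mP : ∀ x y, P.l ≤ x → x ≤ P.r → P.b ≤ y → y ≤ P.t → (x, y) ∈ S :=
      fun x y h1 h2 h3 h4 => hP ⟨h1, h2, h3, h4⟩
    have mQ : ∀ x y, Q.l ≤ x → x ≤ Q.r → Q.b ≤ y → y ≤ Q.t → (x, y) ∈ S :=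
      fun x y h1 h2 h3 h4 => hQ ⟨h1, h2, h3, h4⟩
    -- the induction hypothesis, for a box between `P` and the bounding box
    have ext : ∀ P' : Box, P'.cells ⊆ S → P.cells ⊆ P'.cells → P'.cells ⊆ (join P Q).cells →
        P ≠ P' → (join P Q).cells ⊆ S := by
      intro P' h1 h2 h3 h4
      have hlt := semi_lt_of_subset h2 h4
      rw [cells_subset_iff] at h2 h3
      have hj : join P' Q = join P Q := by
        simp only [join, Box.mk.injEq] at *
        omega
      rw [← hj]
      apply ih h1
      · simp only [Near] at *
        omega
      · rw [hj]; omega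
    have extR : ∀ j, P.b ≤ j → j ≤ P.t → (P.r + 1, j) ∈ S → P.r < Q.r → (join P Q).cells ⊆ S := by
      intro j h1 h2 h3 h4
      have hc := hS.column (x := P.r) (.inl rfl) (fun k hk hk' => mP _ k hP1 le_rfl hk hk') h3 h1 h2
      refine ext ⟨P.l, P.r + 1, P.b, P.t, by omega, hP2⟩ ?_ ?_ ?_ ?_
      · rintro ⟨x, y⟩ ⟨hx, hx', hy, hy'⟩
        rcases eq_or_lt_of_le hx' with h | h
        · have h : x = P.r + 1 := h
          exact h ▸ hc y hy hy'
        · exact mP x y hx (Int.lt_add_one_iff.1 h) hy hy'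
      · rw [cells_subset_iff]; dsimp only; omega
      · rw [cells_subset_iff]; simp only [join]; omega
      · intro h; have := congrArg Box.r h; dsimp only at this; omega
    have extL : ∀ j, P.b ≤ j → j ≤ P.t → (P.l - 1, j) ∈ S → Q.l < P.l → (join P Q).cells ⊆ S := by
      intro j h1 h2 h3 h4
      have hc := hS.column (x := P.l) (.inr rfl) (fun k hk hk' => mP _ k le_rfl hP1 hk hk') h3 h1 h2
      refine ext ⟨P.l - 1, P.r, P.b, P.t, by omega, hP2⟩ ?_ ?_ ?_ ?_
      · rintro ⟨x, y⟩ ⟨hx, hx', hy, hy'⟩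
        rcases eq_or_lt_of_le hx with h | h
        · have h : P.l - 1 = x := h
          exact h ▸ hc y hy hy'
        · exact mP x y (by dsimp only at h; omega) hx' hy hy'
      · rw [cells_subset_iff]; dsimp only; omega
      · rw [cells_subset_iff]; simp only [join]; omega
      · intro h; have := congrArg Box.l h; dsimp only at this; omega
    have extU : ∀ j, P.l ≤ j → j ≤ P.r → (j, P.t + 1) ∈ S → P.t < Q.t → (join P Q).cells ⊆ S := by
      intro j h1 h2 h3 h4
      have hc := hS.row (y := P.t) (.inl rfl) (fun k hk hk' => mP k _ hk hk' hP2 le_rfl) h3 h1 h2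
      refine ext ⟨P.l, P.r, P.b, P.t + 1, hP1, by omega⟩ ?_ ?_ ?_ ?_
      · rintro ⟨x, y⟩ ⟨hx, hx', hy, hy'⟩
        rcases eq_or_lt_of_le hy' with h | h
        · have h : y = P.t + 1 := h
          exact h ▸ hc x hx hx'
        · exact mP x y hx hx' hy (Int.lt_add_one_iff.1 h)
      · rw [cells_subset_iff]; dsimp only; omega
      · rw [cells_subset_iff]; simp only [join]; omega
      · intro h; have := congrArg Box.t h; dsimp only at this; omega
    have extD : ∀ j, P.l ≤ j → j ≤ P.r → (j, P.b - 1) ∈ S → Q.b < P.b → (join P Q).cells ⊆ S := by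
      intro j h1 h2 h3 h4
      have hc := hS.row (y := P.b) (.inr rfl) (fun k hk hk' => mP k _ hk hk' le_rfl hP2) h3 h1 h2
      refine ext ⟨P.l, P.r, P.b - 1, P.t, hP1, by omega⟩ ?_ ?_ ?_ ?_
      · rintro ⟨x, y⟩ ⟨hx, hx', hy, hy'⟩
        rcases eq_or_lt_of_le hy with h | h
        · have h : P.b - 1 = y := h
          exact h ▸ hc x hx hx'
        · exact mP x y hx hx' (by dsimp only at h; omega) hy'
      · rw [cells_subset_iff]; dsimp only; omega
      · rw [cells_subset_iff]; simp only [join]; omega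
      · intro h; have := congrArg Box.b h; dsimp only at this; omega
    -- a position with two given neighbors in `S`
    have sup : ∀ x y x₁ y₁ x₂ y₂, (x₁, y₁) ∈ S → (x₂, y₂) ∈ S → (x₁ ≠ x₂ ∨ y₁ ≠ y₂) →
        (x₁, y₁) ∈ neighbors (x, y) → (x₂, y₂) ∈ neighbors (x, y) → (x, y) ∈ S := by
      intro x y x₁ y₁ x₂ y₂ h1 h2 hne hn1 hn2
      exact hS _ ⟨_, h1, _, h2, by simp only [Ne, Prod.mk.injEq]; omega, hn1, hn2⟩
    simp only [mem_neighbors] at sup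
    simp only [Near] at h
    have horiz : max P.b Q.b ≤ min P.t Q.t → P.r < Q.r ∨ Q.l < P.l → (join P Q).cells ⊆ S := by
      rintro hrow (hr | hl)
      · apply extR (max P.b Q.b) (by omega) (by omega) _ hr
        by_cases hc : Q.l ≤ P.r + 1
        · exact mQ _ _ (by omega) (by omega) (by omega) (by omega)
        · exact sup _ _ P.r (max P.b Q.b) (P.r + 2) (max P.b Q.b)
            (mP _ _ (by omega) (by omega) (by omega) (by omega))
            (mQ _ _ (by omega) (by omega) (by omega) (by omega)) (by omega) (by omega) (by omega)
      · apply extL (max P.b Q.b) (by omega) (by omega) _ hl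
        by_cases hc : P.l - 1 ≤ Q.r
        · exact mQ _ _ (by omega) (by omega) (by omega) (by omega)
        · exact sup _ _ P.l (max P.b Q.b) (P.l - 2) (max P.b Q.b)
            (mP _ _ (by omega) (by omega) (by omega) (by omega))
            (mQ _ _ (by omega) (by omega) (by omega) (by omega)) (by omega) (by omega) (by omega)
    have vert : max P.l Q.l ≤ min P.r Q.r → P.t < Q.t ∨ Q.b < P.b → (join P Q).cells ⊆ S := by
      rintro hrow (hr | hl)
      · apply extU (max P.l Q.l) (by omega) (by omega) _ hr
        by_cases hc : Q.b ≤ P.t + 1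
        · exact mQ _ _ (by omega) (by omega) (by omega) (by omega)
        · exact sup _ _ (max P.l Q.l) P.t (max P.l Q.l) (P.t + 2)
            (mP _ _ (by omega) (by omega) (by omega) (by omega))
            (mQ _ _ (by omega) (by omega) (by omega) (by omega)) (by omega) (by omega) (by omega)
      · apply extD (max P.l Q.l) (by omega) (by omega) _ hl
        by_cases hc : P.b - 1 ≤ Q.t
        · exact mQ _ _ (by omega) (by omega) (by omega) (by omega)
        · exact sup _ _ (max P.l Q.l) P.b (max P.l Q.l) (P.b - 2)
            (mP _ _ (by omega) (by omega) (by omega) (by omega))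
            (mQ _ _ (by omega) (by omega) (by omega) (by omega)) (by omega) (by omega) (by omega)
    by_cases hrow : max P.b Q.b ≤ min P.t Q.t
    · by_cases hh : P.r < Q.r ∨ Q.l < P.l
      · exact horiz hrow hh
      · by_cases hv : P.t < Q.t ∨ Q.b < P.b
        · exact vert (by omega) hv
        · refine (cells_subset_iff.2 ?_).trans hP
          simp only [join]
          omega
    · by_cases hcol : max P.l Q.l ≤ min P.r Q.r
      · exact vert hcol (by omega)
      · -- the boxes touch diagonally
        rcases lt_or_ge P.r Q.l with hr | hr <;> rcases lt_or_ge P.t Q.b with ht | ht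
        · exact extR P.t hP2 le_rfl (sup _ _ P.r P.t (P.r + 1) (P.t + 1)
            (mP _ _ (by omega) (by omega) (by omega) (by omega))
            (mQ _ _ (by omega) (by omega) (by omega) (by omega)) (by omega) (by omega) (by omega))
            (by omega)
        · exact extR P.b le_rfl hP2 (sup _ _ P.r P.b (P.r + 1) (P.b - 1)
            (mP _ _ (by omega) (by omega) (by omega) (by omega))
            (mQ _ _ (by omega) (by omega) (by omega) (by omega)) (by omega) (by omega) (by omega))
            (by omega)
        · exact extL P.t hP2 le_rfl (sup _ _ P.l P.t (P.l - 1) (P.t + 1)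
            (mP _ _ (by omega) (by omega) (by omega) (by omega))
            (mQ _ _ (by omega) (by omega) (by omega) (by omega)) (by omega) (by omega) (by omega))
            (by omega)
        · exact extL P.b le_rfl hP2 (sup _ _ P.l P.b (P.l - 1) (P.b - 1)
            (mP _ _ (by omega) (by omega) (by omega) (by omega))
            (mQ _ _ (by omega) (by omega) (by omega) (by omega)) (by omega) (by omega) (by omega))
            (by omega)

theorem hull_union_of_near {P Q : Box} (h : Near P Q) :
    hull (P.cells ∪ Q.cells) = (join P Q).cells := by
  apply Set.Subset.antisymm
  · exact hull_subset (Set.union_subset (left_subset_join P Q) (right_subset_join P Q))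
      (closed_cells _)
  · exact (closed_hull _).join_subset (Set.subset_union_left.trans (subset_hull _))
      (Set.subset_union_right.trans (subset_hull _)) h

/-! ### Clusters: how a configuration spans a box -/

/-- `Y` spans the box `Q`. -/
def Spans (Y : Configuration) (Q : Box) : Prop := hull (Y : Set (ℤ × ℤ)) = Q.cells

theorem Spans.subset {Y : Configuration} {Q : Box} (h : Spans Y Q) :
    (Y : Set (ℤ × ℤ)) ⊆ Q.cells := (subset_hull _).trans (Eq.subset h)

theorem Spans.unique {Y : Configuration} {P Q : Box} (h : Spans Y P) (h' : Spans Y Q) : P = Q :=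
  cells_injective (h.symm.trans h')

theorem Spans.nonempty {Y : Configuration} {Q : Box} (h : Spans Y Q) : Y.Nonempty := by
  have := Q.cells_nonempty
  rw [← h, hull_nonempty_iff] at this
  exact_mod_cast this

theorem spans_singleton (p : ℤ × ℤ) : Spans {p} (single p) := by
  have h := closed_cells (single p)
  rw [cells_single] at h
  rw [Spans, cells_single, Finset.coe_singleton, h.hull_eq]

theorem Spans.eq_singleton {Y : Configuration} {p : ℤ × ℤ} (h : Spans Y (single p)) : Y = {p} := by
  have hs := h.subset
  rw [cells_single] at hs
  exact Finset.Nonempty.subset_singleton_iff h.nonempty |>.1 (by exact_mod_cast hs)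

theorem Spans.union {Y Z : Configuration} {P Q : Box} (hY : Spans Y P) (hZ : Spans Z Q)
    (h : Near P Q) : Spans (Y ∪ Z) (join P Q) := by
  rw [Spans, ← hull_union_of_near h, Finset.coe_union]
  exact hull_union_congr (hY.trans (closed_cells P).hull_eq.symm)
    (hZ.trans (closed_cells Q).hull_eq.symm)

/-- Between `Y` and its hull nothing changes the hull. -/
theorem Spans.of_subset {Y Z : Configuration} {Q : Box} (h : Spans Y Q) (hYZ : Y ⊆ Z)
    (hZ : (Z : Set (ℤ × ℤ)) ⊆ Q.cells) : Spans Z Q :=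
  (hull_subset hZ (closed_cells Q)).antisymm
    (h.symm.subset.trans (hull_mono (by exact_mod_cast hYZ)))

/-- A union of closed subsets of pairwise far boxes is closed. -/
theorem closed_biUnion_of_far {𝓠 : Set Box} (hfar : ∀ P ∈ 𝓠, ∀ Q ∈ 𝓠, Near P Q → P = Q)
    {S : Box → Set (ℤ × ℤ)} (hS : ∀ Q ∈ 𝓠, S Q ⊆ Q.cells) (hc : ∀ Q ∈ 𝓠, Closed (S Q)) :
    Closed (⋃ Q ∈ 𝓠, S Q) := by
  rintro p ⟨q, hq, r, hr, hne, hqp, hrp⟩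
  simp only [Set.mem_iUnion] at *
  obtain ⟨P, hP, hqP⟩ := hq
  obtain ⟨Q, hQ, hrQ⟩ := hr
  have hnear : Near P Q := by
    apply near_of_mem (hS P hP hqP) (hS Q hQ hrQ)
    rw [mem_neighbors] at hqp hrp
    simp only [abs]
    omega
  obtain rfl := hfar P hP Q hQ hnear
  exact ⟨P, hP, hc P hP p ⟨q, hqP, r, hrQ, hne, hqp, hrp⟩⟩

/-- A configuration splits into disjoint clusters, each spanning a box with the property `ok`, such
that two near boxes have a bounding box without this property: merge clusters while possible. -/
theorem exists_clusters (Y : Configuration) (ok : Box → Prop) (h : ∀ p ∈ Y, ok (single p)) :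
    ∃ F : Finset Configuration, F.biUnion id = Y ∧ (F : Set Configuration).PairwiseDisjoint id ∧
      (∀ Z ∈ F, ∃ Q, Spans Z Q ∧ ok Q) ∧
      ∀ Z ∈ F, ∀ Z' ∈ F, Z ≠ Z' → ∀ Q Q', Spans Z Q → Spans Z' Q' → Near Q Q' →
        ¬ ok (join Q Q') := by
  obtain ⟨F, ⟨hY, hd, hok⟩, hmin⟩ := (InvImage.wf (Finset.card (α := Configuration))
    wellFounded_lt).has_min {F | F.biUnion id = Y ∧ (F : Set Configuration).PairwiseDisjoint id ∧
      ∀ Z ∈ F, ∃ Q, Spans Z Q ∧ ok Q} ⟨Y.image singleton, by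
        refine ⟨?_, ?_, ?_⟩
        · ext p
          simp only [Finset.mem_biUnion, Finset.mem_image, id]
          constructor
          · rintro ⟨_, ⟨q, hq, rfl⟩, hp⟩
            rwa [Finset.mem_singleton.1 hp]
          · exact fun hp => ⟨{p}, ⟨p, hp, rfl⟩, Finset.mem_singleton_self p⟩
        · intro Z hZ Z' hZ' hne
          simp only [Finset.coe_image, Set.mem_image, Finset.mem_coe] at hZ hZ'
          obtain ⟨p, -, rfl⟩ := hZ
          obtain ⟨q, -, rfl⟩ := hZ'
          simpa [Function.onFun, eq_comm] using hne
        · intro Z hZ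
          obtain ⟨p, hp, rfl⟩ := Finset.mem_image.1 hZ
          exact ⟨_, spans_singleton p, h p hp⟩⟩
  refine ⟨F, hY, hd, hok, ?_⟩
  intro Z hZ Z' hZ' hne Q Q' hQ hQ' hnear hj
  refine hmin (insert (Z ∪ Z') ((F.erase Z).erase Z')) ⟨?_, ?_, ?_⟩ ?_
  · rw [← hY]
    ext p
    simp only [Finset.mem_biUnion, Finset.mem_insert, Finset.mem_erase, id]
    constructor
    · rintro ⟨W, rfl | hW, hp⟩
      · rcases Finset.mem_union.1 hp with hp | hp
        · exact ⟨Z, hZ, hp⟩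
        · exact ⟨Z', hZ', hp⟩
      · exact ⟨W, hW.2.2, hp⟩
    · rintro ⟨W, hW, hp⟩
      by_cases h1 : W = Z
      · exact ⟨_, .inl rfl, Finset.mem_union_left _ (h1 ▸ hp)⟩
      · by_cases h2 : W = Z'
        · exact ⟨_, .inl rfl, Finset.mem_union_right _ (h2 ▸ hp)⟩
        · exact ⟨W, .inr ⟨h2, h1, hW⟩, hp⟩
  · rw [Finset.coe_insert, Set.pairwiseDisjoint_insert]
    refine ⟨hd.subset (by intro W hW; simp at hW; exact hW.1.1), ?_⟩
    intro W hW _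
    simp only [Finset.coe_erase, Set.mem_sdiff, Finset.mem_coe, Set.mem_singleton_iff] at hW
    exact Finset.disjoint_union_left.2 ⟨hd hZ hW.1.1 (Ne.symm hW.1.2), hd hZ' hW.1.1 (Ne.symm hW.2)⟩
  · intro W hW
    rcases Finset.mem_insert.1 hW with rfl | hW
    · exact ⟨_, hQ.union hQ' hnear, hj⟩
    · exact hok W (Finset.mem_of_mem_erase (Finset.mem_of_mem_erase hW))
  · have h1 := Finset.card_erase_add_one hZ
    have h2 := Finset.card_erase_add_one (Finset.mem_erase.2 ⟨Ne.symm hne, hZ'⟩)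
    have h3 := Finset.card_insert_le (Z ∪ Z') ((F.erase Z).erase Z')
    simp only [InvImage]
    omega

/-- A configuration spanning more than one position contains two disjoint configurations that span
smaller boxes which merge into the whole box. -/
theorem Spans.exists_split {Y : Configuration} {Q : Box} (h : Spans Y Q) (hQ : 2 < Q.semi) :
    ∃ Y₁ Y₂ Q₁ Q₂, Y₁ ∪ Y₂ ⊆ Y ∧ Disjoint Y₁ Y₂ ∧ Spans Y₁ Q₁ ∧ Spans Y₂ Q₂ ∧ Near Q₁ Q₂ ∧
      join Q₁ Q₂ = Q ∧ Q₁ ≠ Q ∧ Q₂ ≠ Q := by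
  obtain ⟨F, hY, hd, hok, hjoin⟩ := exists_clusters Y (· ≠ Q) (by
    rintro p - rfl
    simp [Box.semi, single] at hQ)
  by_contra hno
  have hsub : ∀ Z ∈ F, Z ⊆ Y := fun Z hZ => hY ▸ Finset.subset_biUnion_of_mem id hZ
  have hfar : ∀ Z ∈ F, ∀ Z' ∈ F, ∀ P P', Spans Z P → Spans Z' P' → Near P P' → Z = Z' := by
    intro Z hZ Z' hZ' P P' hP hP' hnear
    by_contra hne
    obtain ⟨R, hR, hR'⟩ := hok Z hZ
    obtain ⟨R', hS, hS'⟩ := hok Z' hZ'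
    rw [hP.unique hR, hP'.unique hS] at hnear
    exact hno ⟨Z, Z', R, R', Finset.union_subset (hsub Z hZ) (hsub Z' hZ'), hd hZ hZ' hne, hR, hS,
      hnear, not_not.1 (hjoin Z hZ Z' hZ' hne R R' hR hS hnear), hR', hS'⟩
  obtain ⟨p, hp⟩ := h.nonempty
  rw [← hY, Finset.mem_biUnion] at hp
  obtain ⟨Z, hZ, -⟩ := hp
  obtain ⟨P, hP, hPQ⟩ := hok Z hZ
  have hPQ' : P.cells ⊆ Q.cells := by
    rw [← hP, ← h]; exact hull_mono (by exact_mod_cast hsub Z hZ)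
  -- some position of `Q` outside `P` is adjacent to `P`
  obtain ⟨p, hp, q, hq, hqP, hpq⟩ : ∃ p ∈ P.cells, ∃ q ∈ Q.cells, q ∉ P.cells ∧
      |p.1 - q.1| + |p.2 - q.2| ≤ 2 := by
    have h1 := P.hlr; have h2 := P.hbt
    rw [cells_subset_iff] at hPQ'
    by_cases hr : P.r < Q.r
    · exact ⟨(P.r, P.b), by simp only [mem_cells]; omega, (P.r + 1, P.b),
        by simp only [mem_cells]; omega, by simp only [mem_cells]; omega,
        by simp only [abs]; omega⟩
    by_cases hl : Q.l < P.l
    · exact ⟨(P.l, P.b), by simp only [mem_cells]; omega, (P.l - 1, P.b),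
        by simp only [mem_cells]; omega, by simp only [mem_cells]; omega,
        by simp only [abs]; omega⟩
    by_cases ht : P.t < Q.t
    · exact ⟨(P.l, P.t), by simp only [mem_cells]; omega, (P.l, P.t + 1),
        by simp only [mem_cells]; omega, by simp only [mem_cells]; omega,
        by simp only [abs]; omega⟩
    by_cases hb : Q.b < P.b
    · exact ⟨(P.l, P.b), by simp only [mem_cells]; omega, (P.l, P.b - 1),
        by simp only [mem_cells]; omega, by simp only [mem_cells]; omega,
        by simp only [abs]; omega⟩
    exact (hPQ (by ext <;> omega)).elim
  have hc := closed_biUnion_of_far (𝓠 := {R | ∃ Z ∈ F, Spans Z R}) (S := Box.cells) (by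
    rintro R ⟨W, hW, hR⟩ R' ⟨W', hW', hR'⟩ hnear
    obtain rfl := hfar W hW W' hW' R R' hR hR' hnear
    exact hR.unique hR') (fun _ _ => subset_rfl) (fun R _ => closed_cells R)
  have hYc : (Y : Set (ℤ × ℤ)) ⊆ ⋃ R ∈ {R | ∃ Z ∈ F, Spans Z R}, R.cells := by
    intro y hy
    rw [Finset.mem_coe, ← hY, Finset.mem_biUnion] at hy
    obtain ⟨W, hW, hy⟩ := hy
    obtain ⟨R, hR, -⟩ := hok W hW
    exact Set.mem_biUnion (show R ∈ _ from ⟨W, hW, hR⟩) (hR.subset hy)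
  have hq' := hull_subset hYc hc (h.symm ▸ hq)
  simp only [Set.mem_iUnion] at hq'
  obtain ⟨R, ⟨W, hW, hR⟩, hqR⟩ := hq'
  obtain rfl := hfar Z hZ W hW P R hP hR (near_of_mem hp hqR hpq)
  exact hqP (hP.unique hR ▸ hqR)

/-- The half-perimeter is a lower bound for twice the number of coins, since merging near boxes does
not increase the sum of the half-perimeters. -/
theorem Spans.semi_le {Y : Configuration} {Q : Box} (h : Spans Y Q) : Q.semi ≤ 2 * Y.card := by
  obtain ⟨n, hn⟩ : ∃ n, n = Y.card := ⟨_, rfl⟩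
  induction n using Nat.strong_induction_on generalizing Y Q with
  | _ n ih =>
    have hpos := h.nonempty.card_pos
    by_cases hQ : 2 < Q.semi
    · obtain ⟨Y₁, Y₂, Q₁, Q₂, hsub, hd, h₁, h₂, hnear, rfl, -, -⟩ := h.exists_split hQ
      have hc := Finset.card_le_card hsub
      rw [Finset.card_union_of_disjoint hd] at hc
      have p₁ := h₁.nonempty.card_pos
      have p₂ := h₂.nonempty.card_pos
      have i₁ := ih _ (by omega) h₁ rfl
      have i₂ := ih _ (by omega) h₂ rfl
      have := semi_join_le hnear
      omega
    · omega

/-- The box `P` together with the position `x` spans the larger box `Q`. -/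
def Grow (P : Box) (x : ℤ × ℤ) (Q : Box) : Prop := Near P (single x) ∧ join P (single x) = Q ∧ P ≠ Q

theorem Grow.spans {P Q : Box} {x : ℤ × ℤ} {Y : Configuration} (h : Grow P x Q) (hY : Spans Y P) :
    Spans (insert x Y) Q := by
  have := hY.union (spans_singleton x) h.1
  rwa [h.2.1, Finset.union_comm, ← Finset.insert_eq] at this

theorem Grow.semi_lt {P Q : Box} {x : ℤ × ℤ} (h : Grow P x Q) : P.semi < Q.semi :=
  semi_lt_of_subset (h.2.1 ▸ left_subset_join _ _) h.2.2

/-- Every position `q` of a box with more than one position lies in a box that grows to the given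
one by adding one coin, without losing in the count of `Spans.semi_le`. The exception is the middle
of three positions in a line, where the only minimum spanning configuration consists of the ends. -/
theorem exists_grow (Q : Box) (q : ℤ × ℤ) (hq : q ∈ Q.cells) (hQ : 2 < Q.semi)
    (hx : ¬ (Q.r = Q.l + 2 ∧ Q.b = Q.t ∧ q.1 = Q.l + 1))
    (hy : ¬ (Q.t = Q.b + 2 ∧ Q.l = Q.r ∧ q.2 = Q.b + 1)) :
    ∃ P x, Grow P x Q ∧ q ∈ P.cells ∧ (P.semi + 2 ≤ Q.semi ∨ (Q.semi = 3 ∧ P.semi = 2)) := by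
  obtain ⟨l, r, b, t, hlr, hbt⟩ := Q
  obtain ⟨x, y⟩ := q
  simp only [mem_cells, Box.semi] at *
  by_cases h1 : x ≤ r - 2
  · refine ⟨⟨l, r - 2, b, t, by omega, hbt⟩, (r, b), ?_, ?_, ?_⟩ <;>
    simp only [Grow, Near, join, single, Box.mk.injEq, ne_eq] <;> omega
  by_cases h2 : l + 2 ≤ x
  · refine ⟨⟨l + 2, r, b, t, by omega, hbt⟩, (l, b), ?_, ?_, ?_⟩ <;>
    simp only [Grow, Near, join, single, Box.mk.injEq, ne_eq] <;> omega
  by_cases h3 : y ≤ t - 2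
  · refine ⟨⟨l, r, b, t - 2, hlr, by omega⟩, (l, t), ?_, ?_, ?_⟩ <;>
    simp only [Grow, Near, join, single, Box.mk.injEq, ne_eq] <;> omega
  by_cases h4 : b + 2 ≤ y
  · refine ⟨⟨l, r, b + 2, t, hlr, by omega⟩, (l, b), ?_, ?_, ?_⟩ <;>
    simp only [Grow, Near, join, single, Box.mk.injEq, ne_eq] <;> omega
  by_cases h5 : l < r ∧ b < t
  · by_cases hxr : x < r <;> by_cases hyt : y < t
    · refine ⟨⟨l, r - 1, b, t - 1, by omega, by omega⟩, (r, t), ?_, ?_, ?_⟩ <;>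
      simp only [Grow, Near, join, single, Box.mk.injEq, ne_eq] <;> omega
    · refine ⟨⟨l, r - 1, b + 1, t, by omega, by omega⟩, (r, b), ?_, ?_, ?_⟩ <;>
      simp only [Grow, Near, join, single, Box.mk.injEq, ne_eq] <;> omega
    · refine ⟨⟨l + 1, r, b, t - 1, by omega, by omega⟩, (l, t), ?_, ?_, ?_⟩ <;>
      simp only [Grow, Near, join, single, Box.mk.injEq, ne_eq] <;> omega
    · refine ⟨⟨l + 1, r, b + 1, t, by omega, by omega⟩, (l, b), ?_, ?_, ?_⟩ <;>
      simp only [Grow, Near, join, single, Box.mk.injEq, ne_eq] <;> omega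
  -- two adjacent positions
  · refine ⟨⟨x, x, y, y, le_rfl, le_rfl⟩, (l + r - x, b + t - y), ?_, ?_, ?_⟩ <;>
    simp only [Grow, Near, join, single, Box.mk.injEq, ne_eq] <;> omega

theorem eq_single_of_semi_le {Q : Box} (h : Q.semi ≤ 2) {q : ℤ × ℤ} (hq : q ∈ Q.cells) :
    Q = single q := by
  have h1 := Q.hlr; have h2 := Q.hbt
  simp only [mem_cells, Box.semi] at *
  ext <;> simp only [single] <;> omega

/-- Minimum spanning configurations of a box exist; moreover they can be chosen so as to reach a
given position `q` in at most one step, and so as to contain `q` if it is a corner. -/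
theorem exists_tight (Q : Box) (q : ℤ × ℤ) (hq : q ∈ Q.cells) :
    ∃ D : Configuration, Spans D Q ∧ 2 * (D.card : ℤ) ≤ Q.semi + 1 ∧
      (q ∈ D ∨ Supported (D : Set (ℤ × ℤ)) q) ∧
      ((q.1 = Q.l ∨ q.1 = Q.r) ∧ (q.2 = Q.b ∨ q.2 = Q.t) → q ∈ D) := by
  obtain ⟨n, hn⟩ : ∃ n : ℕ, Q.semi ≤ n := ⟨_, Int.self_le_toNat _⟩
  induction n generalizing Q with
  | zero => have := Q.hlr; have := Q.hbt; simp only [Box.semi] at hn; omega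
  | succ n ih =>
    by_cases hQ : 2 < Q.semi
    · have htri : ∀ p p' : ℤ × ℤ, p ≠ p' → p ∈ neighbors q → p' ∈ neighbors q →
          Near (single p) (single p') → join (single p) (single p') = Q → Q.semi = 4 →
          ¬ ((q.1 = Q.l ∨ q.1 = Q.r) ∧ (q.2 = Q.b ∨ q.2 = Q.t)) →
          ∃ D : Configuration, Spans D Q ∧ 2 * (D.card : ℤ) ≤ Q.semi + 1 ∧
            (q ∈ D ∨ Supported (D : Set (ℤ × ℤ)) q) ∧
            ((q.1 = Q.l ∨ q.1 = Q.r) ∧ (q.2 = Q.b ∨ q.2 = Q.t) → q ∈ D) := by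
        intro p p' hne hp hp' hnear hj hs hc
        refine ⟨{p} ∪ {p'}, ?_, ?_, .inr ⟨p, by simp, p', by simp, hne, hp, hp'⟩,
          fun h => (hc h).elim⟩
        · rw [← hj]; exact (spans_singleton p).union (spans_singleton p') hnear
        · have := Finset.card_union_le {p} {p'}
          simp only [Finset.card_singleton] at this
          omega
      by_cases hx : Q.r = Q.l + 2 ∧ Q.b = Q.t ∧ q.1 = Q.l + 1
      · simp only [mem_cells] at hq
        apply htri (q.1 - 1, q.2) (q.1 + 1, q.2)
        · simp only [ne_eq, Prod.mk.injEq]; omega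
        · rw [mem_neighbors]; dsimp only; omega
        · rw [mem_neighbors]; dsimp only; omega
        · simp only [Near, single]; omega
        · simp only [join, single, Box.ext_iff]; omega
        · simp only [Box.semi]; omega
        · omega
      by_cases hy : Q.t = Q.b + 2 ∧ Q.l = Q.r ∧ q.2 = Q.b + 1
      · simp only [mem_cells] at hq
        apply htri (q.1, q.2 - 1) (q.1, q.2 + 1)
        · simp only [ne_eq, Prod.mk.injEq]; omega
        · rw [mem_neighbors]; dsimp only; omega
        · rw [mem_neighbors]; dsimp only; omega
        · simp only [Near, single]; omega
        · simp only [join, single, Box.ext_iff]; omega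
        · simp only [Box.semi]; omega
        · omega
      obtain ⟨P, x, hg, hqP, hs⟩ := exists_grow Q q hq hQ hx hy
      have hlt := hg.semi_lt
      obtain ⟨D, hD, hc, hm, hcor⟩ := ih P hqP (by push_cast at hn; omega)
      refine ⟨insert x D, hg.spans hD, ?_, ?_, ?_⟩
      · have := Finset.card_insert_le x D
        omega
      · exact hm.imp (Finset.mem_insert_of_mem) (fun h => h.mono (by simp))
      · intro h
        apply Finset.mem_insert_of_mem
        apply hcor
        have := cells_subset_iff.1 (hg.2.1 ▸ left_subset_join P (single x))
        simp only [mem_cells] at hqP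
        omega
    · obtain rfl := eq_single_of_semi_le (not_lt.1 hQ) hq
      exact ⟨{q}, spans_singleton q, by simp [Box.semi, single], by simp, by simp⟩

/-! ### Normalizing a spanning configuration -/

/-- `Y` and `Y'` can be transformed into each other with `N` pebbles. -/
def Equi (N : ℕ) (Y Y' : Configuration) : Prop := Peb N Y Y' ∧ Peb N Y' Y

theorem Equi.refl (N : ℕ) (Y : Configuration) : Equi N Y Y := ⟨Peb.refl N Y, Peb.refl N Y⟩

theorem Equi.symm {N : ℕ} {Y Y' : Configuration} (h : Equi N Y Y') : Equi N Y' Y := ⟨h.2, h.1⟩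

theorem Equi.trans {N : ℕ} {X Y Z : Configuration} (h : Equi N X Y) (h' : Equi N Y Z) :
    Equi N X Z := ⟨h.1.trans h'.1, h'.2.trans h.2⟩

theorem Equi.union {N : ℕ} {Y Y' : Configuration} (h : Equi N Y Y') (X : Configuration) {M : ℕ}
    (hM : N + X.card ≤ M) : Equi M (Y ∪ X) (Y' ∪ X) := ⟨h.1.union X hM, h.2.union X hM⟩

theorem Equi.insert_congr {N : ℕ} {Y Y' : Configuration} (h : Equi N Y Y') (x : ℤ × ℤ) {M : ℕ}
    (hM : N + 1 ≤ M) : Equi M (insert x Y) (insert x Y') :=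
  ⟨h.1.insert_congr x hM, h.2.insert_congr x hM⟩

theorem Equi.mono {N M : ℕ} {Y Y' : Configuration} (h : Equi N Y Y') (hM : N ≤ M) : Equi M Y Y' :=
  ⟨h.1.mono hM, h.2.mono hM⟩

/-- All configurations of at most `K` coins that span `Q` can be transformed into each other with
two more pebbles. This is proved for all boxes in `boxConn`. -/
def BoxConn (Q : Box) (K : ℕ) : Prop :=
  ∀ Y Y' : Configuration, Spans Y Q → Spans Y' Q → Y.card ≤ K → Y'.card ≤ K → Peb (K + 2) Y Y'

theorem BoxConn.equi {Q : Box} {K : ℕ} (h : BoxConn Q K) {Y Y' : Configuration} (hY : Spans Y Q)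
    (hY' : Spans Y' Q) (hc : Y.card ≤ K) (hc' : Y'.card ≤ K) : Equi (K + 2) Y Y' :=
  ⟨h Y Y' hY hY' hc hc', h Y' Y hY' hY hc' hc⟩

/-- With a third pebble, any position of the box can be added to a spanning configuration: go to a
minimum configuration that has the position or supports it, add it, and go back. -/
theorem BoxConn.peb_insert {Q : Box} {K : ℕ} (h : BoxConn Q K) {W : Configuration} (hW : Spans W Q)
    (hc : W.card ≤ K) {y : ℤ × ℤ} (hy : y ∈ Q.cells) : Peb (K + 3) W (insert y W) := by
  obtain ⟨D, hD, hDc, hyD, -⟩ := exists_tight Q y hy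
  have hs := hW.semi_le
  have h1 : Peb (K + 3) D (insert y D) := by
    rcases hyD with hyD | hyD
    · rw [Finset.insert_eq_of_mem hyD]
      exact Peb.refl _ _
    · exact Peb.add hyD (by omega)
  exact ((h W D hW hD hc (by omega)).mono (by omega)).trans
    (h1.trans ((h D W hD hW (by omega) hc).insert_congr y (by omega)))

theorem BoxConn.peb_of_subset {Q : Box} {K : ℕ} (h : BoxConn Q K) {W Y : Configuration}
    (hW : Spans W Q) (hc : W.card ≤ K) (hWY : W ⊆ Y) (hY : (Y : Set (ℤ × ℤ)) ⊆ Q.cells)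
    (hYc : Y.card ≤ K + 1) : Peb (K + 3) W Y := by
  by_cases heq : W = Y
  · rw [heq]; exact Peb.refl _ _
  obtain ⟨z, hzY, hzW⟩ := Finset.exists_of_ssubset (hWY.ssubset_of_ne heq)
  have hsub : W ⊆ Y.erase z := Finset.subset_erase.2 ⟨hWY, hzW⟩
  have hU : Spans (Y.erase z) Q := hW.of_subset hsub
    ((Finset.coe_subset.2 (Finset.erase_subset z Y)).trans hY)
  have hUc := Finset.card_erase_add_one hzY
  have h1 := h.peb_insert hU (by omega) (hY (Finset.mem_coe.2 hzY))
  rw [Finset.insert_erase hzY] at h1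
  exact ((h W _ hW hU hc (by omega)).mono (by omega)).trans h1

/-- `Y` can be transformed into a configuration that consists of one coin and a configuration
spanning a smaller box. -/
def Normalizable (Q : Box) (K : ℕ) (Y : Configuration) : Prop :=
  ∃ P x Y', Grow P x Q ∧ Spans Y' P ∧ Y'.card + 1 ≤ K ∧ Equi (K + 2) Y (insert x Y')

/-- If a proper part `W` of `Y` spans the box already, then the induction hypothesis for one pebble
less applies to `W`, and the missing coins of `Y` can be added by `BoxConn.peb_of_subset`. -/
theorem normalizable_of_slack {Q : Box} {K : ℕ} (hQ : 2 < Q.semi)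
    (hP : ∀ K', K = K' + 1 → BoxConn Q K') {W Y : Configuration} (hW : Spans W Q)
    (hc : W.card + 1 ≤ K) (hWY : W ⊆ Y) (hY : (Y : Set (ℤ × ℤ)) ⊆ Q.cells) (hYc : Y.card ≤ K) :
    Normalizable Q K Y := by
  obtain ⟨K, rfl⟩ : ∃ K', K = K' + 1 := ⟨K - 1, by omega⟩
  have hB := hP K rfl
  have h1 := Q.hlr
  have h2 := Q.hbt
  obtain ⟨P, x, hg, -, hs⟩ := exists_grow Q (Q.l, Q.b) ⟨le_rfl, h1, le_rfl, h2⟩ hQ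
    (by dsimp only; omega) (by dsimp only; omega)
  obtain ⟨p, hp⟩ := P.cells_nonempty
  obtain ⟨D, hD, hDc, -⟩ := exists_tight P p hp
  have hsW := hW.semi_le
  have hc' := Finset.card_insert_le x D
  refine ⟨P, x, D, hg, hD, by omega, ?_, ?_⟩
  · exact (Peb.drop hWY).trans ((hB _ _ hW (hg.spans hD) (by omega) (by omega)).mono (by omega))
  · exact ((hB _ _ (hg.spans hD) hW (by omega) (by omega)).mono (by omega)).trans
      (hB.peb_of_subset hW (by omega) hWY hY hYc)

/-- `q` is the middle of the three positions of a `3 × 1` or `1 × 3` box, the exceptional case of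
`exists_grow`. -/
def IsMiddle (Q : Box) (q : ℤ × ℤ) : Prop :=
  (Q.r = Q.l + 2 ∧ Q.b = Q.t ∧ q.1 = Q.l + 1) ∨ (Q.t = Q.b + 2 ∧ Q.l = Q.r ∧ q.2 = Q.b + 1)

/-- Let `Y₁` and `Y₂` span near boxes. By induction `Y₂` can be rearranged so that all coins but
one, `y`, span a box that is still near `Q₁`. Then `y` is the last coin, unless the other coins span
the whole box already. -/
theorem normalizable_of_near {Q : Box} {K : ℕ} (hQ : 2 < Q.semi)
    (hP : ∀ K', K = K' + 1 → BoxConn Q K')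
    (ih : ∀ P : Box, P.semi < Q.semi → ∀ K, BoxConn P K) {Y₁ Y₂ : Configuration} {Q₁ Q₂ : Box}
    (h₁ : Spans Y₁ Q₁) (h₂ : Spans Y₂ Q₂) (hnear : Near Q₁ Q₂) (hj : join Q₁ Q₂ = Q)
    (hne₁ : Q₁ ≠ Q) (hne₂ : Q₂ ≠ Q) (hc : Y₁.card + Y₂.card ≤ K) {p q : ℤ × ℤ} (hp : p ∈ Q₁.cells)
    (hq : q ∈ Q₂.cells) (hpq : |p.1 - q.1| + |p.2 - q.2| ≤ 2) (hm : ¬ IsMiddle Q₂ q) :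
    Normalizable Q K (Y₁ ∪ Y₂) := by
  by_cases hs : 2 < Q₂.semi
  · simp only [IsMiddle, not_or] at hm
    obtain ⟨P, y, hg, hqP, hsP⟩ := exists_grow Q₂ q hq hs hm.1 hm.2
    obtain ⟨D, hD, hDc, -⟩ := exists_tight P q hqP
    have hs₂ := h₂.semi_le
    have hc' := Finset.card_insert_le y D
    have hlt : Q₂.semi < Q.semi := semi_lt_of_subset (hj ▸ right_subset_join _ _) hne₂
    have e := ((ih Q₂ hlt Y₂.card).equi h₂ (hg.spans hD) le_rfl (by omega)).union Y₁
      (M := K + 2) (by omega)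
    rw [Finset.union_comm Y₂, Finset.insert_union] at e
    have hnear' : Near P Q₁ := near_comm.1 (near_of_mem hp hqP hpq)
    have hU : Spans (D ∪ Y₁) (join P Q₁) := hD.union h₁ hnear'
    have hUc := Finset.card_union_le D Y₁
    have hQ2 : join P (single y) = Q₂ := hg.2.1
    have hyP : Near P (single y) := hg.1
    have hjj : join (join P Q₁) (single y) = Q := by rw [← hj, ← hQ2, join_left_comm]
    by_cases heq : join P Q₁ = Q
    · obtain ⟨P', x, Y', hg', hY', hYc', he⟩ := normalizable_of_slack (Y := insert y (D ∪ Y₁))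
        hQ hP (heq ▸ hU) (by omega) (Finset.subset_insert _ _) (by
          rw [Finset.coe_insert]
          refine Set.insert_subset ?_ (heq ▸ hU.subset)
          rw [← hjj]
          apply right_subset_join
          simp [cells_single]) ((Finset.card_insert_le _ _).trans (by omega))
      exact ⟨P', x, Y', hg', hY', hYc', e.trans he⟩
    · refine ⟨join P Q₁, y, D ∪ Y₁, ⟨hyP.mono (left_subset_join P Q₁), hjj, heq⟩, hU,
        by omega, e⟩
  · obtain rfl := eq_single_of_semi_le (not_lt.1 hs) hq
    obtain rfl := h₂.eq_singleton
    refine ⟨Q₁, q, Y₁, ⟨hnear, hj, hne₁⟩, h₁, by simpa using hc, ?_⟩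
    rw [Finset.insert_eq, Finset.union_comm]
    exact Equi.refl _ _

/-- Two near boxes contain close positions one of which is not exceptional: if both are exceptional,
one of the two bars (or both, if they are parallel) can be left by one step. -/
theorem exists_close_not_isMiddle {P Q : Box} (h : Near P Q) :
    ∃ p ∈ P.cells, ∃ q ∈ Q.cells, |p.1 - q.1| + |p.2 - q.2| ≤ 2 ∧
      (¬ IsMiddle P p ∨ ¬ IsMiddle Q q) := by
  obtain ⟨⟨x, y⟩, hp, ⟨z, w⟩, hq, hd⟩ := h.exists_mem
  by_cases hP : IsMiddle P (x, y)
  swap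
  · exact ⟨_, hp, _, hq, hd, .inl hP⟩
  by_cases hQ : IsMiddle Q (z, w)
  swap
  · exact ⟨_, hp, _, hq, hd, .inr hQ⟩
  simp only [IsMiddle, mem_cells, abs] at *
  rcases hP with hP | hP <;> rcases hQ with hQ | hQ
  · rcases lt_trichotomy x z with hlt | heq | hgt
    · exact ⟨(x, y), by simp only []; omega, (z - 1, w), by simp only []; omega,
        by simp only []; omega, by simp only []; omega⟩
    · exact ⟨(x + 1, y), by simp only []; omega, (z + 1, w), by simp only []; omega,
        by simp only []; omega, by simp only []; omega⟩
    · exact ⟨(x, y), by simp only []; omega, (z + 1, w), by simp only []; omega,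
        by simp only []; omega, by simp only []; omega⟩
  · rcases lt_trichotomy y w with hlt | heq | hgt
    · exact ⟨(x, y), by simp only []; omega, (z, w - 1), by simp only []; omega,
        by simp only []; omega, by simp only []; omega⟩
    · by_cases hx : x ≤ z
      · exact ⟨(x + 1, y), by simp only []; omega, (z, w), by simp only []; omega,
          by simp only []; omega, by simp only []; omega⟩
      · exact ⟨(x - 1, y), by simp only []; omega, (z, w), by simp only []; omega,
          by simp only []; omega, by simp only []; omega⟩
    · exact ⟨(x, y), by simp only []; omega, (z, w + 1), by simp only []; omega,
        by simp only []; omega, by simp only []; omega⟩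
  · rcases lt_trichotomy x z with hlt | heq | hgt
    · exact ⟨(x, y), by simp only []; omega, (z - 1, w), by simp only []; omega,
        by simp only []; omega, by simp only []; omega⟩
    · by_cases hx : y ≤ w
      · exact ⟨(x, y + 1), by simp only []; omega, (z, w), by simp only []; omega,
          by simp only []; omega, by simp only []; omega⟩
      · exact ⟨(x, y - 1), by simp only []; omega, (z, w), by simp only []; omega,
          by simp only []; omega, by simp only []; omega⟩
    · exact ⟨(x, y), by simp only []; omega, (z + 1, w), by simp only []; omega,
        by simp only []; omega, by simp only []; omega⟩
  · rcases lt_trichotomy y w with hlt | heq | hgt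
    · exact ⟨(x, y), by simp only []; omega, (z, w - 1), by simp only []; omega,
        by simp only []; omega, by simp only []; omega⟩
    · exact ⟨(x, y + 1), by simp only []; omega, (z, w + 1), by simp only []; omega,
        by simp only []; omega, by simp only []; omega⟩
    · exact ⟨(x, y), by simp only []; omega, (z, w + 1), by simp only []; omega,
        by simp only []; omega, by simp only []; omega⟩

/-- Every spanning configuration can be transformed into one in which the last coin is added to a
smaller box. -/
theorem Spans.normalizable {Q : Box} {K : ℕ} (hQ : 2 < Q.semi)
    (hP : ∀ K', K = K' + 1 → BoxConn Q K')
    (ih : ∀ P : Box, P.semi < Q.semi → ∀ K, BoxConn P K) {Y : Configuration} (hY : Spans Y Q)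
    (hc : Y.card ≤ K) : Normalizable Q K Y := by
  obtain ⟨Y₁, Y₂, Q₁, Q₂, hsub, hd, h₁, h₂, hnear, hj, hne₁, hne₂⟩ := hY.exists_split hQ
  by_cases heq : Y₁ ∪ Y₂ = Y
  · rw [← heq, Finset.card_union_of_disjoint hd] at hc
    obtain ⟨p, hp, q, hq, hpq, hm | hm⟩ := exists_close_not_isMiddle hnear
    · rw [← heq, Finset.union_comm]
      exact normalizable_of_near hQ hP ih h₂ h₁ (near_comm.1 hnear) (by rw [join_comm, hj])
        hne₂ hne₁ (by omega) hq hp (by simp only [abs] at *; omega) hm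
    · rw [← heq]
      exact normalizable_of_near hQ hP ih h₁ h₂ hnear hj hne₁ hne₂ (by omega) hp hq hpq hm
  · have hlt := Finset.card_lt_card (hsub.ssubset_of_ne heq)
    exact normalizable_of_slack hQ hP (hj ▸ h₁.union h₂ hnear) (by omega) hsub hY.subset hc

/-! ### Connecting the ways in which a box grows out of a smaller one -/

/-- All configurations of at most `K` coins that consist of `x` and a configuration spanning `P` can
be transformed into all those that consist of `x'` and a configuration spanning `P'`. -/
def Conn (K : ℕ) (P : Box) (x : ℤ × ℤ) (P' : Box) (x' : ℤ × ℤ) : Prop :=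
  ∀ Y Y' : Configuration, Spans Y P → Spans Y' P' → Y.card + 1 ≤ K → Y'.card + 1 ≤ K →
    Equi (K + 2) (insert x Y) (insert x' Y')

theorem Conn.refl {s : ℤ} (ih : ∀ P : Box, P.semi < s → ∀ K, BoxConn P K) {K : ℕ} {P : Box}
    {x : ℤ × ℤ} (hP : P.semi < s) : Conn K P x P x := by
  intro Y Y' hY hY' hc hc'
  obtain ⟨K, rfl⟩ : ∃ K', K = K' + 1 := ⟨K - 1, by omega⟩
  exact ((ih P hP K).equi hY hY' (by omega) (by omega)).insert_congr x (by omega)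

theorem Conn.symm {K : ℕ} {P P' : Box} {x x' : ℤ × ℤ} (h : Conn K P x P' x') :
    Conn K P' x' P x := fun Y Y' hY hY' hc hc' => (h Y' Y hY' hY hc' hc).symm

/-- Connections compose, since there is a configuration of at most `K` coins in the middle. -/
theorem Conn.trans {K : ℕ} {P P' P'' : Box} {x x' x'' : ℤ × ℤ} (h : Conn K P x P' x')
    (h' : Conn K P' x' P'' x'') (hK : P'.semi + 2 ≤ 2 * K) : Conn K P x P'' x'' := by
  intro Y Y' hY hY' hc hc'
  obtain ⟨p, hp⟩ := P'.cells_nonempty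
  obtain ⟨D, hD, hDc, -⟩ := exists_tight P' p hp
  exact (h Y D hY hD hc (by omega)).trans (h' D Y' hD hY' (by omega) hc')

/-- If adding `x` and `y` to a box `E` in either order leads through `P` and `P'`, then the two ways
are connected, through the configurations consisting of `x`, `y` and one that spans `E`. -/
theorem Conn.of_square {s : ℤ} (ih : ∀ P : Box, P.semi < s → ∀ K, BoxConn P K) {K : ℕ}
    {E P P' : Box} {x y : ℤ × ℤ} (hP : Grow E y P) (hP' : Grow E x P') (hs : P.semi < s)
    (hs' : P'.semi < s) (hE : E.semi + 2 ≤ P.semi ∨ E.semi + 2 ≤ P'.semi) : Conn K P x P' y := by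
  intro Y Y' hY hY' hc hc'
  obtain ⟨p, hp⟩ := E.cells_nonempty
  obtain ⟨D, hD, hDc, -⟩ := exists_tight E p hp
  have h1 := hY.semi_le
  have h2 := hY'.semi_le
  have h3 := Finset.card_insert_le y D
  have h4 := Finset.card_insert_le x D
  obtain ⟨K, rfl⟩ : ∃ K', K = K' + 1 := ⟨K - 1, by omega⟩
  have e1 := ((ih P hs K).equi hY (hP.spans hD) (by omega) (by omega)).insert_congr x
    (M := K + 1 + 2) (by omega)
  have e2 := ((ih P' hs' K).equi hY' (hP'.spans hD) (by omega) (by omega)).insert_congr y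
    (M := K + 1 + 2) (by omega)
  rw [Finset.insert_comm] at e1
  exact e1.trans e2.symm

/-! The lemmas `conn_a_b` connect two ways in which the box `[l, r] × [b, t]` can grow. Here `a` and
`b` are sides, where the smaller box lacks `k` or two lines, or corners, where it lacks the two
lines that meet there. In each case the box `E` of `Conn.of_square` is the intersection of the two
smaller boxes; it has to be nonempty, and each coin has to be near it. -/

section Links

variable {l r b t k i j : ℤ} {K : ℕ}

theorem conn_right_nw
    (ih : ∀ P : Box, P.semi < (r - l) + (t - b) + 2 → ∀ K, BoxConn P K)
    (hk : k = 1 ∨ k = 2) (h : l + 1 ≤ r - k)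
    (h' : b ≤ t - 1) (hj : b ≤ j) (hj' : j ≤ t - 1) :
    Conn K ⟨l, r - k, b, t, by omega, by omega⟩ (r, j)
      ⟨l + 1, r, b, t - 1, by omega, by omega⟩ (l, t) :=
  Conn.of_square ih (E := ⟨l + 1, r - k, b, t - 1, by omega, by omega⟩)
    (by simp only [Grow, Near, join, single, Box.mk.injEq, ne_eq]; omega)
    (by simp only [Grow, Near, join, single, Box.mk.injEq, ne_eq]; omega)
    (by simp only [Box.semi]; omega) (by simp only [Box.semi]; omega)
    (by simp only [Box.semi]; omega)

theorem conn_right_sw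
    (ih : ∀ P : Box, P.semi < (r - l) + (t - b) + 2 → ∀ K, BoxConn P K)
    (hk : k = 1 ∨ k = 2) (h : l + 1 ≤ r - k)
    (h' : b ≤ t - 1) (hj : b + 1 ≤ j) (hj' : j ≤ t) :
    Conn K ⟨l, r - k, b, t, by omega, by omega⟩ (r, j)
      ⟨l + 1, r, b + 1, t, by omega, by omega⟩ (l, b) :=
  Conn.of_square ih (E := ⟨l + 1, r - k, b + 1, t, by omega, by omega⟩)
    (by simp only [Grow, Near, join, single, Box.mk.injEq, ne_eq]; omega)
    (by simp only [Grow, Near, join, single, Box.mk.injEq, ne_eq]; omega)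
    (by simp only [Box.semi]; omega) (by simp only [Box.semi]; omega)
    (by simp only [Box.semi]; omega)

theorem conn_left_ne
    (ih : ∀ P : Box, P.semi < (r - l) + (t - b) + 2 → ∀ K, BoxConn P K)
    (hk : k = 1 ∨ k = 2) (h : l + k ≤ r - 1)
    (h' : b ≤ t - 1) (hj : b ≤ j) (hj' : j ≤ t - 1) :
    Conn K ⟨l + k, r, b, t, by omega, by omega⟩ (l, j)
      ⟨l, r - 1, b, t - 1, by omega, by omega⟩ (r, t) :=
  Conn.of_square ih (E := ⟨l + k, r - 1, b, t - 1, by omega, by omega⟩)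
    (by simp only [Grow, Near, join, single, Box.mk.injEq, ne_eq]; omega)
    (by simp only [Grow, Near, join, single, Box.mk.injEq, ne_eq]; omega)
    (by simp only [Box.semi]; omega) (by simp only [Box.semi]; omega)
    (by simp only [Box.semi]; omega)

theorem conn_left_se
    (ih : ∀ P : Box, P.semi < (r - l) + (t - b) + 2 → ∀ K, BoxConn P K)
    (hk : k = 1 ∨ k = 2) (h : l + k ≤ r - 1)
    (h' : b ≤ t - 1) (hj : b + 1 ≤ j) (hj' : j ≤ t) :
    Conn K ⟨l + k, r, b, t, by omega, by omega⟩ (l, j)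
      ⟨l, r - 1, b + 1, t, by omega, by omega⟩ (r, b) :=
  Conn.of_square ih (E := ⟨l + k, r - 1, b + 1, t, by omega, by omega⟩)
    (by simp only [Grow, Near, join, single, Box.mk.injEq, ne_eq]; omega)
    (by simp only [Grow, Near, join, single, Box.mk.injEq, ne_eq]; omega)
    (by simp only [Box.semi]; omega) (by simp only [Box.semi]; omega)
    (by simp only [Box.semi]; omega)

theorem conn_top_se
    (ih : ∀ P : Box, P.semi < (r - l) + (t - b) + 2 → ∀ K, BoxConn P K)
    (hk : k = 1 ∨ k = 2) (h : b + 1 ≤ t - k)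
    (h' : l ≤ r - 1) (hi : l ≤ i) (hi' : i ≤ r - 1) :
    Conn K ⟨l, r, b, t - k, by omega, by omega⟩ (i, t)
      ⟨l, r - 1, b + 1, t, by omega, by omega⟩ (r, b) :=
  Conn.of_square ih (E := ⟨l, r - 1, b + 1, t - k, by omega, by omega⟩)
    (by simp only [Grow, Near, join, single, Box.mk.injEq, ne_eq]; omega)
    (by simp only [Grow, Near, join, single, Box.mk.injEq, ne_eq]; omega)
    (by simp only [Box.semi]; omega) (by simp only [Box.semi]; omega)
    (by simp only [Box.semi]; omega)

theorem conn_top_sw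
    (ih : ∀ P : Box, P.semi < (r - l) + (t - b) + 2 → ∀ K, BoxConn P K)
    (hk : k = 1 ∨ k = 2) (h : b + 1 ≤ t - k)
    (h' : l ≤ r - 1) (hi : l + 1 ≤ i) (hi' : i ≤ r) :
    Conn K ⟨l, r, b, t - k, by omega, by omega⟩ (i, t)
      ⟨l + 1, r, b + 1, t, by omega, by omega⟩ (l, b) :=
  Conn.of_square ih (E := ⟨l + 1, r, b + 1, t - k, by omega, by omega⟩)
    (by simp only [Grow, Near, join, single, Box.mk.injEq, ne_eq]; omega)
    (by simp only [Grow, Near, join, single, Box.mk.injEq, ne_eq]; omega)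
    (by simp only [Box.semi]; omega) (by simp only [Box.semi]; omega)
    (by simp only [Box.semi]; omega)

theorem conn_bottom_ne
    (ih : ∀ P : Box, P.semi < (r - l) + (t - b) + 2 → ∀ K, BoxConn P K)
    (hk : k = 1 ∨ k = 2) (h : b + k ≤ t - 1)
    (h' : l ≤ r - 1) (hi : l ≤ i) (hi' : i ≤ r - 1) :
    Conn K ⟨l, r, b + k, t, by omega, by omega⟩ (i, b)
      ⟨l, r - 1, b, t - 1, by omega, by omega⟩ (r, t) :=
  Conn.of_square ih (E := ⟨l, r - 1, b + k, t - 1, by omega, by omega⟩)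
    (by simp only [Grow, Near, join, single, Box.mk.injEq, ne_eq]; omega)
    (by simp only [Grow, Near, join, single, Box.mk.injEq, ne_eq]; omega)
    (by simp only [Box.semi]; omega) (by simp only [Box.semi]; omega)
    (by simp only [Box.semi]; omega)

theorem conn_bottom_nw
    (ih : ∀ P : Box, P.semi < (r - l) + (t - b) + 2 → ∀ K, BoxConn P K)
    (hk : k = 1 ∨ k = 2) (h : b + k ≤ t - 1)
    (h' : l ≤ r - 1) (hi : l + 1 ≤ i) (hi' : i ≤ r) :
    Conn K ⟨l, r, b + k, t, by omega, by omega⟩ (i, b)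
      ⟨l + 1, r, b, t - 1, by omega, by omega⟩ (l, t) :=
  Conn.of_square ih (E := ⟨l + 1, r, b + k, t - 1, by omega, by omega⟩)
    (by simp only [Grow, Near, join, single, Box.mk.injEq, ne_eq]; omega)
    (by simp only [Grow, Near, join, single, Box.mk.injEq, ne_eq]; omega)
    (by simp only [Box.semi]; omega) (by simp only [Box.semi]; omega)
    (by simp only [Box.semi]; omega)

theorem conn_top_bottom
    (ih : ∀ P : Box, P.semi < (r - l) + (t - b) + 2 → ∀ K, BoxConn P K)
    (hk : k = 1 ∨ k = 2) (h : b + 2 ≤ t - k) (h' : l ≤ r)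
    (hi : l ≤ i) (hi' : i ≤ r) (hj : l ≤ j) (hj' : j ≤ r) :
    Conn K ⟨l, r, b, t - k, by omega, by omega⟩ (i, t)
      ⟨l, r, b + 2, t, by omega, by omega⟩ (j, b) :=
  Conn.of_square ih (E := ⟨l, r, b + 2, t - k, by omega, by omega⟩)
    (by simp only [Grow, Near, join, single, Box.mk.injEq, ne_eq]; omega)
    (by simp only [Grow, Near, join, single, Box.mk.injEq, ne_eq]; omega)
    (by simp only [Box.semi]; omega) (by simp only [Box.semi]; omega)
    (by simp only [Box.semi]; omega)

theorem conn_bottom_top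
    (ih : ∀ P : Box, P.semi < (r - l) + (t - b) + 2 → ∀ K, BoxConn P K)
    (hk : k = 1 ∨ k = 2) (h : b + k ≤ t - 2) (h' : l ≤ r)
    (hi : l ≤ i) (hi' : i ≤ r) (hj : l ≤ j) (hj' : j ≤ r) :
    Conn K ⟨l, r, b + k, t, by omega, by omega⟩ (i, b)
      ⟨l, r, b, t - 2, by omega, by omega⟩ (j, t) :=
  Conn.of_square ih (E := ⟨l, r, b + k, t - 2, by omega, by omega⟩)
    (by simp only [Grow, Near, join, single, Box.mk.injEq, ne_eq]; omega)
    (by simp only [Grow, Near, join, single, Box.mk.injEq, ne_eq]; omega)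
    (by simp only [Box.semi]; omega) (by simp only [Box.semi]; omega)
    (by simp only [Box.semi]; omega)

theorem conn_right_top
    (ih : ∀ P : Box, P.semi < (r - l) + (t - b) + 2 → ∀ K, BoxConn P K)
    (hk : k = 1 ∨ k = 2) (hi : l ≤ i) (hi' : i ≤ r - k)
    (hj : b ≤ j) (hj' : j ≤ t - 2) :
    Conn K ⟨l, r - k, b, t, by omega, by omega⟩ (r, j)
      ⟨l, r, b, t - 2, by omega, by omega⟩ (i, t) :=
  Conn.of_square ih (E := ⟨l, r - k, b, t - 2, by omega, by omega⟩)
    (by simp only [Grow, Near, join, single, Box.mk.injEq, ne_eq]; omega)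
    (by simp only [Grow, Near, join, single, Box.mk.injEq, ne_eq]; omega)
    (by simp only [Box.semi]; omega) (by simp only [Box.semi]; omega)
    (by simp only [Box.semi]; omega)

theorem conn_right_bottom
    (ih : ∀ P : Box, P.semi < (r - l) + (t - b) + 2 → ∀ K, BoxConn P K)
    (hk : k = 1 ∨ k = 2) (hi : l ≤ i) (hi' : i ≤ r - k)
    (hj : b + 2 ≤ j) (hj' : j ≤ t) :
    Conn K ⟨l, r - k, b, t, by omega, by omega⟩ (r, j)
      ⟨l, r, b + 2, t, by omega, by omega⟩ (i, b) :=
  Conn.of_square ih (E := ⟨l, r - k, b + 2, t, by omega, by omega⟩)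
    (by simp only [Grow, Near, join, single, Box.mk.injEq, ne_eq]; omega)
    (by simp only [Grow, Near, join, single, Box.mk.injEq, ne_eq]; omega)
    (by simp only [Box.semi]; omega) (by simp only [Box.semi]; omega)
    (by simp only [Box.semi]; omega)

theorem conn_left_top
    (ih : ∀ P : Box, P.semi < (r - l) + (t - b) + 2 → ∀ K, BoxConn P K)
    (hk : k = 1 ∨ k = 2) (hi : l + k ≤ i) (hi' : i ≤ r)
    (hj : b ≤ j) (hj' : j ≤ t - 2) :
    Conn K ⟨l + k, r, b, t, by omega, by omega⟩ (l, j)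
      ⟨l, r, b, t - 2, by omega, by omega⟩ (i, t) :=
  Conn.of_square ih (E := ⟨l + k, r, b, t - 2, by omega, by omega⟩)
    (by simp only [Grow, Near, join, single, Box.mk.injEq, ne_eq]; omega)
    (by simp only [Grow, Near, join, single, Box.mk.injEq, ne_eq]; omega)
    (by simp only [Box.semi]; omega) (by simp only [Box.semi]; omega)
    (by simp only [Box.semi]; omega)

theorem conn_left_bottom
    (ih : ∀ P : Box, P.semi < (r - l) + (t - b) + 2 → ∀ K, BoxConn P K)
    (hk : k = 1 ∨ k = 2) (hi : l + k ≤ i) (hi' : i ≤ r)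
    (hj : b + 2 ≤ j) (hj' : j ≤ t) :
    Conn K ⟨l + k, r, b, t, by omega, by omega⟩ (l, j)
      ⟨l, r, b + 2, t, by omega, by omega⟩ (i, b) :=
  Conn.of_square ih (E := ⟨l + k, r, b + 2, t, by omega, by omega⟩)
    (by simp only [Grow, Near, join, single, Box.mk.injEq, ne_eq]; omega)
    (by simp only [Grow, Near, join, single, Box.mk.injEq, ne_eq]; omega)
    (by simp only [Box.semi]; omega) (by simp only [Box.semi]; omega)
    (by simp only [Box.semi]; omega)

theorem conn_ne_sw
    (ih : ∀ P : Box, P.semi < (r - l) + (t - b) + 2 → ∀ K, BoxConn P K)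
    (h : l + 1 ≤ r - 1) (h' : b + 1 ≤ t - 1) :
    Conn K ⟨l, r - 1, b, t - 1, by omega, by omega⟩ (r, t)
      ⟨l + 1, r, b + 1, t, by omega, by omega⟩ (l, b) :=
  Conn.of_square ih (E := ⟨l + 1, r - 1, b + 1, t - 1, by omega, by omega⟩)
    (by simp only [Grow, Near, join, single, Box.mk.injEq, ne_eq]; omega)
    (by simp only [Grow, Near, join, single, Box.mk.injEq, ne_eq]; omega)
    (by simp only [Box.semi]; omega) (by simp only [Box.semi]; omega)
    (by simp only [Box.semi]; omega)

theorem conn_nw_se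
    (ih : ∀ P : Box, P.semi < (r - l) + (t - b) + 2 → ∀ K, BoxConn P K)
    (h : l + 1 ≤ r - 1) (h' : b + 1 ≤ t - 1) :
    Conn K ⟨l + 1, r, b, t - 1, by omega, by omega⟩ (l, t)
      ⟨l, r - 1, b + 1, t, by omega, by omega⟩ (r, b) :=
  Conn.of_square ih (E := ⟨l + 1, r - 1, b + 1, t - 1, by omega, by omega⟩)
    (by simp only [Grow, Near, join, single, Box.mk.injEq, ne_eq]; omega)
    (by simp only [Grow, Near, join, single, Box.mk.injEq, ne_eq]; omega)
    (by simp only [Box.semi]; omega) (by simp only [Box.semi]; omega)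
    (by simp only [Box.semi]; omega)

end Links

/-- The ways in which a box can grow out of a smaller one: the smaller box lacks one or two lines on
one side, or two lines meeting in a corner, which is then the position of the new coin. -/
theorem Grow.cases {l r b t : ℤ} {hlr : l ≤ r} {hbt : b ≤ t} {motive : Box → ℤ × ℤ → Prop}
    (right : ∀ k j, k = 1 ∨ k = 2 → ∀ h : l ≤ r - k, b ≤ j → j ≤ t →
      motive ⟨l, r - k, b, t, h, hbt⟩ (r, j))
    (left : ∀ k j, k = 1 ∨ k = 2 → ∀ h : l + k ≤ r, b ≤ j → j ≤ t →
      motive ⟨l + k, r, b, t, h, hbt⟩ (l, j))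
    (top : ∀ k i, k = 1 ∨ k = 2 → ∀ h : b ≤ t - k, l ≤ i → i ≤ r →
      motive ⟨l, r, b, t - k, hlr, h⟩ (i, t))
    (bottom : ∀ k i, k = 1 ∨ k = 2 → ∀ h : b + k ≤ t, l ≤ i → i ≤ r →
      motive ⟨l, r, b + k, t, hlr, h⟩ (i, b))
    (ne : ∀ (h : l ≤ r - 1) (h' : b ≤ t - 1), motive ⟨l, r - 1, b, t - 1, h, h'⟩ (r, t))
    (se : ∀ (h : l ≤ r - 1) (h' : b + 1 ≤ t), motive ⟨l, r - 1, b + 1, t, h, h'⟩ (r, b))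
    (nw : ∀ (h : l + 1 ≤ r) (h' : b ≤ t - 1), motive ⟨l + 1, r, b, t - 1, h, h'⟩ (l, t))
    (sw : ∀ (h : l + 1 ≤ r) (h' : b + 1 ≤ t), motive ⟨l + 1, r, b + 1, t, h, h'⟩ (l, b))
    {P : Box} {x : ℤ × ℤ} (hg : Grow P x ⟨l, r, b, t, hlr, hbt⟩) : motive P x := by
  obtain ⟨l', r', b', t', hlr', hbt'⟩ := P
  obtain ⟨i, j⟩ := x
  simp only [Grow, Near, join, single, Box.mk.injEq, ne_eq] at hg
  rcases lt_or_eq_of_le (show l ≤ l' by omega) with hl | rfl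
  · rcases lt_or_eq_of_le (show b ≤ b' by omega) with hb | rfl
    · obtain ⟨rfl, rfl, rfl, rfl, rfl, rfl⟩ :
        l' = l + 1 ∧ r' = r ∧ b' = b + 1 ∧ t' = t ∧ i = l ∧ j = b := by omega
      exact sw _ _
    rcases lt_or_eq_of_le (show t' ≤ t by omega) with ht | rfl
    · obtain ⟨rfl, rfl, rfl, rfl, rfl⟩ :
        l' = l + 1 ∧ r' = r ∧ t' = t - 1 ∧ i = l ∧ j = t := by omega
      exact nw _ _
    obtain ⟨k, rfl⟩ : ∃ k, l' = l + k := ⟨l' - l, by omega⟩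
    obtain ⟨rfl, rfl⟩ : r' = r ∧ i = l := by omega
    exact left k j (by omega) _ (by omega) (by omega)
  rcases lt_or_eq_of_le (show r' ≤ r by omega) with hr | rfl
  · rcases lt_or_eq_of_le (show b ≤ b' by omega) with hb | rfl
    · obtain ⟨rfl, rfl, rfl, rfl, rfl⟩ :
        r' = r - 1 ∧ b' = b + 1 ∧ t' = t ∧ i = r ∧ j = b := by omega
      exact se _ _
    rcases lt_or_eq_of_le (show t' ≤ t by omega) with ht | rfl
    · obtain ⟨rfl, rfl, rfl, rfl⟩ :
        r' = r - 1 ∧ t' = t - 1 ∧ i = r ∧ j = t := by omega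
      exact ne _ _
    obtain ⟨k, rfl⟩ : ∃ k, r' = r - k := ⟨r - r', by omega⟩
    obtain rfl : i = r := by omega
    exact right k j (by omega) _ (by omega) (by omega)
  rcases lt_or_eq_of_le (show b ≤ b' by omega) with hb | rfl
  · obtain ⟨k, rfl⟩ : ∃ k, b' = b + k := ⟨b' - b, by omega⟩
    obtain ⟨rfl, rfl⟩ : t' = t ∧ j = b := by omega
    exact bottom k i (by omega) _ (by omega) (by omega)
  · obtain ⟨k, rfl⟩ : ∃ k, t' = t - k := ⟨t - t', by omega⟩
    obtain rfl : j = t := by omega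
    exact top k i (by omega) _ (by omega) (by omega)

section Regimes

variable {l r b t : ℤ} {K : ℕ}

/-- In a box with at least three columns and at least three rows, all ways to grow are connected to
the growth at the upper right corner, as soon as this holds for the growth at the upper left corner
and for the growths by two lines that leave a single line. -/
theorem conn_ne_of_links (ih : ∀ P : Box, P.semi < (r - l) + (t - b) + 2 → ∀ K, BoxConn P K)
    (hK : (r - l) + (t - b) + 2 ≤ 2 * K) (hw : l + 2 ≤ r) (hh : b + 2 ≤ t)
    (nw : Conn K ⟨l + 1, r, b, t - 1, by omega, by omega⟩ (l, t)
      ⟨l, r - 1, b, t - 1, by omega, by omega⟩ (r, t))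
    (right₂ : ∀ j, b ≤ j → j ≤ t → r = l + 2 → Conn K ⟨l, r - 2, b, t, by omega, by omega⟩ (r, j)
      ⟨l, r - 1, b, t - 1, by omega, by omega⟩ (r, t))
    (left₂ : ∀ j, b ≤ j → j ≤ t → r = l + 2 → Conn K ⟨l + 2, r, b, t, by omega, by omega⟩ (l, j)
      ⟨l, r - 1, b, t - 1, by omega, by omega⟩ (r, t))
    (top₂ : ∀ i, l ≤ i → i ≤ r → t = b + 2 → Conn K ⟨l, r, b, t - 2, by omega, by omega⟩ (i, t)
      ⟨l, r - 1, b, t - 1, by omega, by omega⟩ (r, t))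
    (bottom₂ : ∀ i, l ≤ i → i ≤ r → t = b + 2 → Conn K ⟨l, r, b + 2, t, by omega, by omega⟩ (i, b)
      ⟨l, r - 1, b, t - 1, by omega, by omega⟩ (r, t)) {P : Box} {x : ℤ × ℤ}
    (hg : Grow P x ⟨l, r, b, t, by omega, by omega⟩) :
    Conn K P x ⟨l, r - 1, b, t - 1, by omega, by omega⟩ (r, t) := by
  have sw : Conn K ⟨l + 1, r, b + 1, t, by omega, by omega⟩ (l, b)
      ⟨l, r - 1, b, t - 1, by omega, by omega⟩ (r, t) :=
    (conn_ne_sw ih (by omega) (by omega)).symm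
  have se : Conn K ⟨l, r - 1, b + 1, t, by omega, by omega⟩ (r, b)
      ⟨l, r - 1, b, t - 1, by omega, by omega⟩ (r, t) :=
    (conn_nw_se ih (by omega) (by omega)).symm.trans nw (by simp only [Box.semi]; omega)
  refine Grow.cases
    (motive := fun P x => Conn K P x ⟨l, r - 1, b, t - 1, by omega, by omega⟩ (r, t))
    ?_ ?_ ?_ ?_ (fun _ _ => Conn.refl ih (by simp only [Box.semi]; omega)) (fun _ _ => se)
    (fun _ _ => nw) (fun _ _ => sw) hg
  · intro k j hk h hj hj'
    by_cases hr : l + 1 ≤ r - k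
    · by_cases hjt : j ≤ t - 1
      · exact (conn_right_nw ih hk hr (by omega) hj hjt).trans nw (by simp only [Box.semi]; omega)
      · exact (conn_right_sw ih hk hr (by omega) (by omega) hj').trans sw
          (by simp only [Box.semi]; omega)
    · obtain rfl : k = 2 := by omega
      exact right₂ j hj hj' (by omega)
  · intro k j hk h hj hj'
    by_cases hr : l + k ≤ r - 1
    · by_cases hjt : j ≤ t - 1
      · exact conn_left_ne ih hk hr (by omega) hj hjt
      · exact (conn_left_se ih hk hr (by omega) (by omega) hj').trans se
          (by simp only [Box.semi]; omega)
    · obtain rfl : k = 2 := by omega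
      exact left₂ j hj hj' (by omega)
  · intro k i hk h hi hi'
    by_cases hr : b + 1 ≤ t - k
    · by_cases hir : i ≤ r - 1
      · exact (conn_top_se ih hk hr (by omega) hi hir).trans se (by simp only [Box.semi]; omega)
      · exact (conn_top_sw ih hk hr (by omega) (by omega) hi').trans sw
          (by simp only [Box.semi]; omega)
    · obtain rfl : k = 2 := by omega
      exact top₂ i hi hi' (by omega)
  · intro k i hk h hi hi'
    by_cases hr : b + k ≤ t - 1
    · by_cases hir : i ≤ r - 1
      · exact conn_bottom_ne ih hk hr (by omega) hi hir
      · exact (conn_bottom_nw ih hk hr (by omega) (by omega) hi').trans nw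
          (by simp only [Box.semi]; omega)
    · obtain rfl : k = 2 := by omega
      exact bottom₂ i hi hi' (by omega)

/-- In a box with at least three columns and at least four rows, all ways to grow are connected. The
upper corners are connected through the growth by two rows at the bottom, and the growths by two
columns through those by two rows. -/
theorem conn_ne_of_large (ih : ∀ P : Box, P.semi < (r - l) + (t - b) + 2 → ∀ K, BoxConn P K)
    (hK : (r - l) + (t - b) + 2 ≤ 2 * K) (hw : l + 2 ≤ r) (hh : b + 3 ≤ t) {P : Box} {x : ℤ × ℤ}
    (hg : Grow P x ⟨l, r, b, t, by omega, by omega⟩) :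
    Conn K P x ⟨l, r - 1, b, t - 1, by omega, by omega⟩ (r, t) := by
  have sw : Conn K ⟨l + 1, r, b + 1, t, by omega, by omega⟩ (l, b)
      ⟨l, r - 1, b, t - 1, by omega, by omega⟩ (r, t) :=
    (conn_ne_sw ih (by omega) (by omega)).symm
  have nw : Conn K ⟨l + 1, r, b, t - 1, by omega, by omega⟩ (l, t)
      ⟨l, r - 1, b, t - 1, by omega, by omega⟩ (r, t) :=
    (conn_bottom_nw ih (k := 2) (.inr rfl) (by omega) (by omega) (i := l + 1) (by omega)
      (by omega)).symm.trans (conn_bottom_ne ih (k := 2) (.inr rfl) (by omega) (by omega)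
      (i := l + 1) (by omega) (by omega)) (by simp only [Box.semi]; omega)
  have se : Conn K ⟨l, r - 1, b + 1, t, by omega, by omega⟩ (r, b)
      ⟨l, r - 1, b, t - 1, by omega, by omega⟩ (r, t) :=
    (conn_nw_se ih (by omega) (by omega)).symm.trans nw (by simp only [Box.semi]; omega)
  have top : ∀ i, l ≤ i → i ≤ r → Conn K ⟨l, r, b, t - 2, by omega, by omega⟩ (i, t)
      ⟨l, r - 1, b, t - 1, by omega, by omega⟩ (r, t) := by
    intro i hi hi'
    by_cases hir : i ≤ r - 1
    · exact (conn_top_se ih (.inr rfl) (by omega) (by omega) hi hir).trans se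
        (by simp only [Box.semi]; omega)
    · exact (conn_top_sw ih (.inr rfl) (by omega) (by omega) (by omega) hi').trans sw
        (by simp only [Box.semi]; omega)
  have bottom : ∀ i, l ≤ i → i ≤ r → Conn K ⟨l, r, b + 2, t, by omega, by omega⟩ (i, b)
      ⟨l, r - 1, b, t - 1, by omega, by omega⟩ (r, t) := by
    intro i hi hi'
    by_cases hir : i ≤ r - 1
    · exact conn_bottom_ne ih (.inr rfl) (by omega) (by omega) hi hir
    · exact (conn_bottom_nw ih (.inr rfl) (by omega) (by omega) (by omega) hi').trans nw
        (by simp only [Box.semi]; omega)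
  refine conn_ne_of_links ih hK hw (by omega) nw ?_ ?_ (fun _ _ _ _ => by omega)
    (fun _ _ _ _ => by omega) hg
  · intro j hj hj' _
    by_cases hjt : j ≤ t - 2
    · exact (conn_right_top ih (.inr rfl) (i := l) le_rfl (by omega) hj hjt).trans
        (top l (by omega) (by omega)) (by simp only [Box.semi]; omega)
    · exact (conn_right_bottom ih (.inr rfl) (i := l) le_rfl (by omega) (by omega) hj').trans
        (bottom l (by omega) (by omega)) (by simp only [Box.semi]; omega)
  · intro j hj hj' _
    by_cases hjt : j ≤ t - 2
    · exact (conn_left_top ih (.inr rfl) (i := r) (by omega) (by omega) hj hjt).trans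
        (top r (by omega) (by omega)) (by simp only [Box.semi]; omega)
    · exact (conn_left_bottom ih (.inr rfl) (i := r) (by omega) (by omega) (by omega) hj').trans
        (bottom r (by omega) (by omega)) (by simp only [Box.semi]; omega)

/-- In a box with one or two columns and at least five rows, all ways to grow are connected to the
growth by two rows at the top. -/
theorem conn_top_of_narrow (ih : ∀ P : Box, P.semi < (r - l) + (t - b) + 2 → ∀ K, BoxConn P K)
    (hK : (r - l) + (t - b) + 2 ≤ 2 * K) (hlr : l ≤ r) (hw : r ≤ l + 1) (hh : b + 4 ≤ t) {P : Box}
    {x : ℤ × ℤ} (hg : Grow P x ⟨l, r, b, t, by omega, by omega⟩) :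
    Conn K P x ⟨l, r, b, t - 2, by omega, by omega⟩ (l, t) := by
  have bottom : ∀ k i, k = 1 ∨ k = 2 → ∀ h : b + k ≤ t, l ≤ i → i ≤ r →
      Conn K ⟨l, r, b + k, t, hlr, h⟩ (i, b) ⟨l, r, b, t - 2, by omega, by omega⟩ (l, t) :=
    fun k i hk h hi hi' => conn_bottom_top ih hk (by omega) (by omega) hi hi' le_rfl hlr
  have top : ∀ k i, k = 1 ∨ k = 2 → ∀ h : b ≤ t - k, l ≤ i → i ≤ r →
      Conn K ⟨l, r, b, t - k, hlr, h⟩ (i, t) ⟨l, r, b, t - 2, by omega, by omega⟩ (l, t) :=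
    fun k i hk h hi hi' => (conn_top_bottom ih hk (by omega) (by omega) hi hi' le_rfl hlr).trans
      (bottom 2 l (.inr rfl) (by omega) le_rfl hlr) (by simp only [Box.semi]; omega)
  refine Grow.cases (motive := fun P x => Conn K P x ⟨l, r, b, t - 2, by omega, by omega⟩ (l, t))
    ?_ ?_ top bottom ?_ ?_ ?_ ?_ hg
  · intro k j hk h hj hj'
    by_cases hjt : j ≤ t - 2
    · exact conn_right_top ih hk (i := l) le_rfl (by omega) hj hjt
    · exact (conn_right_bottom ih hk (i := l) le_rfl (by omega) (by omega) hj').trans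
        (bottom 2 l (.inr rfl) (by omega) (by omega) (by omega)) (by simp only [Box.semi]; omega)
  · intro k j hk h hj hj'
    by_cases hjt : j ≤ t - 2
    · exact (conn_left_top ih hk (i := r) (by omega) (by omega) hj hjt).trans
        (top 2 r (.inr rfl) (by omega) (by omega) (by omega)) (by simp only [Box.semi]; omega)
    · exact (conn_left_bottom ih hk (i := r) (by omega) (by omega) (by omega) hj').trans
        (bottom 2 r (.inr rfl) (by omega) (by omega) (by omega)) (by simp only [Box.semi]; omega)
  · intro h h'
    exact (conn_bottom_ne ih (k := 2) (.inr rfl) (by omega) h le_rfl h).symm.trans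
      (bottom 2 l (.inr rfl) (by omega) le_rfl hlr) (by simp only [Box.semi]; omega)
  · intro h h'
    exact (conn_top_se ih (k := 2) (.inr rfl) (by omega) h le_rfl h).symm
  · intro h h'
    exact (conn_bottom_nw ih (k := 2) (.inr rfl) (by omega) (by omega) h le_rfl).symm.trans
      (bottom 2 r (.inr rfl) (by omega) hlr le_rfl) (by simp only [Box.semi]; omega)
  · intro h h'
    exact (conn_top_sw ih (k := 2) (.inr rfl) (by omega) (by omega) h le_rfl).symm.trans
      (top 2 r (.inr rfl) (by omega) hlr le_rfl) (by simp only [Box.semi]; omega)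

end Regimes

/-! ### Symmetries of the grid -/

/-- A map of the grid into itself that is injective and preserves neighbors. -/
structure IsFrame (f : ℤ × ℤ → ℤ × ℤ) : Prop where
  injective : Function.Injective f
  mem_neighbors : ∀ p q, q ∈ neighbors p → f q ∈ neighbors (f p)

theorem IsFrame.supported {f : ℤ × ℤ → ℤ × ℤ} (hf : IsFrame f) {S T : Set (ℤ × ℤ)} {p : ℤ × ℤ}
    (h : Supported S p) (hT : f '' S ⊆ T) : Supported T (f p) := by
  obtain ⟨q, hq, r, hr, hne, hqp, hrp⟩ := h
  exact ⟨f q, hT ⟨q, hq, rfl⟩, f r, hT ⟨r, hr, rfl⟩, hf.injective.ne hne, hf.mem_neighbors _ _ hqp,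
    hf.mem_neighbors _ _ hrp⟩

/-- Symmetries of the grid map pebblings to pebblings. -/
theorem Peb.image {f : ℤ × ℤ → ℤ × ℤ} (hf : IsFrame f) {N : ℕ} {Y Y' : Configuration}
    (h : Peb N Y Y') : Peb N (Y.image f) (Y'.image f) := by
  induction h with
  | refl => exact Peb.refl _ _
  | tail _ h ih =>
    refine ih.trans ?_
    rcases h with ⟨p, hp, hc, rfl⟩ | h
    · rw [Finset.image_insert]
      refine Peb.add (hf.supported hp ?_) (lt_of_le_of_lt Finset.card_image_le hc)
      rw [Finset.coe_image]
    · exact Peb.drop (Finset.image_subset_image h)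

theorem Equi.image {f : ℤ × ℤ → ℤ × ℤ} (hf : IsFrame f) {N : ℕ} {Y Y' : Configuration}
    (h : Equi N Y Y') : Equi N (Y.image f) (Y'.image f) := ⟨h.1.image hf, h.2.image hf⟩

theorem IsFrame.image_hull_subset {f : ℤ × ℤ → ℤ × ℤ} (hf : IsFrame f) (S : Set (ℤ × ℤ)) :
    f '' hull S ⊆ hull (f '' S) := by
  rw [Set.image_subset_iff]
  refine hull_subset (Set.image_subset_iff.1 (subset_hull _)) fun p hp => ?_
  exact closed_hull _ _ (hf.supported hp (Set.image_preimage_subset _ _))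

theorem isFrame_swap : IsFrame Prod.swap := by
  refine ⟨Prod.swap_injective, fun p q h => ?_⟩
  rw [mem_neighbors] at h ⊢
  simp only [Prod.fst_swap, Prod.snd_swap]
  omega

theorem image_swap_hull (S : Set (ℤ × ℤ)) : Prod.swap '' hull S = hull (Prod.swap '' S) := by
  refine (isFrame_swap.image_hull_subset S).antisymm ?_
  have h := Set.image_mono (f := Prod.swap) (isFrame_swap.image_hull_subset (Prod.swap '' S))
  simpa only [← Set.image_comp, Prod.swap_swap_eq, Set.image_id] using h

/-- The reflection of a box at the diagonal. -/
def Box.transpose (Q : Box) : Box := ⟨Q.b, Q.t, Q.l, Q.r, Q.hbt, Q.hlr⟩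

theorem Box.cells_transpose (Q : Box) : Q.transpose.cells = Prod.swap '' Q.cells := by
  ext ⟨i, j⟩
  rw [Set.image_swap_eq_preimage_swap]
  simp only [Box.transpose, mem_cells, Set.mem_preimage, Prod.swap_prod_mk]
  tauto

theorem Spans.transpose {Y : Configuration} {Q : Box} (h : Spans Y Q) :
    Spans (Y.image Prod.swap) Q.transpose := by
  rw [Spans] at h ⊢
  rw [Finset.coe_image, ← image_swap_hull, h, Box.cells_transpose]

theorem image_swap_swap (Y : Configuration) : (Y.image Prod.swap).image Prod.swap = Y := by
  rw [Finset.image_image, Prod.swap_swap_eq, Finset.image_id]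

theorem BoxConn.of_transpose {Q : Box} {K : ℕ} (h : BoxConn Q.transpose K) : BoxConn Q K := by
  intro Y Y' hY hY' hc hc'
  have := (h _ _ hY.transpose hY'.transpose (Finset.card_image_le.trans hc)
    (Finset.card_image_le.trans hc')).image isFrame_swap
  rwa [image_swap_swap, image_swap_swap] at this

/-- The position with coordinates `p` relative to the origin `(x, y)` and axes of directions `s`,
`s'`, which are `1` or `-1`. -/
def frame (x y s s' : ℤ) (p : ℤ × ℤ) : ℤ × ℤ := (x + s * p.1, y + s' * p.2)

theorem isFrame_frame {x y s s' : ℤ} (hs : s = 1 ∨ s = -1) (hs' : s' = 1 ∨ s' = -1) :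
    IsFrame (frame x y s s') := by
  constructor
  · rintro ⟨a, b⟩ ⟨c, d⟩ h
    simp only [frame, Prod.mk.injEq] at h ⊢
    rcases hs with rfl | rfl <;> rcases hs' with rfl | rfl <;> omega
  · intro p q h
    rw [mem_neighbors] at h ⊢
    simp only [frame]
    rcases hs with rfl | rfl <;> rcases hs' with rfl | rfl <;> omega

/-! ### The small boxes -/

/-- The configurations `Y` and `Y'` are connected by adding and removing pebbles at the positions in
the list, where a pebble is removed only if it could be put back. -/
def Walk (N : ℕ) : Configuration → List (ℤ × ℤ) → Configuration → Prop
  | Y, [], Y' => Y = Y'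
  | Y, p :: ps, Y' => 2 ≤ numNeighbors (Y.erase p) p ∧ (Y.erase p).card < N ∧
      Walk N (if p ∈ Y then Y.erase p else insert p Y) ps Y'

instance Walk.decidable (N : ℕ) : ∀ (Y : Configuration) (ps : List (ℤ × ℤ)) (Y' : Configuration),
    Decidable (Walk N Y ps Y')
  | Y, [], Y' => inferInstanceAs (Decidable (Y = Y'))
  | Y, p :: ps, Y' =>
    have := Walk.decidable N (if p ∈ Y then Y.erase p else insert p Y) ps Y'
    inferInstanceAs (Decidable (_ ∧ _ ∧ _))

theorem Walk.equi {N : ℕ} {Y Y' : Configuration} {ps : List (ℤ × ℤ)} (h : Walk N Y ps Y') :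
    Equi N Y Y' := by
  induction ps generalizing Y with
  | nil => obtain rfl : Y = Y' := h; exact Equi.refl _ _
  | cons p ps ih =>
    obtain ⟨h2, hN, h⟩ := h
    rw [two_le_numNeighbors_iff] at h2
    refine Equi.trans ?_ (ih h)
    split_ifs with hp
    · refine ⟨Peb.drop (Finset.erase_subset _ _), ?_⟩
      have := Peb.add h2 hN
      rwa [Finset.insert_erase hp] at this
    · rw [Finset.erase_eq_of_notMem hp] at h2 hN
      exact ⟨Peb.add h2 hN, Peb.drop (Finset.subset_insert _ _)⟩

/-! Each of the following sequences of at most sixteen steps connects two configurations of three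
coins that span the box of three by three, two by four, or two by three positions at the origin. -/

theorem equi_three_three_corner : Equi 5 {(0, 0), (1, 1), (2, 2)} {(0, 0), (0, 2), (2, 2)} :=
  Walk.equi (ps := [(0, 1), (1, 2), (1, 1), (0, 2), (0, 1), (1, 2)]) (by decide)

theorem equi_three_three_side : Equi 5 {(0, 0), (0, 2), (2, 1)} {(0, 0), (2, 0), (0, 2)} :=
  Walk.equi (ps := [(0, 1), (1, 1), (0, 1), (1, 0), (1, 1), (0, 1), (0, 0), (1, 1), (0, 1), (2, 0),
    (2, 1), (0, 1), (1, 1), (0, 0), (0, 1), (1, 0)]) (by decide)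

theorem equi_two_four_top : Equi 5 {(0, 0), (1, 1), (1, 3)} {(0, 0), (1, 1), (0, 3)} :=
  Walk.equi (ps := [(0, 1), (1, 2), (1, 1), (0, 2), (0, 1), (0, 3), (1, 3), (0, 1), (0, 2), (1, 1),
    (0, 1), (0, 2), (1, 2), (0, 1), (0, 2), (0, 1)]) (by decide)

theorem equi_two_four_bottom : Equi 5 {(0, 0), (1, 1), (0, 3)} {(0, 0), (0, 2), (1, 3)} :=
  Walk.equi (ps := [(0, 1), (0, 2), (0, 1), (1, 2), (0, 2), (0, 1), (1, 1), (0, 2), (0, 1), (1, 3),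
    (0, 3), (1, 2)]) (by decide)

theorem equi_two_three_end : Equi 5 {(0, 0), (0, 2), (1, 1)} {(0, 0), (1, 0), (0, 2)} :=
  Walk.equi (ps := [(0, 1), (1, 0), (1, 1), (0, 1)]) (by decide)

theorem equi_two_three_corner : Equi 5 {(0, 0), (0, 2), (1, 1)} {(1, 0), (0, 1), (0, 2)} :=
  Walk.equi (ps := [(0, 1), (1, 0), (0, 0), (1, 1)]) (by decide)

theorem equi_two_three_far : Equi 5 {(0, 0), (0, 2), (1, 1)} {(1, 0), (1, 1), (0, 2)} :=
  Walk.equi (ps := [(0, 1), (1, 0), (0, 0), (0, 1)]) (by decide)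

/-- A connection between two configurations of three coins whose last two coins span smaller boxes
`P` and `P'` is a connection between these two ways to grow. -/
theorem Conn.of_equi {K : ℕ} {s : ℤ} (ih : ∀ P : Box, P.semi < s → ∀ K, BoxConn P K)
    (hK : 3 ≤ K) {a b c a' b' c' : ℤ × ℤ} (h : Equi 5 {a, b, c} {a', b', c'}) {P P' : Box}
    (hP : Grow (single b) c P) (hP' : Grow (single b') c' P') (hs : P.semi < s)
    (hs' : P'.semi < s) : Conn K P a P' a' := by
  intro Y Y' hY hY' hc hc'
  obtain ⟨K, rfl⟩ : ∃ K', K = K' + 1 := ⟨K - 1, by omega⟩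
  have e1 := ((ih P hs K).equi hY (hP.spans (spans_singleton b)) (by omega)
    (Finset.card_le_two.trans (by omega))).insert_congr a (M := K + 1 + 2) (by omega)
  have e2 := ((ih P' hs' K).equi hY' (hP'.spans (spans_singleton b')) (by omega)
    (Finset.card_le_two.trans (by omega))).insert_congr a' (M := K + 1 + 2) (by omega)
  rw [Finset.pair_comm] at e1 e2
  exact e1.trans ((h.mono (by omega)).trans e2.symm)

/-- A connection of configurations of three coins near the origin gives, after a symmetry of the
grid, a connection between two ways to grow: in both configurations the second and the third coin
span the smaller box. -/
theorem Conn.of_frame {K : ℕ} {σ : ℤ} (ih : ∀ P : Box, P.semi < σ → ∀ K, BoxConn P K) (hK : 3 ≤ K)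
    (x y s s' : ℤ) (a b c a' b' c' : ℤ × ℤ) {S S' : Configuration} (h : Equi 5 S S')
    {P P' : Box} {p p' : ℤ × ℤ}
    (hP : Grow (single (frame x y s s' b)) (frame x y s s' c) P := by
      simp only [frame, Grow, Near, join, single, Box.mk.injEq, ne_eq]; omega)
    (hP' : Grow (single (frame x y s s' b')) (frame x y s s' c') P' := by
      simp only [frame, Grow, Near, join, single, Box.mk.injEq, ne_eq]; omega)
    (hp : frame x y s s' a = p := by simp only [frame, Prod.mk.injEq]; omega)
    (hp' : frame x y s s' a' = p' := by simp only [frame, Prod.mk.injEq]; omega)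
    (hσ : P.semi < σ := by simp only [Box.semi]; omega)
    (hσ' : P'.semi < σ := by simp only [Box.semi]; omega)
    (hS : S = {a, b, c} := by decide) (hS' : S' = {a', b', c'} := by decide)
    (hs : s = 1 ∨ s = -1 := by decide) (hs' : s' = 1 ∨ s' = -1 := by decide) :
    Conn K P p P' p' := by
  subst hS hS' hp hp'
  have := h.image (isFrame_frame (x := x) (y := y) hs hs')
  simp only [Finset.image_insert, Finset.image_singleton] at this
  exact Conn.of_equi ih hK this hP hP' hσ hσ'

section Small

variable {l b : ℤ} {K : ℕ}

/-- In a box of three by three positions the upper corners are connected, and the growths by two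
lines are, because of explicit sequences of steps with three coins. -/
theorem conn_ne_of_three_three (ih : ∀ P : Box, P.semi < 6 → ∀ K, BoxConn P K) (hK : 3 ≤ K)
    {P : Box} {x : ℤ × ℤ} (hg : Grow P x ⟨l, l + 2, b, b + 2, by omega, by omega⟩) :
    Conn K P x ⟨l, l + 2 - 1, b, b + 2 - 1, by omega, by omega⟩ (l + 2, b + 2) := by
  have ih' : ∀ P : Box, P.semi < (l + 2 - l) + (b + 2 - b) + 2 → ∀ K, BoxConn P K :=
    fun P hP => ih P (by omega)
  have hK' : (6 : ℤ) ≤ 2 * K := by omega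
  have right₂ : Conn K ⟨l, l + 2 - 2, b, b + 2, by omega, by omega⟩ (l + 2, b + 2)
      ⟨l, l + 2 - 1, b, b + 2 - 1, by omega, by omega⟩ (l + 2, b + 2) :=
    Conn.of_frame ih hK l b 1 1 (2, 2) (0, 0) (0, 2) (2, 2) (0, 0) (1, 1)
      equi_three_three_corner.symm
  have right₁ : Conn K ⟨l, l + 2 - 2, b, b + 2, by omega, by omega⟩ (l + 2, b + 1)
      ⟨l, l + 2 - 1, b, b + 2 - 1, by omega, by omega⟩ (l + 2, b + 2) :=
    (Conn.of_frame ih hK l (b + 2) 1 (-1) (2, 1) (0, 0) (0, 2) (2, 0) (0, 0) (0, 2)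
      equi_three_three_side).trans right₂ (by simp only [Box.semi]; omega)
  have right₀ : Conn K ⟨l, l + 2 - 2, b, b + 2, by omega, by omega⟩ (l + 2, b)
      ⟨l, l + 2 - 1, b, b + 2 - 1, by omega, by omega⟩ (l + 2, b + 2) :=
    (Conn.of_frame ih hK l b 1 1 (2, 0) (0, 0) (0, 2) (2, 1) (0, 0) (0, 2)
      equi_three_three_side.symm).trans right₁ (by simp only [Box.semi]; omega)
  have nw : Conn K ⟨l + 1, l + 2, b, b + 2 - 1, by omega, by omega⟩ (l, b + 2)
      ⟨l, l + 2 - 1, b, b + 2 - 1, by omega, by omega⟩ (l + 2, b + 2) :=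
    (Conn.of_frame ih hK l (b + 2) 1 (-1) (0, 0) (1, 1) (2, 2) (2, 2) (0, 0) (0, 2)
      equi_three_three_corner).trans right₀ (by simp only [Box.semi]; omega)
  have left₀ : Conn K ⟨l + 2, l + 2, b, b + 2, by omega, by omega⟩ (l, b)
      ⟨l, l + 2 - 1, b, b + 2 - 1, by omega, by omega⟩ (l + 2, b + 2) :=
    Conn.of_frame ih hK (l + 2) (b + 2) (-1) (-1) (2, 2) (0, 0) (0, 2) (0, 0) (1, 1) (2, 2)
      equi_three_three_corner.symm
  have left₁ : Conn K ⟨l + 2, l + 2, b, b + 2, by omega, by omega⟩ (l, b + 1)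
      ⟨l, l + 2 - 1, b, b + 2 - 1, by omega, by omega⟩ (l + 2, b + 2) :=
    (Conn.of_frame ih hK (l + 2) b (-1) 1 (2, 1) (0, 0) (0, 2) (2, 0) (0, 0) (0, 2)
      equi_three_three_side).trans left₀ (by simp only [Box.semi]; omega)
  have left₂ : Conn K ⟨l + 2, l + 2, b, b + 2, by omega, by omega⟩ (l, b + 2)
      ⟨l, l + 2 - 1, b, b + 2 - 1, by omega, by omega⟩ (l + 2, b + 2) :=
    (Conn.of_frame ih hK (l + 2) (b + 2) (-1) (-1) (2, 0) (0, 0) (0, 2) (2, 1) (0, 0) (0, 2)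
      equi_three_three_side.symm).trans left₁ (by simp only [Box.semi]; omega)
  have top₀ : Conn K ⟨l, l + 2, b, b + 2 - 2, by omega, by omega⟩ (l, b + 2)
      ⟨l, l + 2 - 1, b, b + 2 - 1, by omega, by omega⟩ (l + 2, b + 2) :=
    (Conn.of_frame ih hK l b 1 1 (0, 2) (0, 0) (2, 0) (2, 1) (0, 0) (0, 2)
      equi_three_three_side.symm).trans right₁ (by simp only [Box.semi]; omega)
  have top₂ : Conn K ⟨l, l + 2, b, b + 2 - 2, by omega, by omega⟩ (l + 2, b + 2)
      ⟨l, l + 2 - 1, b, b + 2 - 1, by omega, by omega⟩ (l + 2, b + 2) :=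
    (Conn.of_frame ih hK (l + 2) b (-1) 1 (0, 2) (0, 0) (2, 0) (2, 1) (0, 0) (0, 2)
      equi_three_three_side.symm).trans left₁ (by simp only [Box.semi]; omega)
  have bottom₀ : Conn K ⟨l, l + 2, b + 2, b + 2, by omega, by omega⟩ (l, b)
      ⟨l, l + 2 - 1, b, b + 2 - 1, by omega, by omega⟩ (l + 2, b + 2) :=
    (Conn.of_frame ih hK l (b + 2) 1 (-1) (0, 2) (0, 0) (2, 0) (2, 1) (0, 0) (0, 2)
      equi_three_three_side.symm).trans right₁ (by simp only [Box.semi]; omega)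
  have bottom₂ : Conn K ⟨l, l + 2, b + 2, b + 2, by omega, by omega⟩ (l + 2, b)
      ⟨l, l + 2 - 1, b, b + 2 - 1, by omega, by omega⟩ (l + 2, b + 2) :=
    (Conn.of_frame ih hK (l + 2) (b + 2) (-1) (-1) (0, 2) (0, 0) (2, 0) (2, 1) (0, 0) (0, 2)
      equi_three_three_side.symm).trans left₁ (by simp only [Box.semi]; omega)
  -- a coin in the middle of a side moves to a corner, seen after a reflection at the diagonal
  have side := equi_three_three_side.image isFrame_swap
  refine conn_ne_of_links ih' (by omega) (by omega) (by omega) nw ?_ ?_ ?_ ?_ hg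
  · intro j hj hj' _
    obtain rfl | rfl | rfl : j = b ∨ j = b + 1 ∨ j = b + 2 := by omega
    exacts [right₀, right₁, right₂]
  · intro j hj hj' _
    obtain rfl | rfl | rfl : j = b ∨ j = b + 1 ∨ j = b + 2 := by omega
    exacts [left₀, left₁, left₂]
  · intro j hj hj' _
    obtain rfl | rfl | rfl : j = l ∨ j = l + 1 ∨ j = l + 2 := by omega
    · exact top₀
    · exact (Conn.of_frame ih hK l b 1 1 (1, 2) (0, 0) (2, 0) (0, 2) (0, 0) (2, 0) side).trans top₀
        (by simp only [Box.semi]; omega)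
    · exact top₂
  · intro j hj hj' _
    obtain rfl | rfl | rfl : j = l ∨ j = l + 1 ∨ j = l + 2 := by omega
    · exact bottom₀
    · exact (Conn.of_frame ih hK l (b + 2) 1 (-1) (1, 2) (0, 0) (2, 0) (0, 2) (0, 0) (2, 0)
        side).trans bottom₀ (by simp only [Box.semi]; omega)
    · exact bottom₂

/-- In a box with two columns and four rows, the growths by two rows are connected by explicit
sequences of steps, and all others are connected to them. -/
theorem conn_top_of_two_four (ih : ∀ P : Box, P.semi < 6 → ∀ K, BoxConn P K) (hK : 3 ≤ K)
    {P : Box} {x : ℤ × ℤ} (hg : Grow P x ⟨l, l + 1, b, b + 3, by omega, by omega⟩) :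
    Conn K P x ⟨l, l + 1, b, b + 3 - 2, by omega, by omega⟩ (l, b + 3) := by
  have ih' : ∀ P : Box, P.semi < (l + 1 - l) + (b + 3 - b) + 2 → ∀ K, BoxConn P K :=
    fun P hP => ih P (by omega)
  have hK' : (6 : ℤ) ≤ 2 * K := by omega
  have top₂ : ∀ i, l ≤ i → i ≤ l + 1 →
      Conn K ⟨l, l + 1, b, b + 3 - 2, by omega, by omega⟩ (i, b + 3)
      ⟨l, l + 1, b, b + 3 - 2, by omega, by omega⟩ (l, b + 3) := by
    intro i hi hi'
    obtain rfl | rfl : i = l ∨ i = l + 1 := by omega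
    · exact Conn.refl ih (by simp only [Box.semi]; omega)
    · exact Conn.of_frame ih hK l b 1 1 (1, 3) (0, 0) (1, 1) (0, 3) (0, 0) (1, 1) equi_two_four_top
  have bottom₂ : ∀ i, l ≤ i → i ≤ l + 1 → Conn K ⟨l, l + 1, b + 2, b + 3, by omega, by omega⟩ (i, b)
      ⟨l, l + 1, b, b + 3 - 2, by omega, by omega⟩ (l, b + 3) := by
    intro i hi hi'
    have h : Conn K ⟨l, l + 1, b + 2, b + 3, by omega, by omega⟩ (l, b)
        ⟨l, l + 1, b, b + 3 - 2, by omega, by omega⟩ (l, b + 3) :=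
      Conn.of_frame ih hK l b 1 1 (0, 0) (0, 2) (1, 3) (0, 3) (0, 0) (1, 1)
        equi_two_four_bottom.symm
    obtain rfl | rfl : i = l ∨ i = l + 1 := by omega
    · exact h
    · exact (Conn.of_frame ih hK l (b + 3) 1 (-1) (1, 3) (0, 0) (1, 1) (0, 3) (0, 0) (1, 1)
        equi_two_four_top).trans h (by simp only [Box.semi]; omega)
  have ne : ∀ h h', Conn K ⟨l, l + 1 - 1, b, b + 3 - 1, h, h'⟩ (l + 1, b + 3)
      ⟨l, l + 1, b, b + 3 - 2, by omega, by omega⟩ (l, b + 3) := fun _ _ =>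
    (conn_bottom_ne ih' (k := 2) (.inr rfl) (by omega) (by omega) (i := l) (by omega)
      (by omega)).symm.trans (bottom₂ l (by omega) (by omega)) (by simp only [Box.semi]; omega)
  have nw : ∀ h h', Conn K ⟨l + 1, l + 1, b, b + 3 - 1, h, h'⟩ (l, b + 3)
      ⟨l, l + 1, b, b + 3 - 2, by omega, by omega⟩ (l, b + 3) := fun _ _ =>
    (conn_bottom_nw ih' (k := 2) (.inr rfl) (by omega) (by omega) (i := l + 1) (by omega)
      (by omega)).symm.trans (bottom₂ (l + 1) (by omega) (by omega))
      (by simp only [Box.semi]; omega)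
  have se : ∀ h h', Conn K ⟨l, l + 1 - 1, b + 1, b + 3, h, h'⟩ (l + 1, b)
      ⟨l, l + 1, b, b + 3 - 2, by omega, by omega⟩ (l, b + 3) := fun _ _ =>
    (conn_top_se ih' (k := 2) (.inr rfl) (by omega) (by omega) (i := l) (by omega)
      (by omega)).symm.trans (top₂ l (by omega) (by omega)) (by simp only [Box.semi]; omega)
  have sw : ∀ h h', Conn K ⟨l + 1, l + 1, b + 1, b + 3, h, h'⟩ (l, b)
      ⟨l, l + 1, b, b + 3 - 2, by omega, by omega⟩ (l, b + 3) := fun _ _ =>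
    (conn_top_sw ih' (k := 2) (.inr rfl) (by omega) (by omega) (i := l + 1) (by omega)
      (by omega)).symm.trans (top₂ (l + 1) (by omega) (by omega)) (by simp only [Box.semi]; omega)
  refine Grow.cases (motive := fun P x =>
    Conn K P x ⟨l, l + 1, b, b + 3 - 2, by omega, by omega⟩ (l, b + 3)) ?_ ?_ ?_ ?_ ne se nw sw hg
  · intro k j hk h hj hj'
    by_cases hjt : j ≤ b + 3 - 2
    · exact conn_right_top ih' hk (i := l) le_rfl (by omega) hj hjt
    · exact (conn_right_bottom ih' hk (i := l) le_rfl (by omega) (by omega) hj').trans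
        (bottom₂ l (by omega) (by omega)) (by simp only [Box.semi]; omega)
  · intro k j hk h hj hj'
    by_cases hjt : j ≤ b + 3 - 2
    · exact (conn_left_top ih' hk (i := l + 1) (by omega) (by omega) hj hjt).trans
        (top₂ (l + 1) (by omega) (by omega)) (by simp only [Box.semi]; omega)
    · exact (conn_left_bottom ih' hk (i := l + 1) (by omega) (by omega) (by omega) hj').trans
        (bottom₂ (l + 1) (by omega) (by omega)) (by simp only [Box.semi]; omega)
  · intro k i hk h hi hi'
    by_cases hir : i ≤ l
    · exact (conn_top_se ih' hk (by omega) (by omega) hi (by omega)).trans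
        (se (by omega) (by omega))
        (by simp only [Box.semi]; omega)
    · exact (conn_top_sw ih' hk (by omega) (by omega) (by omega) hi').trans
        (sw (by omega) (by omega))
        (by simp only [Box.semi]; omega)
  · intro k i hk h hi hi'
    by_cases hir : i ≤ l
    · exact (conn_bottom_ne ih' hk (by omega) (by omega) hi (by omega)).trans
        (ne (by omega) (by omega)) (by simp only [Box.semi]; omega)
    · exact (conn_bottom_nw ih' hk (by omega) (by omega) (by omega) hi').trans
        (nw (by omega) (by omega)) (by simp only [Box.semi]; omega)

/-- In a box with two columns and three rows, all ways to grow are connected to the growth by the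
right column with the coin in the middle, mostly by explicit sequences of steps. -/
theorem conn_right_of_two_three (ih : ∀ P : Box, P.semi < 5 → ∀ K, BoxConn P K) (hK : 3 ≤ K)
    {P : Box} {x : ℤ × ℤ} (hg : Grow P x ⟨l, l + 1, b, b + 2, by omega, by omega⟩) :
    Conn K P x ⟨l, l + 1 - 1, b, b + 2, by omega, by omega⟩ (l + 1, b + 1) := by
  have ih' : ∀ P : Box, P.semi < (l + 1 - l) + (b + 2 - b) + 2 → ∀ K, BoxConn P K :=
    fun P hP => ih P (by omega)
  have ne : Conn K ⟨l, l + 1 - 1, b, b + 2 - 1, by omega, by omega⟩ (l + 1, b + 2)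
      ⟨l, l + 1 - 1, b, b + 2, by omega, by omega⟩ (l + 1, b + 1) :=
    Conn.of_frame ih hK l (b + 2) 1 (-1) (1, 0) (0, 1) (0, 2) (1, 1) (0, 0) (0, 2)
      equi_two_three_corner.symm
  have se : Conn K ⟨l, l + 1 - 1, b + 1, b + 2, by omega, by omega⟩ (l + 1, b)
      ⟨l, l + 1 - 1, b, b + 2, by omega, by omega⟩ (l + 1, b + 1) :=
    Conn.of_frame ih hK l b 1 1 (1, 0) (0, 1) (0, 2) (1, 1) (0, 0) (0, 2)
      equi_two_three_corner.symm
  have nw : Conn K ⟨l + 1, l + 1, b, b + 2 - 1, by omega, by omega⟩ (l, b + 2)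
      ⟨l, l + 1 - 1, b, b + 2, by omega, by omega⟩ (l + 1, b + 1) :=
    Conn.of_frame ih hK l b 1 1 (0, 2) (1, 0) (1, 1) (1, 1) (0, 0) (0, 2) equi_two_three_far.symm
  have sw : Conn K ⟨l + 1, l + 1, b + 1, b + 2, by omega, by omega⟩ (l, b)
      ⟨l, l + 1 - 1, b, b + 2, by omega, by omega⟩ (l + 1, b + 1) :=
    Conn.of_frame ih hK l (b + 2) 1 (-1) (0, 2) (1, 0) (1, 1) (1, 1) (0, 0) (0, 2)
      equi_two_three_far.symm
  have left₁ : Conn K ⟨l + 1, l + 1, b, b + 2, by omega, by omega⟩ (l, b + 1)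
      ⟨l, l + 1 - 1, b, b + 2, by omega, by omega⟩ (l + 1, b + 1) :=
    (Conn.of_frame ih hK (l + 1) b (-1) 1 (1, 1) (0, 0) (0, 2) (1, 0) (0, 1) (0, 2)
      equi_two_three_corner).trans sw (by simp only [Box.semi]; omega)
  refine Grow.cases (motive := fun P x =>
    Conn K P x ⟨l, l + 1 - 1, b, b + 2, by omega, by omega⟩ (l + 1, b + 1)) ?_ ?_ ?_ ?_
    (fun _ _ => ne) (fun _ _ => se) (fun _ _ => nw) (fun _ _ => sw) hg
  · intro k j hk h hj hj'
    obtain rfl : k = 1 := by omega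
    obtain rfl | rfl | rfl : b = j ∨ j = b + 1 ∨ j = b + 2 := by omega
    · exact Conn.of_frame ih hK l b 1 1 (1, 0) (0, 0) (0, 2) (1, 1) (0, 0) (0, 2)
        equi_two_three_end.symm
    · exact Conn.refl ih (by simp only [Box.semi]; omega)
    · exact Conn.of_frame ih hK l (b + 2) 1 (-1) (1, 0) (0, 0) (0, 2) (1, 1) (0, 0) (0, 2)
        equi_two_three_end.symm
  · intro k j hk h hj hj'
    obtain rfl : k = 1 := by omega
    obtain rfl | rfl | rfl : b = j ∨ j = b + 1 ∨ j = b + 2 := by omega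
    · exact (Conn.of_frame ih hK (l + 1) b (-1) 1 (1, 0) (0, 0) (0, 2) (1, 1) (0, 0) (0, 2)
        equi_two_three_end.symm).trans left₁ (by simp only [Box.semi]; omega)
    · exact left₁
    · exact (Conn.of_frame ih hK (l + 1) (b + 2) (-1) (-1) (1, 0) (0, 0) (0, 2) (1, 1) (0, 0)
        (0, 2) equi_two_three_end.symm).trans left₁ (by simp only [Box.semi]; omega)
  · intro k i hk h hi hi'
    obtain rfl | rfl := hk <;> obtain rfl | rfl : l = i ∨ i = l + 1 := by omega
    · exact (conn_top_se ih' (.inl rfl) (by omega) (by omega) hi (by omega)).trans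
        se (by simp only [Box.semi]; omega)
    · exact (conn_top_sw ih' (.inl rfl) (by omega) (by omega) (by omega) hi').trans
        sw (by simp only [Box.semi]; omega)
    · exact Conn.of_frame ih hK l b 1 1 (0, 2) (0, 0) (1, 0) (1, 1) (0, 0) (0, 2)
        equi_two_three_end.symm
    · exact (Conn.of_frame ih hK (l + 1) b (-1) 1 (0, 2) (0, 0) (1, 0) (1, 1) (0, 0) (0, 2)
        equi_two_three_end.symm).trans left₁ (by simp only [Box.semi]; omega)
  · intro k i hk h hi hi'
    obtain rfl | rfl := hk <;> obtain rfl | rfl : l = i ∨ i = l + 1 := by omega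
    · exact (conn_bottom_ne ih' (.inl rfl) (by omega) (by omega) hi (by omega)).trans
        ne (by simp only [Box.semi]; omega)
    · exact (conn_bottom_nw ih' (.inl rfl) (by omega) (by omega) (by omega) hi').trans
        nw (by simp only [Box.semi]; omega)
    · exact Conn.of_frame ih hK l (b + 2) 1 (-1) (0, 2) (0, 0) (1, 0) (1, 1) (0, 0) (0, 2)
        equi_two_three_end.symm
    · exact (Conn.of_frame ih hK (l + 1) (b + 2) (-1) (-1) (0, 2) (0, 0) (1, 0) (1, 1) (0, 0)
        (0, 2) equi_two_three_end.symm).trans left₁ (by simp only [Box.semi]; omega)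

end Small

/-- If there are enough pebbles to fill the box, then every spanning configuration can be reached.
-/
theorem BoxConn.of_card_le {Q : Box} {K : ℕ} {Z : Configuration} (hZ : (Z : Set (ℤ × ℤ)) = Q.cells)
    (hc : Z.card ≤ K + 2) : BoxConn Q K := by
  intro Y Y' hY hY' _ _
  have h : ∀ Y : Configuration, Spans Y Q → Y ⊆ Z := fun Y hY => by
    rw [← Finset.coe_subset, hZ]; exact hY.subset
  exact (Peb.fill (h Y hY) (by rw [hZ, ← hY]) hc).trans (Peb.drop (h Y' hY'))

theorem exists_finset_eq_cells (Q : Box) : ∃ Z : Configuration, (Z : Set (ℤ × ℤ)) = Q.cells ∧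
    Z.card = (Q.r + 1 - Q.l).toNat * (Q.t + 1 - Q.b).toNat := by
  refine ⟨Finset.Icc Q.l Q.r ×ˢ Finset.Icc Q.b Q.t, ?_, ?_⟩
  · ext p
    simp only [Finset.coe_product, Finset.coe_Icc, Set.mem_prod, Set.mem_Icc, mem_cells]
    tauto
  · rw [Finset.card_product, Int.card_Icc, Int.card_Icc]

/-- In a box that is at least as high as it is wide and has more than `K + 2` positions, there is a
way to grow to which all others are connected. -/
theorem exists_hub {Q : Box} {K : ℕ} (ih : ∀ P : Box, P.semi < Q.semi → ∀ K, BoxConn P K)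
    (hK : Q.semi ≤ 2 * K) (hwh : Q.r - Q.l ≤ Q.t - Q.b)
    (hc : ∀ Z : Configuration, (Z : Set (ℤ × ℤ)) = Q.cells → K + 2 < Z.card) :
    ∃ (P₀ : Box) (x₀ : ℤ × ℤ), P₀.semi + 2 ≤ 2 * (K : ℤ) ∧
      ∀ P x, Grow P x Q → Conn K P x P₀ x₀ := by
  obtain ⟨Z, hZ, hZc⟩ := exists_finset_eq_cells Q
  have hc := hc Z hZ
  rw [hZc] at hc
  clear hZ hZc
  obtain ⟨l, r, b, t, hlr, hbt⟩ := Q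
  change ∀ P : Box, P.semi < (r - l) + (t - b) + 2 → _ at ih
  change (r - l) + (t - b) + 2 ≤ 2 * (K : ℤ) at hK
  dsimp only at hwh hc
  by_cases h1 : l + 2 ≤ r ∧ b + 3 ≤ t
  · exact ⟨_, _, by simp only [Box.semi]; omega, fun P x hg => conn_ne_of_large ih hK h1.1 h1.2 hg⟩
  by_cases h2 : r ≤ l + 1 ∧ b + 4 ≤ t
  · exact ⟨_, _, by simp only [Box.semi]; omega,
      fun P x hg => conn_top_of_narrow ih hK hlr h2.1 h2.2 hg⟩
  obtain ⟨rfl, rfl⟩ | ⟨rfl, rfl⟩ | ⟨rfl, rfl⟩ | h3 : r = l + 2 ∧ t = b + 2 ∨ r = l + 1 ∧ t = b + 3 ∨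
    r = l + 1 ∧ t = b + 2 ∨ (r = l + 1 ∧ t = b + 1 ∨ r = l ∧ t ≤ b + 3) := by omega
  · exact ⟨_, _, by simp only [Box.semi]; omega, fun P x hg =>
      conn_ne_of_three_three (fun P hP => ih P (by omega)) (by omega) hg⟩
  · exact ⟨_, _, by simp only [Box.semi]; omega, fun P x hg =>
      conn_top_of_two_four (fun P hP => ih P (by omega)) (by omega) hg⟩
  · exact ⟨_, _, by simp only [Box.semi]; omega, fun P x hg =>
      conn_right_of_two_three (fun P hP => ih P (by omega)) (by omega) hg⟩
  · exfalso
    obtain ⟨rfl, rfl⟩ | ⟨rfl, h3⟩ := h3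
    · have h4 : (l + 1 + 1 - l).toNat = 2 := by omega
      have h5 : (b + 1 + 1 - b).toNat = 2 := by omega
      rw [h4, h5] at hc
      omega
    · have h4 : (r + 1 - r).toNat = 1 := by omega
      rw [h4, one_mul] at hc
      omega

/-- The induction step, for a box that is at least as high as it is wide: both configurations are
normalized, and the two ways to grow are connected through the one from `exists_hub`. -/
theorem boxConn_of_smaller {Q : Box} (ih : ∀ P : Box, P.semi < Q.semi → ∀ K, BoxConn P K)
    (hwh : Q.r - Q.l ≤ Q.t - Q.b) (K : ℕ) : BoxConn Q K := by
  induction K with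
  | zero =>
    intro Y Y' hY hY' hc hc'
    exact absurd (Finset.card_pos.2 hY.nonempty) (by omega)
  | succ K ihK =>
    by_cases hZ : ∃ Z : Configuration, (Z : Set (ℤ × ℤ)) = Q.cells ∧ Z.card ≤ K + 1 + 2
    · obtain ⟨Z, hZ, hc⟩ := hZ
      exact BoxConn.of_card_le hZ hc
    · push Not at hZ
      intro Y Y' hY hY' hc hc'
      have hQ : 2 < Q.semi := by
        by_contra h
        obtain ⟨q, hq⟩ := Q.cells_nonempty
        have := hZ {q} (by rw [eq_single_of_semi_le (not_lt.1 h) hq, cells_single]; simp)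
        simp at this
      obtain ⟨P₀, x₀, hs, hub⟩ := exists_hub ih (hY.semi_le.trans (by omega)) hwh hZ
      have hP : ∀ K', K + 1 = K' + 1 → BoxConn Q K' := fun K' h => by
        obtain rfl : K = K' := by omega
        exact ihK
      obtain ⟨P, x, W, hg, hW, hWc, e⟩ := hY.normalizable hQ hP ih hc
      obtain ⟨P', x', W', hg', hW', hWc', e'⟩ := hY'.normalizable hQ hP ih hc'
      exact (e.trans ((((hub P x hg).trans (hub P' x' hg').symm hs) W W' hW hW' hWc hWc').trans
        e'.symm)).1

/-- All configurations of at most `K` coins that span the same box can be transformed into each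
other with two more pebbles. -/
theorem boxConn (Q : Box) (K : ℕ) : BoxConn Q K := by
  obtain ⟨n, hn⟩ : ∃ n : ℕ, Q.semi ≤ n := ⟨Q.semi.toNat, Int.self_le_toNat _⟩
  induction n generalizing Q K with
  | zero =>
    have := Q.hlr
    have := Q.hbt
    simp only [Box.semi] at hn
    omega
  | succ n ih =>
    have ih' : ∀ P : Box, P.semi < Q.semi → ∀ K, BoxConn P K := fun P hP K => ih P K (by omega)
    rcases le_total (Q.r - Q.l) (Q.t - Q.b) with h | h
    · exact boxConn_of_smaller ih' h K
    · refine BoxConn.of_transpose (boxConn_of_smaller (fun P hP => ih' P (hP.trans_eq ?_)) h K)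
      simp only [Box.semi, Box.transpose]
      ring

/-! ### Configurations with the same hull -/

theorem exists_tight_corner (Q : Box) :
    ∃ D : Configuration, Spans D Q ∧ 2 * (D.card : ℤ) ≤ Q.semi + 1 :=
  have ⟨p, hp⟩ := Q.cells_nonempty
  have ⟨D, hD, hc, _⟩ := exists_tight Q p hp
  ⟨D, hD, hc⟩

/-- A chosen minimum configuration spanning the box `Q`. -/
noncomputable def tight (Q : Box) : Configuration := (exists_tight_corner Q).choose

theorem spans_tight (Q : Box) : Spans (tight Q) Q := (exists_tight_corner Q).choose_spec.1

theorem two_mul_card_tight_le (Q : Box) : 2 * ((tight Q).card : ℤ) ≤ Q.semi + 1 :=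
  (exists_tight_corner Q).choose_spec.2

theorem card_tight_le {Y : Configuration} {Q : Box} (h : Spans Y Q) : (tight Q).card ≤ Y.card := by
  have h1 := h.semi_le
  have h2 := two_mul_card_tight_le Q
  omega

theorem eq_of_mem_of_mem {𝓠 : Finset Box} (hfar : ∀ P ∈ 𝓠, ∀ Q ∈ 𝓠, Near P Q → P = Q) {P Q : Box}
    (hP : P ∈ 𝓠) (hQ : Q ∈ 𝓠) {p : ℤ × ℤ} (hp : p ∈ P.cells) (hq : p ∈ Q.cells) : P = Q :=
  hfar P hP Q hQ (near_of_mem hp hq (by simp))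

/-- The hull of a configuration is the union of finitely many pairwise far boxes. -/
theorem exists_far_family (D : Configuration) : ∃ 𝓠 : Finset Box,
    (∀ P ∈ 𝓠, ∀ Q ∈ 𝓠, Near P Q → P = Q) ∧ hull (D : Set (ℤ × ℤ)) = ⋃ Q ∈ 𝓠, Q.cells := by
  classical
  obtain ⟨F, hF, -, hs, hfar⟩ := exists_clusters D (fun _ => True) (fun _ _ => trivial)
  have : Nonempty Box := ⟨single (0, 0)⟩
  choose! box hbox using hs
  have hfar' : ∀ P ∈ F.image box, ∀ Q ∈ F.image box, Near P Q → P = Q := by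
    simp only [Finset.mem_image]
    rintro _ ⟨Z, hZ, rfl⟩ _ ⟨Z', hZ', rfl⟩ hn
    by_contra hne
    exact hfar Z hZ Z' hZ' (fun h => hne (h ▸ rfl)) _ _ (hbox Z hZ).1 (hbox Z' hZ').1 hn trivial
  refine ⟨F.image box, hfar', (hull_subset ?_ ?_).antisymm ?_⟩
  · intro p hp
    rw [← hF, Finset.mem_coe, Finset.mem_biUnion] at hp
    obtain ⟨Z, hZ, hp⟩ := hp
    exact Set.mem_biUnion (Finset.mem_image_of_mem box hZ) ((hbox Z hZ).1.subset hp)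
  · exact closed_biUnion_of_far (𝓠 := {Q | Q ∈ F.image box}) hfar' (fun Q _ => subset_rfl)
      (fun Q _ => closed_cells Q)
  · refine Set.iUnion₂_subset fun Q hQ => ?_
    obtain ⟨Z, hZ, rfl⟩ := Finset.mem_image.1 hQ
    rw [← (hbox Z hZ).1]
    refine hull_mono ?_
    rw [← hF]
    exact_mod_cast Finset.subset_biUnion_of_mem id hZ

section Part

open Classical in
/-- The part of a configuration that lies in a box. -/
noncomputable def part (D : Configuration) (Q : Box) : Configuration := D.filter (· ∈ Q.cells)

theorem mem_part {D : Configuration} {Q : Box} {p : ℤ × ℤ} :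
    p ∈ part D Q ↔ p ∈ D ∧ p ∈ Q.cells := by
  simp [part]

variable {𝓠 : Finset Box} {D : Configuration}

/-- If the hull of a configuration is a union of far boxes, then each of these boxes is spanned by
the coins in it. -/
theorem spans_part (hfar : ∀ P ∈ 𝓠, ∀ Q ∈ 𝓠, Near P Q → P = Q)
    (hD : hull (D : Set (ℤ × ℤ)) = ⋃ Q ∈ 𝓠, Q.cells) {Q : Box} (hQ : Q ∈ 𝓠) :
    Spans (part D Q) Q := by
  have hpart : ∀ Q, hull (part D Q : Set (ℤ × ℤ)) ⊆ Q.cells := fun Q =>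
    hull_subset (fun p hp => (mem_part.1 hp).2) (closed_cells Q)
  refine (hpart Q).antisymm fun p hp => ?_
  have hsub : hull (D : Set (ℤ × ℤ)) ⊆ ⋃ Q ∈ 𝓠, hull (part D Q : Set (ℤ × ℤ)) := by
    refine hull_subset (fun q hq => ?_) (closed_biUnion_of_far (𝓠 := {Q | Q ∈ 𝓠}) hfar
      (fun Q _ => hpart Q) (fun Q _ => closed_hull _))
    obtain ⟨P, hP, hqP⟩ := Set.mem_iUnion₂.1 (hD.subset (subset_hull _ hq))
    exact Set.mem_biUnion hP (subset_hull _ (mem_part.2 ⟨hq, hqP⟩))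
  obtain ⟨P, hP, hpP⟩ := Set.mem_iUnion₂.1 (hsub (hD.symm.subset (Set.mem_biUnion hQ hp)))
  rwa [eq_of_mem_of_mem hfar hQ hP hp (hpart P hpP)]

theorem biUnion_part (hD : hull (D : Set (ℤ × ℤ)) = ⋃ Q ∈ 𝓠, Q.cells) : 𝓠.biUnion (part D) = D := by
  ext p
  simp only [Finset.mem_biUnion, mem_part]
  refine ⟨fun ⟨_, _, h, _⟩ => h, fun h => ?_⟩
  obtain ⟨P, hP, hpP⟩ := Set.mem_iUnion₂.1 (hD.subset (subset_hull _ h))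
  exact ⟨P, hP, h, hpP⟩

theorem sum_card_part (hfar : ∀ P ∈ 𝓠, ∀ Q ∈ 𝓠, Near P Q → P = Q)
    (hD : hull (D : Set (ℤ × ℤ)) = ⋃ Q ∈ 𝓠, Q.cells) : ∑ Q ∈ 𝓠, (part D Q).card = D.card := by
  rw [← Finset.card_biUnion, biUnion_part hD]
  intro P hP Q hQ hne
  refine Finset.disjoint_left.2 fun p hp hq => hne ?_
  exact eq_of_mem_of_mem hfar hP hQ (mem_part.1 hp).2 (mem_part.1 hq).2

theorem sum_card_tight_le (hfar : ∀ P ∈ 𝓠, ∀ Q ∈ 𝓠, Near P Q → P = Q)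
    (hD : hull (D : Set (ℤ × ℤ)) = ⋃ Q ∈ 𝓠, Q.cells) : ∑ Q ∈ 𝓠, (tight Q).card ≤ D.card := by
  rw [← sum_card_part hfar hD]
  exact Finset.sum_le_sum fun Q hQ => card_tight_le (spans_part hfar hD hQ)

end Part

/-- Configurations can be transformed part by part, so that two spare pebbles are enough for all
parts. -/
theorem Equi.biUnion {ι : Type*} (s : Finset ι) (f g : ι → Configuration) (k : ι → ℕ)
    (h : ∀ i ∈ s, Equi (k i + 2) (f i) (g i)) (hf : ∀ i ∈ s, (f i).card ≤ k i)
    (hg : ∀ i ∈ s, (g i).card ≤ k i) : Equi (∑ i ∈ s, k i + 2) (s.biUnion f) (s.biUnion g) := by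
  classical
  induction s using Finset.induction_on with
  | empty => exact Equi.refl _ _
  | insert a s ha ih =>
    simp only [Finset.forall_mem_insert] at h hf hg
    have hcard : (s.biUnion f).card ≤ ∑ i ∈ s, k i :=
      Finset.card_biUnion_le.trans (Finset.sum_le_sum hf.2)
    rw [Finset.biUnion_insert, Finset.biUnion_insert, Finset.sum_insert ha]
    refine (h.1.union (s.biUnion f) (by omega)).trans ?_
    rw [Finset.union_comm (g a), Finset.union_comm (g a)]
    exact (ih h.2 hf.2 hg.2).union (g a) (by have := hg.1; omega)

/-- Two configurations of at most `K` coins with the same hull can be transformed into each other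
with two more pebbles. -/
theorem equi_of_hull_eq {K : ℕ} {D D' : Configuration}
    (h : hull (D : Set (ℤ × ℤ)) = hull (D' : Set (ℤ × ℤ))) (hc : D.card ≤ K) (hc' : D'.card ≤ K) :
    Equi (K + 2) D D' := by
  obtain ⟨𝓠, hfar, hD⟩ := exists_far_family D
  have key : ∀ D : Configuration, hull (D : Set (ℤ × ℤ)) = ⋃ Q ∈ 𝓠, Q.cells → D.card ≤ K →
      Equi (K + 2) D (𝓠.biUnion tight) := by
    intro D hD hc
    have := Equi.biUnion 𝓠 (part D) tight (fun Q => (part D Q).card)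
      (fun Q hQ => (boxConn Q _).equi (spans_part hfar hD hQ) (spans_tight Q) le_rfl
        (card_tight_le (spans_part hfar hD hQ)))
      (fun _ _ => le_rfl) (fun Q hQ => card_tight_le (spans_part hfar hD hQ))
    rw [biUnion_part hD, sum_card_part hfar hD] at this
    exact this.mono (by omega)
  exact (key D hD hc).trans (key D' (h ▸ hD) hc').symm

/-! ### Growing the reachable hulls -/

/-- All configurations with hull `X` that leave two of `N` pebbles unused can be transformed into
`B`. -/
def Good (N : ℕ) (B : Configuration) (X : Set (ℤ × ℤ)) : Prop :=
  ∀ D : Configuration, hull (D : Set (ℤ × ℤ)) = X → D.card + 2 ≤ N → Peb N D B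

/-- Because of `equi_of_hull_eq`, a single configuration with hull `X'` that can be transformed into
a single one with hull `X` is enough. -/
theorem Good.of_peb {N : ℕ} {B : Configuration} {X X' : Set (ℤ × ℤ)} (h : Good N B X)
    {D D' : Configuration} (hD : hull (D : Set (ℤ × ℤ)) = X) (hc : D.card + 2 ≤ N)
    (hD' : hull (D' : Set (ℤ × ℤ)) = X') (hc' : D'.card + 2 ≤ N) (hp : Peb N D' D) :
    Good N B X' := by
  intro Y hY hYc
  have := (equi_of_hull_eq (K := N - 2) (hY.trans hD'.symm) (by omega) (by omega)).1
  rw [show N - 2 + 2 = N by omega] at this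
  exact this.trans (hp.trans (h D hD hc))

theorem good_self {N : ℕ} {B : Configuration} (hB : B.card + 2 ≤ N) :
    Good N B (hull (B : Set (ℤ × ℤ))) := by
  intro Y hY hYc
  have := (equi_of_hull_eq (K := N - 2) hY (by omega) (by omega)).1
  rwa [show N - 2 + 2 = N by omega] at this

/-- The union of a box and the boxes of a family. -/
def withFamily (𝓠 : Finset Box) (T : Box) : Set (ℤ × ℤ) := T.cells ∪ ⋃ Q ∈ 𝓠, Q.cells

theorem hull_biUnion_tight (𝓠 : Finset Box) :
    hull (𝓠.biUnion tight : Configuration) = hull (⋃ Q ∈ 𝓠, Q.cells) := by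
  refine hull_congr (fun p hp => ?_) (Set.iUnion₂_subset fun Q hQ => ?_)
  · obtain ⟨Q, hQ, hpQ⟩ := Finset.mem_biUnion.1 (Finset.mem_coe.1 hp)
    exact subset_hull _ (Set.mem_biUnion hQ ((spans_tight Q).subset hpQ))
  · rw [← spans_tight Q]
    exact hull_mono (by exact_mod_cast Finset.subset_biUnion_of_mem tight hQ)

theorem hull_union_tight {Y : Configuration} {T : Box} (h : Spans Y T) (𝓠 : Finset Box) :
    hull ((Y ∪ 𝓠.biUnion tight : Configuration) : Set (ℤ × ℤ)) = hull (withFamily 𝓠 T) := by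
  rw [Finset.coe_union, withFamily]
  exact hull_union_congr (h.trans (closed_cells T).hull_eq.symm) (hull_biUnion_tight 𝓠)

theorem card_union_tight_le (Y : Configuration) (𝓠 : Finset Box) :
    (Y ∪ 𝓠.biUnion tight).card ≤ Y.card + ∑ Q ∈ 𝓠, (tight Q).card :=
  (Finset.card_union_le _ _).trans (Nat.add_le_add_left Finset.card_biUnion_le _)

/-- When a box of odd semiperimeter grows by one line, there are minimum configurations of the
smaller and of the larger box that differ in one coin only, and the one for the larger box supports
the position where the other one has its coin. -/
theorem exists_shift {T T' : Box} {x p : ℤ × ℤ} (hp : p ∈ T.cells) (hx : x ∈ neighbors p)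
    (hT' : join T (single x) = T') (hxT : x ∉ T.cells) (hodd : T.semi % 2 = 1) :
    ∃ E y q, Spans (insert y E) T' ∧ Spans (insert q E) T ∧
      Supported ((insert y E : Configuration) : Set (ℤ × ℤ)) q ∧
      2 * ((E.card : ℤ) + 1) ≤ T.semi + 1 := by
  -- `S` is `T` without one line, and `c` one of its corners; the position `q`, next to `c`, makes
  -- up for this line, and the position `y`, next to `q`, makes up for the new line in addition
  obtain ⟨S, c, y, q, hc, hcorner, hy, hyT, hq, hqT, hcq, hyq, hyS, hS⟩ :
      ∃ (S : Box) (c y q : ℤ × ℤ), c ∈ S.cells ∧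
        ((c.1 = S.l ∨ c.1 = S.r) ∧ (c.2 = S.b ∨ c.2 = S.t)) ∧ Near S (single y) ∧
        join S (single y) = T' ∧ Near S (single q) ∧ join S (single q) = T ∧ c ∈ neighbors q ∧
        y ∈ neighbors q ∧ y ∉ S.cells ∧ S.semi + 1 = T.semi := by
    obtain ⟨l, r, b, t, hlr, hbt⟩ := T
    obtain ⟨i, j⟩ := x
    obtain ⟨u, v⟩ := p
    subst hT'
    rw [mem_neighbors] at hx
    rw [mem_cells] at hp hxT
    simp only [Box.semi] at hodd
    dsimp only at hp hxT hx
    simp only [mem_cells, mem_neighbors, Near, join, single, Box.mk.injEq, Box.semi]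
    obtain ⟨rfl, h⟩ | ⟨rfl, h⟩ | ⟨rfl, h⟩ | ⟨rfl, h⟩ : (i = r + 1 ∧ b ≤ j ∧ j ≤ t) ∨
      (i = l - 1 ∧ b ≤ j ∧ j ≤ t) ∨ (j = t + 1 ∧ l ≤ i ∧ i ≤ r) ∨ (j = b - 1 ∧ l ≤ i ∧ i ≤ r) := by
      omega
    · by_cases hd : b < t
      · exact ⟨⟨l, r, b, t - 1, by omega, by omega⟩, (r, t - 1), (r + 1, t), (r, t),
          by dsimp only; omega⟩
      · exact ⟨⟨l, r - 1, b, t, by omega, by omega⟩, (r - 1, b), (r + 1, b), (r, b),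
          by dsimp only; omega⟩
    · by_cases hd : b < t
      · exact ⟨⟨l, r, b, t - 1, by omega, by omega⟩, (l, t - 1), (l - 1, t), (l, t),
          by dsimp only; omega⟩
      · exact ⟨⟨l + 1, r, b, t, by omega, by omega⟩, (l + 1, b), (l - 1, b), (l, b),
          by dsimp only; omega⟩
    · by_cases hd : l < r
      · exact ⟨⟨l, r - 1, b, t, by omega, by omega⟩, (r - 1, t), (r, t + 1), (r, t),
          by dsimp only; omega⟩
      · exact ⟨⟨l, r, b, t - 1, by omega, by omega⟩, (l, t - 1), (l, t + 1), (l, t),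
          by dsimp only; omega⟩
    · by_cases hd : l < r
      · exact ⟨⟨l, r - 1, b, t, by omega, by omega⟩, (r - 1, b), (r, b - 1), (r, b),
          by dsimp only; omega⟩
      · exact ⟨⟨l, r, b + 1, t, by omega, by omega⟩, (l, b + 1), (l, b - 1), (l, b),
          by dsimp only; omega⟩
  obtain ⟨E, hE, hEc, -, hcE⟩ := exists_tight S c hc
  refine ⟨E, y, q, ?_, ?_, ⟨y, by simp, c, by simp [hcE hcorner], ?_, hyq, hcq⟩, by omega⟩
  · rw [← hyT, Finset.insert_eq, Finset.union_comm]
    exact hE.union (spans_singleton y) hy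
  · rw [← hqT, Finset.insert_eq, Finset.union_comm]
    exact hE.union (spans_singleton q) hq
  · rintro rfl
    exact hyS hc

/-- A box grows by one line next to a family of other boxes, if there are enough coins for minimum
configurations of all these boxes. -/
theorem Good.grow {N : ℕ} {B : Configuration} {𝓤 : Finset Box} {T T' : Box} {x p : ℤ × ℤ}
    (hp : p ∈ T.cells) (hx : x ∈ neighbors p) (hT' : join T (single x) = T') (hxT : x ∉ T.cells)
    (hs : T.semi + 2 * (∑ Q ∈ 𝓤, (tight Q).card : ℕ) + 5 ≤ 2 * N)
    (h : Good N B (hull (withFamily 𝓤 T))) : Good N B (hull (withFamily 𝓤 T')) := by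
  have hnear : Near T (single x) := by
    refine near_of_mem hp (show x ∈ (single x).cells by simp [cells_single]) ?_
    rw [mem_neighbors] at hx
    simp only [abs]
    omega
  rcases Int.emod_two_eq_zero_or_one T.semi with heven | hodd
  -- if the half-perimeter is even, then a minimum configuration of `T'` is one of `T` and the coin
  -- `x`; if it is odd, then both have the same size, and `exists_shift` applies
  · have hspan : Spans (insert x (tight T)) T' := by
      rw [← hT', Finset.insert_eq, Finset.union_comm]
      exact (spans_tight T).union (spans_singleton x) hnear
    have h1 := two_mul_card_tight_le T
    have h2 := card_union_tight_le (tight T) 𝓤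
    have h3 := card_union_tight_le (insert x (tight T)) 𝓤
    have h4 := Finset.card_insert_le x (tight T)
    exact h.of_peb (hull_union_tight (spans_tight T) 𝓤) (by omega) (hull_union_tight hspan 𝓤)
      (by omega) (Peb.drop (Finset.union_subset_union_left (Finset.subset_insert _ _)))
  · obtain ⟨E, y, q, hy, hq, hyq, hc⟩ := exists_shift hp hx hT' hxT hodd
    have h2 := card_union_tight_le (insert y E) 𝓤
    have h3 := card_union_tight_le (insert q E) 𝓤
    have h4 := Finset.card_insert_le y E
    have h5 := Finset.card_insert_le q E
    refine h.of_peb (hull_union_tight hq 𝓤) (by omega) (hull_union_tight hy 𝓤) (by omega) ?_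
    refine (Peb.add (p := q) (hyq.mono (Finset.coe_subset.2 Finset.subset_union_left))
        (by omega)).trans (Peb.drop ?_)
    intro z hz
    simp only [Finset.mem_union, Finset.mem_insert] at hz ⊢
    tauto

/-- There are enough coins for the box `T` to grow by one line: `T` can first absorb some boxes of
the family, and minimum configurations of the resulting box and of the other boxes are small enough.
-/
def Ready (N : ℕ) (𝓠 : Finset Box) (T : Box) : Prop :=
  ∃ T₁ : Box, ∃ 𝓤 ⊆ 𝓠, T.cells ⊆ T₁.cells ∧ T₁.cells ⊆ hull (withFamily 𝓠 T) ∧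
    (∀ Q ∈ 𝓠, Q ∉ 𝓤 → Q.cells ⊆ T₁.cells) ∧
    T₁.semi + 2 * (∑ Q ∈ 𝓤, (tight Q).card : ℕ) + 5 ≤ 2 * N

theorem cells_subset_withFamily (𝓠 : Finset Box) (T : Box) : T.cells ⊆ withFamily 𝓠 T :=
  Set.subset_union_left

theorem subset_withFamily {𝓠 : Finset Box} (T : Box) {Q : Box} (hQ : Q ∈ 𝓠) :
    Q.cells ⊆ withFamily 𝓠 T :=
  (Set.subset_biUnion_of_mem (u := fun Q : Box => Q.cells) hQ).trans Set.subset_union_right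

theorem withFamily_subset {𝓠 : Finset Box} {T : Box} {S : Set (ℤ × ℤ)} (hT : T.cells ⊆ S)
    (h : ∀ Q ∈ 𝓠, Q.cells ⊆ S) : withFamily 𝓠 T ⊆ S :=
  Set.union_subset hT (Set.iUnion₂_subset h)

/-- If `Ready N 𝓠 T` holds, then the box `T` can grow by the line of a position `x` next to it: this
is `Good.grow` for the box that has absorbed some members of the family, or there is nothing to do
if `x` has been absorbed as well. -/
theorem Good.step {N : ℕ} {B : Configuration} {𝓠 : Finset Box} {T T' : Box} (x p : ℤ × ℤ)
    (hr : Ready N 𝓠 T) (hp : p ∈ T.cells) (hx : x ∈ neighbors p) (hT' : join T (single x) = T')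
    (h : Good N B (hull (withFamily 𝓠 T))) : Good N B (hull (withFamily 𝓠 T')) := by
  obtain ⟨T₁, 𝓤, hU, hT, hT₁, habs, hs⟩ := hr
  have hnear : ∀ P : Box, p ∈ P.cells → Near P (single x) := by
    intro P hp
    refine near_of_mem hp (show x ∈ (single x).cells by simp [cells_single]) ?_
    rw [mem_neighbors] at hx
    simp only [abs]
    omega
  have hTT' : T.cells ⊆ T'.cells := hT' ▸ left_subset_join _ _
  have hxT' : (single x).cells ⊆ T'.cells := hT' ▸ right_subset_join _ _
  by_cases hxT₁ : x ∈ T₁.cells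
  · have hT'₁ : T'.cells ⊆ T₁.cells := by
      rw [← hT']
      exact (closed_cells T₁).join_subset hT (by rw [cells_single]; simpa using hxT₁) (hnear T hp)
    rwa [hull_congr (T := withFamily 𝓠 T) (withFamily_subset (hT'₁.trans hT₁)
      fun Q hQ => (subset_withFamily T hQ).trans (subset_hull _))
      (withFamily_subset (hTT'.trans ((cells_subset_withFamily 𝓠 T').trans (subset_hull _)))
      fun Q hQ => (subset_withFamily T' hQ).trans (subset_hull _))]
  · have e : hull (withFamily 𝓠 T) = hull (withFamily 𝓤 T₁) := by
      refine hull_congr (withFamily_subset ?_ fun Q hQ => ?_) (withFamily_subset hT₁ fun Q hQ => ?_)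
      · exact hT.trans ((cells_subset_withFamily 𝓤 T₁).trans (subset_hull _))
      · by_cases hQU : Q ∈ 𝓤
        · exact (subset_withFamily T₁ hQU).trans (subset_hull _)
        · exact (habs Q hQ hQU).trans ((cells_subset_withFamily 𝓤 T₁).trans (subset_hull _))
      · exact (subset_withFamily T (hU hQ)).trans (subset_hull _)
    have e' : hull (withFamily 𝓠 T') = hull (withFamily 𝓤 (join T₁ (single x))) := by
      have h1 : T₁.cells ⊆ (join T₁ (single x)).cells := left_subset_join _ _
      have h2 : (join T₁ (single x)).cells ⊆ hull (withFamily 𝓤 (join T₁ (single x))) :=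
        (cells_subset_withFamily 𝓤 _).trans (subset_hull _)
      refine hull_congr (withFamily_subset ?_ fun Q hQ => ?_) (withFamily_subset ?_ fun Q hQ => ?_)
      · rw [← hT']
        exact (closed_hull _).join_subset (hT.trans (h1.trans h2))
          ((right_subset_join _ _).trans h2) (hnear T hp)
      · by_cases hQU : Q ∈ 𝓤
        · exact (subset_withFamily _ hQU).trans (subset_hull _)
        · exact (habs Q hQ hQU).trans (h1.trans h2)
      · have h3 : T'.cells ⊆ hull (withFamily 𝓠 T') :=
          (cells_subset_withFamily 𝓠 T').trans (subset_hull _)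
        refine (closed_hull _).join_subset (hT₁.trans (hull_subset_hull (withFamily_subset
          (hTT'.trans h3) fun Q hQ => (subset_withFamily T' hQ).trans (subset_hull _))))
          (hxT'.trans h3) (hnear T₁ (hT hp))
      · exact (subset_withFamily T' (hU hQ)).trans (subset_hull _)
    rw [e']
    rw [e] at h
    exact h.grow (hT hp) hx rfl hxT₁ hs

/-! ### Growing an interval -/

/-- An interval grows from `[a, c]` to `[p, q]`, first at the right end and then at the left end. -/
theorem extend_interval {Φ : ℤ → ℤ → Prop} {p a c q : ℤ} (hpa : p ≤ a) (hcq : c ≤ q)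
    (right : ∀ a' c', p ≤ a' → a' ≤ a → c ≤ c' → c' < q → Φ a' c' → Φ a' (c' + 1))
    (left : ∀ a' c', p < a' → a' ≤ a → c ≤ c' → c' ≤ q → Φ a' c' → Φ (a' - 1) c') (h : Φ a c) :
    Φ p q := by
  have h1 : ∀ k : ℕ, c + k ≤ q → Φ a (c + k) := by
    intro k
    induction k with
    | zero => exact fun _ => by simpa using h
    | succ k ih =>
      intro hk
      push_cast at hk ⊢
      rw [← add_assoc]
      exact right _ _ hpa le_rfl (by omega) (by omega) (ih (by omega))
  have h2 : ∀ k : ℕ, p ≤ a - k → Φ (a - k) q := by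
    intro k
    induction k with
    | zero =>
      intro _
      have := h1 (q - c).toNat (by omega)
      rw [show c + ((q - c).toNat : ℤ) = q by omega] at this
      simpa using this
    | succ k ih =>
      intro hk
      push_cast at hk ⊢
      rw [← sub_sub]
      exact left _ _ (by omega) (by omega) hcq le_rfl (ih (by omega))
  have := h2 (a - p).toNat (by omega)
  rwa [show a - ((a - p).toNat : ℤ) = p by omega] at this

/-- Let `H (q + 1) - H p` be the weight of the interval `[p, q]`. If an interval can grow whenever
its weight is at least its length plus `κ`, and the process can start at every point of weight at
least `2 * κ - 1`, then it reaches every interval of weight at least twice its length plus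
`2 * κ - 3`: when neither growing from the right end nor growing from the left end works, then a
final and an initial part have small weight, so the part between them has even more weight than
needed. -/
theorem interval_chain {H : ℤ → ℤ} (hH : Monotone H) {κ : ℤ} (hκ : κ ≤ 1) {Φ : ℤ → ℤ → Prop}
    {l r : ℤ} (start : ∀ c, l ≤ c → c ≤ r → 2 * κ - 1 ≤ H (c + 1) - H c → Φ c c)
    (right : ∀ p q, l ≤ p → p ≤ q → q < r → q + 1 - p + κ ≤ H (q + 1) - H p → Φ p q → Φ p (q + 1))
    (left : ∀ p q, l < p → p ≤ q → q ≤ r → q + 1 - p + κ ≤ H (q + 1) - H p → Φ p q → Φ (p - 1) q)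
    {p q : ℤ} (hpq : p ≤ q) (hlp : l ≤ p) (hqr : q ≤ r)
    (h : 2 * (q + 1 - p) + 2 * κ - 3 ≤ H (q + 1) - H p) : Φ p q := by
  obtain ⟨n, hn⟩ : ∃ n : ℕ, q - p ≤ n := ⟨_, Int.self_le_toNat _⟩
  induction n generalizing p q with
  | zero =>
    obtain rfl : p = q := by omega
    exact start p hlp hqr (by omega)
  | succ n ih =>
    by_cases hs : ∃ i, p < i ∧ i ≤ q ∧ H (q + 1) - H i < q + 1 - i + κ
    · by_cases ht : ∃ j, p ≤ j ∧ j < q ∧ H (j + 1) - H p < j + 1 - p + κ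
      · obtain ⟨i, hi, hi', hiH⟩ := hs
        obtain ⟨j, hj, hj', hjH⟩ := ht
        by_cases hji : j + 1 ≤ i - 1
        · have hmid : Φ (j + 1) (i - 1) := by
            refine ih hji (by omega) (by omega) ?_ (by omega)
            rw [show i - 1 + 1 = i by ring]
            omega
          refine extend_interval (a := j + 1) (c := i - 1) (by omega) (by omega) ?_ ?_ hmid
          · intro a' c' h1 h2 h3 h4 h5
            have m1 := hH h2
            have m2 := hH (show i ≤ c' + 1 by omega)
            exact right a' c' (by omega) (by omega) (by omega) (by omega) h5
          · intro a' c' h1 h2 h3 h4 h5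
            have m1 := hH h2
            have m2 := hH (show i ≤ c' + 1 by omega)
            exact left a' c' (by omega) (by omega) (by omega) (by omega) h5
        -- otherwise the two parts cover the interval, and its weight is too small
        · have m := hH (show i ≤ j + 1 by omega)
          omega
      · push Not at ht
        have h0 := ht p le_rfl
        refine extend_interval (a := p) (c := p) le_rfl hpq ?_ ?_ ?_
        · intro a' c' h1 h2 h3 h4 h5
          obtain rfl : a' = p := by omega
          exact right a' c' hlp h3 (by omega) (ht c' h3 h4) h5
        · intro a' c' h1 h2
          omega
        · by_cases hpq' : p < q
          · exact start p hlp (by omega) (by have := h0 hpq'; omega)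
          · obtain rfl : p = q := by omega
            exact start p hlp hqr (by omega)
    · push Not at hs
      have h0 := hs q
      refine extend_interval (a := q) (c := q) hpq le_rfl ?_ ?_ ?_
      · intro a' c' h1 h2 h3 h4
        omega
      · intro a' c' h1 h2 h3 h4 h5
        obtain rfl : c' = q := by omega
        exact left a' c' (by omega) h2 hqr (hs a' h1 h2) h5
      · by_cases hpq' : p < q
        · exact start q (by omega) hqr (by have := h0 hpq' le_rfl; omega)
        · obtain rfl : p = q := by omega
          exact start p hlp hqr (by omega)

/-! ### Growing to the whole rectangle -/

/-- The share of the box `Q` in the weight of the columns to the left of `x`: every column of `Q`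
counts once, and the first one counts so much more that the total is `2 * (tight Q).card`. -/
noncomputable def leftWeight (Q : Box) (x : ℤ) : ℤ :=
  if x ≤ Q.l then 0 else 2 * (tight Q).card - (Q.r + 1 - min x (Q.r + 1))

theorem monotone_leftWeight (Q : Box) : Monotone (leftWeight Q) := by
  intro x y hxy
  have h1 := (spans_tight Q).semi_le
  have h2 := Q.hlr
  have h3 := Q.hbt
  simp only [Box.semi] at h1
  simp only [leftWeight]
  split_ifs <;> omega

section Grid

variable {N : ℕ} {B : Configuration} {𝓠 : Finset Box} {l r b t : ℤ}

/-- A column of the rectangle grows from one position. -/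
theorem good_column (hbt : b ≤ t) {c j : ℤ} (hj : b ≤ j) (hjt : j ≤ t)
    (hr : ∀ (j₁ j₂ : ℤ) (h : j₁ ≤ j₂), b ≤ j₁ → j₁ ≤ j → j ≤ j₂ → j₂ ≤ t → j₂ - j₁ < t - b →
      Ready N 𝓠 ⟨c, c, j₁, j₂, le_rfl, h⟩)
    (h : Good N B (hull (withFamily 𝓠 (single (c, j))))) :
    Good N B (hull (withFamily 𝓠 ⟨c, c, b, t, le_rfl, hbt⟩)) := by
  refine extend_interval (a := j) (c := j) (Φ := fun j₁ j₂ => ∀ h : j₁ ≤ j₂,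
    Good N B (hull (withFamily 𝓠 ⟨c, c, j₁, j₂, le_rfl, h⟩))) hj hjt ?_ ?_ (fun _ => h) hbt
  · intro j₁ j₂ h1 h2 h3 h4 h5 _
    refine (h5 (by omega)).step (c, j₂ + 1) (c, j₂) (hr j₁ j₂ _ h1 h2 h3 (by omega) (by omega))
      ⟨le_rfl, le_rfl, by dsimp only; omega, le_rfl⟩ (by rw [mem_neighbors]; dsimp only; omega) ?_
    simp only [join, single, Box.mk.injEq, min_self, max_self, true_and]
    omega
  · intro j₁ j₂ h1 h2 h3 h4 h5 _
    refine (h5 (by omega)).step (c, j₁ - 1) (c, j₁) (hr j₁ j₂ _ (by omega) h2 h3 h4 (by omega))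
      ⟨le_rfl, le_rfl, le_rfl, by dsimp only; omega⟩ (by rw [mem_neighbors]; dsimp only; omega) ?_
    simp only [join, single, Box.mk.injEq, min_self, max_self, true_and]
    omega

/-- A growing column may start anywhere when there are enough coins for minimum configurations of
the family and a column of the rectangle. -/
theorem good_column_of_slack (hbt : b ≤ t) (c : ℤ)
    (hB : hull (B : Set (ℤ × ℤ)) = ⋃ Q ∈ 𝓠, Q.cells) (hBc : B.card + 2 ≤ N)
    (hs : (t - b + 1) + 2 * (∑ Q ∈ 𝓠, (tight Q).card : ℕ) + 5 ≤ 2 * (N : ℤ)) :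
    Good N B (hull (withFamily 𝓠 ⟨c, c, b, t, le_rfl, hbt⟩)) := by
  refine good_column hbt (j := b) le_rfl hbt ?_ ?_
  · intro j₁ j₂ h h1 h2 h3 h4 h5
    refine ⟨_, 𝓠, subset_rfl, subset_rfl, (cells_subset_withFamily _ _).trans (subset_hull _),
      fun Q hQ hQ' => absurd hQ hQ', ?_⟩
    simp only [Box.semi]
    omega
  · have h0 := card_union_tight_le {(c, b)} 𝓠
    have h1 : (𝓠.biUnion tight).card ≤ _ := Finset.card_biUnion_le
    rw [Finset.card_singleton] at h0
    refine (good_self hBc).of_peb (D := 𝓠.biUnion tight) ?_ (by omega)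
      (hull_union_tight (spans_singleton (c, b)) 𝓠) (by omega)
      (Peb.drop Finset.subset_union_right)
    rw [hull_biUnion_tight, ← hB, hull_hull]

/-- A growing column may start in a box of the family, and absorb it. -/
theorem good_column_of_mem (hbt : b ≤ t) {c : ℤ}
    (hB : hull (B : Set (ℤ × ℤ)) = ⋃ Q ∈ 𝓠, Q.cells) (hBc : B.card + 2 ≤ N)
    (hs : (t - b + 1) + 2 * (∑ Q ∈ 𝓠, (tight Q).card : ℕ) + 3 ≤ 2 * (N : ℤ)) {Q : Box} (hQ : Q ∈ 𝓠)
    (hQb : b ≤ Q.b) (hQt : Q.t ≤ t) (hl : Q.l ≤ c) (hr : c ≤ Q.r) :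
    Good N B (hull (withFamily 𝓠 ⟨c, c, b, t, le_rfl, hbt⟩)) := by
  classical
  have h1 := Q.hbt
  refine good_column hbt (j := Q.b) hQb (by omega) ?_ ?_
  · intro j₁ j₂ h h2 h3 h4 h5 h6
    have hnear : Near ⟨c, c, j₁, j₂, le_rfl, h⟩ Q := by
      simp only [Near]
      omega
    refine ⟨_, 𝓠.erase Q, Finset.erase_subset _ _, left_subset_join _ Q, ?_, ?_, ?_⟩
    · exact (closed_hull _).join_subset ((cells_subset_withFamily _ _).trans (subset_hull _))
        ((subset_withFamily _ hQ).trans (subset_hull _)) hnear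
    · intro P hP hPU
      obtain rfl : P = Q := by
        by_contra hne
        exact hPU (Finset.mem_erase.2 ⟨hne, hP⟩)
      exact right_subset_join _ _
    · have h7 := Finset.add_sum_erase 𝓠 (fun Q => (tight Q).card) hQ
      have h8 := (spans_tight Q).semi_le
      simp only [Box.semi, join] at h8 ⊢
      omega
  · have e : hull (B : Set (ℤ × ℤ)) = hull (withFamily 𝓠 (single (c, Q.b))) := by
      refine hull_congr (((subset_hull _).trans hB.subset).trans
        (Set.subset_union_right.trans (subset_hull _))) ?_
      rw [hB]
      refine withFamily_subset ?_ fun P hP => Set.subset_biUnion_of_mem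
          (u := fun Q : Box => Q.cells) hP
      rw [cells_single, Set.singleton_subset_iff]
      exact Set.mem_biUnion hQ ⟨hl, hr, le_rfl, h1⟩
    exact e ▸ good_self hBc

/-- An interval of columns can absorb all boxes that it touches. -/
theorem exists_absorb (hbt : b ≤ t) (h𝓠 : ∀ Q ∈ 𝓠, b ≤ Q.b ∧ Q.t ≤ t) {p q : ℤ} (hpq : p ≤ q)
    {𝓢 : Finset Box} (hS : 𝓢 ⊆ 𝓠) (htouch : ∀ Q ∈ 𝓢, Q.l ≤ q ∧ p ≤ Q.r) :
    ∃ T₁ : Box, Box.cells ⟨p, q, b, t, hpq, hbt⟩ ⊆ T₁.cells ∧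
      T₁.cells ⊆ hull (withFamily 𝓠 ⟨p, q, b, t, hpq, hbt⟩) ∧ (∀ Q ∈ 𝓢, Q.cells ⊆ T₁.cells) ∧
      T₁.b = b ∧ T₁.t = t ∧ T₁.r - T₁.l ≤ q - p +
        ∑ Q ∈ 𝓢, (2 * ((tight Q).card : ℤ) - (leftWeight Q (q + 1) - leftWeight Q p)) := by
  classical
  induction 𝓢 using Finset.induction_on with
  | empty =>
    exact ⟨_, subset_rfl, (cells_subset_withFamily _ _).trans (subset_hull _), by simp, rfl, rfl,
      by simp⟩
  | insert Q 𝓢 hQS ih =>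
    obtain ⟨T₁, hT, hT₁, habs, hb, ht, hw⟩ := ih (fun P hP => hS (Finset.mem_insert_of_mem hP))
      (fun P hP => htouch P (Finset.mem_insert_of_mem hP))
    have hQ := hS (Finset.mem_insert_self Q 𝓢)
    have h1 := h𝓠 Q hQ
    have h2 := htouch Q (Finset.mem_insert_self Q 𝓢)
    have h3 := cells_subset_iff.1 hT
    have h4 := (spans_tight Q).semi_le
    have h5 := Q.hlr
    have h6 := Q.hbt
    dsimp only at h3
    have hnear : Near T₁ Q := by
      simp only [Near]
      omega
    refine ⟨join T₁ Q, hT.trans (left_subset_join _ _), ?_, ?_, ?_, ?_, ?_⟩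
    · exact (closed_hull _).join_subset hT₁ ((subset_withFamily _ hQ).trans (subset_hull _)) hnear
    · intro P hP
      rcases Finset.mem_insert.1 hP with rfl | hP
      · exact right_subset_join _ _
      · exact (habs P hP).trans (left_subset_join _ _)
    · simp only [join]; omega
    · simp only [join]; omega
    · rw [Finset.sum_insert hQS]
      simp only [Box.semi] at h4
      generalize ∑ Q ∈ 𝓢, (2 * ((tight Q).card : ℤ) - (leftWeight Q (q + 1) - leftWeight Q p)) = s
        at hw ⊢
      simp only [join, leftWeight]
      split_ifs <;> omega

/-- Let `h` be the height of the rectangle and `κ = h + 2 * ∑ (tight Q).card + 5 - 2 * N`. An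
interval of columns can grow if its weight is at least its length plus `κ`: absorbing the boxes that
it touches gains the part of their coins that is counted in its weight. -/
theorem ready_of_weight (hbt : b ≤ t) (h𝓠 : ∀ Q ∈ 𝓠, b ≤ Q.b ∧ Q.t ≤ t) {p q : ℤ} (hpq : p ≤ q)
    (hw : q + 1 - p + ((t - b + 1) + 2 * (∑ Q ∈ 𝓠, (tight Q).card : ℕ) + 5 - 2 * N) ≤
      ∑ Q ∈ 𝓠, leftWeight Q (q + 1) - ∑ Q ∈ 𝓠, leftWeight Q p) :
    Ready N 𝓠 ⟨p, q, b, t, hpq, hbt⟩ := by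
  classical
  obtain ⟨T₁, hT, hT₁, habs, hb, ht, hw₁⟩ := exists_absorb hbt h𝓠 hpq
    (𝓢 := 𝓠.filter fun Q => Q.l ≤ q ∧ p ≤ Q.r) (Finset.filter_subset _ _)
    (fun Q hQ => (Finset.mem_filter.1 hQ).2)
  refine ⟨T₁, 𝓠.filter fun Q => ¬ (Q.l ≤ q ∧ p ≤ Q.r), Finset.filter_subset _ _, hT, hT₁, ?_, ?_⟩
  · intro Q hQ hQ'
    refine habs Q (Finset.mem_filter.2 ⟨hQ, ?_⟩)
    by_contra h
    exact hQ' (Finset.mem_filter.2 ⟨hQ, h⟩)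
  · have h1 := Finset.sum_filter_add_sum_filter_not 𝓠 (fun Q => Q.l ≤ q ∧ p ≤ Q.r)
      (fun Q => (2 * ((tight Q).card : ℤ) - (leftWeight Q (q + 1) - leftWeight Q p)))
    have h2 : ∑ Q ∈ 𝓠.filter (fun Q => ¬ (Q.l ≤ q ∧ p ≤ Q.r)),
        (2 * ((tight Q).card : ℤ) - (leftWeight Q (q + 1) - leftWeight Q p)) =
        ∑ Q ∈ 𝓠.filter (fun Q => ¬ (Q.l ≤ q ∧ p ≤ Q.r)), 2 * ((tight Q).card : ℤ) := by
      refine Finset.sum_congr rfl fun Q hQ => ?_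
      have h3 := (Finset.mem_filter.1 hQ).2
      have h4 := Q.hlr
      simp only [leftWeight]
      split_ifs <;> omega
    have h5 : ∑ Q ∈ 𝓠, (2 * ((tight Q).card : ℤ) - (leftWeight Q (q + 1) - leftWeight Q p)) =
        2 * ∑ Q ∈ 𝓠, ((tight Q).card : ℤ) -
          (∑ Q ∈ 𝓠, leftWeight Q (q + 1) - ∑ Q ∈ 𝓠, leftWeight Q p) := by
      rw [Finset.sum_sub_distrib, Finset.sum_sub_distrib, ← Finset.mul_sum]
    rw [h2, h5, ← Finset.mul_sum] at h1
    simp only [Box.semi]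
    push_cast at hw ⊢
    omega

end Grid

/-- All configurations that span the rectangle `R` can be transformed into `B`, if the boxes of the
hull of `B` lie in `R`. With `κ` as in `ready_of_weight`, the assumptions on `N` and the fact that
`R` is at least as wide as it is high imply `κ ≤ 1`, and that the total weight is large enough for
`interval_chain`. If `κ ≤ 0`, then the first column can be put anywhere; if `κ = 1`, then a column
of positive weight is available, and it is put into the box of the family to which this column
belongs. -/
theorem good_box {N : ℕ} {B : Configuration} {𝓠 : Finset Box} {R : Box}
    (hwide : R.t - R.b ≤ R.r - R.l)
    (hB : hull (B : Set (ℤ × ℤ)) = ⋃ Q ∈ 𝓠, Q.cells) (hBc : B.card + 2 ≤ N)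
    (h𝓠 : ∀ Q ∈ 𝓠, Q.cells ⊆ R.cells) (hR : 3 * R.semi + 8 ≤ 4 * N)
    (hV : 3 * (∑ Q ∈ 𝓠, (tight Q).card) + 4 ≤ 2 * N) : Good N B R.cells := by
  have h𝓠' : ∀ Q ∈ 𝓠, R.b ≤ Q.b ∧ Q.t ≤ R.t := fun Q hQ => by
    have := cells_subset_iff.1 (h𝓠 Q hQ)
    omega
  have hlr := R.hlr
  have hbt := R.hbt
  simp only [Box.semi] at hR
  have key := interval_chain (H := fun x => ∑ Q ∈ 𝓠, leftWeight Q x)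
    (κ := (R.t - R.b + 1) + 2 * (∑ Q ∈ 𝓠, (tight Q).card : ℕ) + 5 - 2 * N)
    (Φ := fun p q => ∀ h : p ≤ q, Good N B (hull (withFamily 𝓠 ⟨p, q, R.b, R.t, h, hbt⟩)))
    (l := R.l) (r := R.r) (fun x y hxy => Finset.sum_le_sum fun Q _ => monotone_leftWeight Q hxy)
    (by omega) ?_ ?_ ?_ hlr le_rfl le_rfl ?_ hlr
  · have e : hull (withFamily 𝓠 R) = R.cells :=
      (hull_subset (withFamily_subset subset_rfl h𝓠) (closed_cells R)).antisymm
        ((cells_subset_withFamily 𝓠 R).trans (subset_hull _))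
    rwa [e] at key
  · intro c _ _ hc _
    by_cases hκ : (R.t - R.b + 1) + 2 * (∑ Q ∈ 𝓠, (tight Q).card : ℕ) + 5 - 2 * (N : ℤ) ≤ 0
    · exact good_column_of_slack hbt c hB hBc (by omega)
    · obtain ⟨Q, hQ, hlt⟩ := Finset.exists_lt_of_sum_lt
        (show ∑ Q ∈ 𝓠, leftWeight Q c < ∑ Q ∈ 𝓠, leftWeight Q (c + 1) by omega)
      have h1 : Q.l ≤ c ∧ c ≤ Q.r := by
        by_contra h
        refine hlt.not_ge ?_
        have := Q.hlr
        simp only [leftWeight]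
        split_ifs <;> omega
      exact good_column_of_mem hbt hB hBc (by omega) hQ (h𝓠' Q hQ).1 (h𝓠' Q hQ).2 h1.1 h1.2
  · intro p q _ hpq _ hw h _
    refine (h hpq).step (q + 1, R.b) (q, R.b) (ready_of_weight hbt h𝓠' hpq (by omega))
      ⟨hpq, le_rfl, le_rfl, hbt⟩ (by rw [mem_neighbors]; dsimp only; omega) ?_
    simp only [join, single, Box.mk.injEq]
    omega
  · intro p q _ hpq _ hw h _
    refine (h hpq).step (p - 1, R.b) (p, R.b) (ready_of_weight hbt h𝓠' hpq (by omega))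
      ⟨le_rfl, hpq, le_rfl, hbt⟩ (by rw [mem_neighbors]; dsimp only; omega) ?_
    simp only [join, single, Box.mk.injEq]
    omega
  · have h1 : ∑ Q ∈ 𝓠, leftWeight Q (R.r + 1) = ∑ Q ∈ 𝓠, 2 * ((tight Q).card : ℤ) :=
      Finset.sum_congr rfl fun Q hQ => by
        have := cells_subset_iff.1 (h𝓠 Q hQ)
        have := Q.hlr
        simp only [leftWeight]
        split_ifs <;> omega
    have h2 : ∑ Q ∈ 𝓠, leftWeight Q R.l = 0 :=
      Finset.sum_eq_zero fun Q hQ => by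
        have := cells_subset_iff.1 (h𝓠 Q hQ)
        simp only [leftWeight]
        split_ifs <;> omega
    rw [← Finset.mul_sum] at h1
    rw [h1, h2]
    push_cast at hV ⊢
    have hV' : 3 * (∑ Q ∈ 𝓠, ((tight Q).card : ℤ)) + 4 ≤ 2 * N := by exact_mod_cast hV
    omega

/-- The case of `peb_of_spans` in which the rectangle is at least as wide as it is high. -/
theorem peb_of_wide {N : ℕ} {A B D : Configuration} {R : Box} (hwide : R.t - R.b ≤ R.r - R.l)
    (hA : Spans A R) (hAc : A.card + 2 ≤ N) (hB : (B : Set (ℤ × ℤ)) ⊆ R.cells)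
    (hBc : B.card + 2 ≤ N)
    (hR : 3 * R.semi + 8 ≤ 4 * N) (hD : hull (D : Set (ℤ × ℤ)) = hull (B : Set (ℤ × ℤ)))
    (hDc : 3 * D.card + 4 ≤ 2 * N) : Peb N A B := by
  obtain ⟨𝓠, hfar, h𝓠⟩ := exists_far_family B
  refine good_box hwide h𝓠 hBc (fun Q hQ => ?_) hR ?_ A hA hAc
  · exact (Set.subset_biUnion_of_mem (u := fun Q : Box => Q.cells) hQ).trans
      (h𝓠.symm.subset.trans (hull_subset hB (closed_cells R)))
  · have := sum_card_tight_le hfar (hD.trans h𝓠)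
    omega

/-- A configuration spanning a rectangle can be transformed into any configuration in the rectangle,
provided that both leave two of `N` pebbles unused and `N` is at least `3 / 2` times the sizes of
minimum configurations, plus two. For the rectangle, `R.semi / 2` stands for this size. -/
theorem peb_of_spans {N : ℕ} {A B D : Configuration} {R : Box}
    (hA : Spans A R) (hAc : A.card + 2 ≤ N) (hB : (B : Set (ℤ × ℤ)) ⊆ R.cells)
    (hBc : B.card + 2 ≤ N)
    (hR : 3 * R.semi + 8 ≤ 4 * N) (hD : hull (D : Set (ℤ × ℤ)) = hull (B : Set (ℤ × ℤ)))
    (hDc : 3 * D.card + 4 ≤ 2 * N) : Peb N A B := by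
  rcases le_total (R.t - R.b) (R.r - R.l) with h | h
  · exact peb_of_wide h hA hAc hB hBc hR hD hDc
  · have := (peb_of_wide (A := A.image Prod.swap) (B := B.image Prod.swap) (D := D.image Prod.swap)
      (R := R.transpose) (N := N) h hA.transpose
      ((Nat.add_le_add_right Finset.card_image_le 2).trans hAc) ?_
      ((Nat.add_le_add_right Finset.card_image_le 2).trans hBc) ?_ ?_ ?_).image isFrame_swap
    · rwa [image_swap_swap, image_swap_swap] at this
    · rw [Box.cells_transpose, Finset.coe_image]
      exact Set.image_mono hB
    · simp only [Box.semi, Box.transpose] at hR ⊢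
      omega
    · rw [Finset.coe_image, Finset.coe_image, ← image_swap_hull, hD, image_swap_hull]
    · have := Finset.card_image_le (s := D) (f := Prod.swap)
      omega

/-! ### The puzzle -/

/-- A position is not its own neighbor. -/
theorem Supported.erase {C : Configuration} {p : ℤ × ℤ} (h : Supported (C : Set (ℤ × ℤ)) p) :
    Supported (C.erase p : Configuration) p := by
  obtain ⟨q, hq, r, hr, hne, hqp, hrp⟩ := h
  have h1 : ∀ q ∈ neighbors p, q ≠ p := fun q hq => by
    rintro rfl
    exact not_mem_neighbors_self _ hq
  exact ⟨q, by simpa using ⟨hq, h1 q hqp⟩, r, by simpa using ⟨hr, h1 r hrp⟩, hne, hqp, hrp⟩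

/-- Removing a coin with two neighbors does not change the hull. -/
theorem Supported.subset_hull_erase {C : Configuration} {p : ℤ × ℤ}
    (h : Supported (C : Set (ℤ × ℤ)) p) : (C : Set (ℤ × ℤ)) ⊆ hull (C.erase p : Configuration) := by
  intro q hq
  by_cases hqp : q = p
  · rw [hqp]
    exact closed_hull _ _ (h.erase.mono (subset_hull _))
  · exact subset_hull _ (Finset.mem_coe.2 (Finset.mem_erase.2 ⟨hqp, hq⟩))

/-- Without two redundant coins a configuration has the same hull, and with two pebbles the coins
can be put back. -/
theorem HasRedundantCoins.exists_subset {B : Configuration} (h : HasRedundantCoins B 2) :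
    ∃ B₀ ⊆ B, B₀.card + 2 = B.card ∧ hull (B₀ : Set (ℤ × ℤ)) = hull (B : Set (ℤ × ℤ)) ∧
      Peb B.card B₀ B := by
  obtain ⟨b, hinj, hb⟩ := h
  have hne : b 1 ≠ b 0 := hinj.ne (by decide)
  obtain ⟨h0, h0'⟩ := hb 0
  obtain ⟨h1, h1'⟩ := hb 1
  have e0 : (Finset.univ.filter (· < (0 : Fin 2))) = ∅ := by decide
  have e1 : (Finset.univ.filter (· < (1 : Fin 2))) = {0} := by decide
  rw [e0, Finset.image_empty, Finset.sdiff_empty, two_le_numNeighbors_iff] at h0'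
  rw [e1, Finset.image_singleton, Finset.sdiff_singleton_eq_erase, two_le_numNeighbors_iff] at h1'
  have h1e : b 1 ∈ B.erase (b 0) := Finset.mem_erase.2 ⟨hne, h1⟩
  have c0 := Finset.card_erase_add_one h0
  have c1 := Finset.card_erase_add_one h1e
  have hsub := (Finset.erase_subset (b 1) (B.erase (b 0))).trans (Finset.erase_subset (b 0) B)
  refine ⟨(B.erase (b 0)).erase (b 1), hsub, by omega,
    (hull_mono (Finset.coe_subset.2 hsub)).antisymm (hull_subset_hull (h0'.subset_hull_erase.trans
      (hull_subset_hull h1'.subset_hull_erase))), ?_⟩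
  have p1 := Peb.add h1'.erase (N := B.card) (by omega)
  rw [Finset.insert_erase h1e] at p1
  have p0 := Peb.add h0'.erase (N := B.card) (by omega)
  rw [Finset.insert_erase h0] at p0
  exact p1.trans p0

theorem exists_card_eq_minCard (C : Configuration) :
    ∃ D : Configuration, hull (D : Set (ℤ × ℤ)) = hull (C : Set (ℤ × ℤ)) ∧ D.card = minCard C := by
  obtain ⟨D, hD, hc⟩ := Nat.sInf_mem (s := {k | ∃ D : Configuration, span D = span C ∧ D.card = k})
    ⟨C.card, C, rfl, rfl⟩
  exact ⟨D, by rwa [← span_eq_hull, ← span_eq_hull], hc⟩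

theorem IsRectangle.exists_box {m n : ℕ} {S : Set (ℤ × ℤ)} (h : IsRectangle m n S)
    (hS : S.Nonempty) :
    ∃ R : Box, R.cells = S := by
  obtain ⟨a, b, rfl⟩ := h
  obtain ⟨⟨i, j⟩, ⟨hi, hi'⟩, hj, hj'⟩ := hS
  dsimp only at hi hi' hj hj'
  refine ⟨⟨a, a + m - 1, b, b + n - 1, by omega, by omega⟩, ?_⟩
  ext ⟨u, v⟩
  simp only [mem_cells, Set.mem_prod, Set.mem_Ico]
  omega

end CoinPuzzle

theorem mainTheorem1 (A B : CoinPuzzle.Configuration) (N m n : ℕ)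
    (hA : A.card = N) (hB : B.card = N)
    (hrect : CoinPuzzle.IsRectangle m n (CoinPuzzle.span A))
    (hsub : (B : Set (ℤ × ℤ)) ⊆ CoinPuzzle.span A)
    (hextra : CoinPuzzle.HasExtraCoins A 2)
    (hred : CoinPuzzle.HasRedundantCoins B 2)
    (hN : (N : ℝ) ≥ 3 / 2 * (max (CoinPuzzle.minCard A) (CoinPuzzle.minCard B) : ℕ) + 2) :
    CoinPuzzle.Reaches A B := by
  obtain ⟨A', hA', hA'c, hAspan⟩ := hextra
  obtain ⟨B₀, -, hB₀c, hB₀, hpeb⟩ := hred.exists_subset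
  obtain ⟨D, hD, hDc⟩ := CoinPuzzle.exists_card_eq_minCard A
  obtain ⟨E, hE, hEc⟩ := CoinPuzzle.exists_card_eq_minCard B
  have hN' : 3 * max (CoinPuzzle.minCard A) (CoinPuzzle.minCard B) + 4 ≤ 2 * N := by
    have : (3 * (max (CoinPuzzle.minCard A) (CoinPuzzle.minCard B) : ℕ) + 4 : ℝ) ≤ 2 * N := by
      linarith
    exact_mod_cast this
  have hcard := Finset.card_sdiff_add_card_eq_card hA'
  have hne : (A : Set (ℤ × ℤ)).Nonempty := by
    rw [Finset.coe_nonempty, ← Finset.card_pos]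
    omega
  simp only [CoinPuzzle.span_eq_hull] at hrect hsub hAspan
  obtain ⟨R, hR⟩ := hrect.exists_box (CoinPuzzle.hull_nonempty_iff.2 hne)
  -- only the half-perimeter of the rectangle matters, and it is bounded by the size of `D`
  have hs := CoinPuzzle.Spans.semi_le (hD.trans hR.symm)
  have hAB : CoinPuzzle.Peb N (A \ A') B₀ := by
    refine CoinPuzzle.peb_of_spans (D := E) (hAspan.trans hR.symm) (by omega) ?_ (by omega)
      (by omega) (hE.trans hB₀.symm) (by omega)
    refine (CoinPuzzle.subset_hull _).trans (hB₀.subset.trans ?_)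
    exact CoinPuzzle.hull_subset (hR ▸ hsub) R.closed_cells
  rw [hB] at hpeb
  obtain ⟨C, hC, hBC, hreach⟩ := (hAB.trans hpeb).reaches hA Finset.sdiff_subset
  -- `C` contains `B` and has as many coins
  rwa [Finset.eq_of_subset_of_card_le hBC (by omega)]
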